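/- **Theorem 1.3 (annealed CLT).** Fix an integer $d\ge 2$. *Model.* For $n\ge1$ let $G_n$ be the random $d$-regular multigraph on $n$ vertices given by the configuration model: attach $d$ half-edges to each vertex (if $dn$ is odd, one vertex gets $d+1$ half-edges) and join the half-edges by a uniformly random perfect matching; self-loops and multiple edges are allowed. Let $k_{i,j}$ be the number of edges between the vertices $i$ and $j$ ($k_{i,i}$ is the number of self-loops at $i$). For $\beta\ge0$, $B\in\mathbb R$ and $\sigma\in\{-1,1\}^n$ put $$H(\sigma)=-\beta\sum_{i\le j}k_{i,j}\sigma_i\sigma_j-B\sum_{i=1}^n\sigma_i,\qquad Z_n(\beta,B)=\sum_{\sigma\in\{-1,1\}^n}e^{-H(\sigma)},\qquad \mu_n(\sigma)=\frac{\mathbb E\big(e^{-H(\sigma)}\big)}{\mathbb E\big(Z_n(\beta,B)\big)},$$ where $\mathbb E$ is the expectation over $G_n$; $\mu_n$ is the annealed measure. Let $S_n=\sigma_1+\dots+\sigma_n$. *Parameters.* Let $\mathcal M(\beta,B)=\lim_{n\to\infty}\mathbb E_{\mu_n}(S_n/n)$ where the limit exists, let $\mathcal M(\beta,0^+)=\lim_{B\searrow0}\mathcal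 M(\beta,B)$, let $\beta_c=\inf\{\beta>0:\mathcal M(\beta,0^+)>0\}\in[0,\infty]$ (with $\inf\emptyset=\infty$), and let $$\mathcal U=\{(\beta,B):\beta\ge0,\ B\ne0\}\cup\{(\beta,0):0<\beta<\beta_c\}.$$ *Limits.* Let $$\psi(\beta,B)=\frac{\beta d}{2}-B+\max_{0\le t\le1}\Big[(t-1)\log(1-t)-t\log t+2Bt+d\int_0^{\min\{t,1-t\}}\log f(s)\,ds\Big],$$ $$f(s)=\frac{e^{-2\beta}(1-2s)+\sqrt{1+(e^{-4\beta}-1)(1-2s)^2}}{2(1-s)},$$ with the convention $0\log0=0$. *Claim.* Let $(\beta,B)\in\mathcal U$. Then the limit $$\chi(\beta,B)=\lim_{n\to\infty}\mathrm{Var}_{\mu_n}\big(S_n/\sqrt n\big)$$ exists and is finite, the function $\psi(\beta,\cdot)$ is differentiable near $B$ and twice differentiable at $B$ with $\frac{\partial^2}{\partial B^2}\psi(\beta,B)=\chi(\beta,B)$, and, as $n\to\infty$, $$\frac{S_n-\mathbb E_{\mu_n}(S_n)}{\sqrt n}\ \longrightarrow\ \mathcal N\big(0,\chi(\beta,B)\big)\quad\text{in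 distribution under }\mu_n ,$$ where $\mathcal N(0,\chi)$ is the centered Gaussian law with variance $\chi$. -/

import Mathlib

open MeasureTheory ProbabilityTheory Filter Topology
open scoped NNReal

noncomputable section

namespace AnnealedIsing

/-! ### The configuration model -/

/-- The degree sequence really used by the configuration model: if the prescribed total degree is
odd, the degree of the first vertex is increased by one. -/
def evenDegrees {n : ℕ} (D : Fin n → ℕ) (i : Fin n) : ℕ :=
  if Odd (∑ j, D j) ∧ (i : ℕ) = 0 then D i + 1 else D i

/-- Half-edges: `D i` of them are attached to the vertex `i`. -/
abbrev HalfEdge {n : ℕ} (D : Fin n → ℕ) : Type := Σ i : Fin n, Fin (D i)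

/-- Perfect matchings of the half-edges, as fixed-point-free involutions. -/
abbrev Pairing {n : ℕ} (D : Fin n → ℕ) : Type :=
  {m : Equiv.Perm (HalfEdge D) // (∀ h, m (m h) = h) ∧ ∀ h, m h ≠ h}

/-- The edges of the multigraph given by a matching: the matched pairs of half-edges. -/
def edges {n : ℕ} {D : Fin n → ℕ} (m : Pairing D) : Finset (Sym2 (HalfEdge D)) :=
  Finset.univ.image fun h => s(h, m.1 h)

/-- The number of edges between the vertices `i` and `j` (of self-loops at `i`, if `i = j`). -/
def edgeCount {n : ℕ} {D : Fin n → ℕ} (m : Pairing D) (i j : Fin n) : ℕ :=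
  ((edges m).filter fun e => e.map Sigma.fst = s(i, j)).card

/-- Expectation over the configuration model with degrees `D`, that is, over a uniformly random
perfect matching of the half-edges. -/
def graphExpect {n : ℕ} (D : Fin n → ℕ) (f : Pairing D → ℝ) : ℝ :=
  (∑ m : Pairing D, f m) / (Fintype.card (Pairing D) : ℝ)

/-- The degree sequence of the random `d`-regular graph on `n` vertices. -/
def regularDegrees (d n : ℕ) : Fin n → ℕ := evenDegrees fun _ => d

/-! ### The annealed Ising model -/

/-- Spin configurations, with spins in `{-1, 1}`. -/
abbrev Config (n : ℕ) : Type := Fin n → ℤˣ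

/-- Every set of spins is measurable. -/
instance : DiscreteMeasurableSpace ℤˣ :=
  ⟨fun s => ⟨Units.val '' s, .of_discrete, Set.preimage_image_eq _ Units.val_injective⟩⟩

/-- The spin of the vertex `i` as a real number. -/
def spin {n : ℕ} (σ : Config n) (i : Fin n) : ℝ := ((σ i : ℤ) : ℝ)

/-- The total spin `S_n`. -/
def totalSpin {n : ℕ} (σ : Config n) : ℝ := ∑ i, spin σ i

/-- The Hamiltonian `H(σ)` on the multigraph given by the matching `m`. -/
def hamiltonian {n : ℕ} {D : Fin n → ℕ} (β B : ℝ) (m : Pairing D) (σ : Config n) : ℝ :=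
  -β * ∑ i, ∑ j ∈ Finset.univ.filter (fun j => i ≤ j),
    (edgeCount m i j : ℝ) * spin σ i * spin σ j - B * ∑ i, spin σ i

/-- The partition function on the multigraph given by the matching `m`. -/
def partitionFunction {n : ℕ} {D : Fin n → ℕ} (β B : ℝ) (m : Pairing D) : ℝ :=
  ∑ σ : Config n, Real.exp (-hamiltonian β B m σ)

/-- The probability of the configuration `σ` under the annealed measure. -/
def annealedProb (d n : ℕ) (β B : ℝ) (σ : Config n) : ℝ :=
  graphExpect (regularDegrees d n) (fun m => Real.exp (-hamiltonian β B m σ)) /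
    graphExpect (regularDegrees d n) (fun m => partitionFunction β B m)

/-- The annealed measure `μ_n` of the Ising model on the random `d`-regular graph. -/
def annealedMeasure (d n : ℕ) (β B : ℝ) : Measure (Config n) :=
  ∑ σ : Config n, ENNReal.ofReal (annealedProb d n β B σ) • Measure.dirac σ

/-- The annealed magnetization `M_n(β, B)`. -/
def annealedMagnetization (d n : ℕ) (β B : ℝ) : ℝ :=
  ∫ σ, totalSpin σ / n ∂(annealedMeasure d n β B)

/-- The annealed susceptibility `χ_n(β, B)`. -/
def annealedSusceptibility (d n : ℕ) (β B : ℝ) : ℝ :=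
  variance (fun σ => totalSpin σ / √n) (annealedMeasure d n β B)

/-- `m` is the spontaneous magnetization at inverse temperature `β`: the limit, as `B ↘ 0`, of the
limit magnetization `M B = lim_n M_n(β, B)`. -/
def IsSpontaneousMagnetization (d : ℕ) (β m : ℝ) : Prop :=
  ∃ M : ℝ → ℝ,
    (∀ B, 0 < B → Tendsto (fun n => annealedMagnetization d n β B) atTop (𝓝 (M B))) ∧
    Tendsto M (𝓝[>] 0) (𝓝 m)

/-- The critical inverse temperature (it is `⊤` if there is no spontaneous magnetization). -/
def criticalBeta (d : ℕ) : EReal :=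
  sInf {b | ∃ β : ℝ, b = (β : EReal) ∧ 0 < β ∧ ∃ m, IsSpontaneousMagnetization d β m ∧ 0 < m}

/-- The region `𝒰` of parameters `(β, B)`. -/
def uniquenessRegion (d : ℕ) : Set (ℝ × ℝ) :=
  {p | (0 ≤ p.1 ∧ p.2 ≠ 0) ∨ (0 < p.1 ∧ (p.1 : EReal) < criticalBeta d ∧ p.2 = 0)}

/-! ### The limits of the thermodynamic quantities -/

/-- The function `f` in the variational formula for the pressure. -/
def fFun (β s : ℝ) : ℝ :=
  (Real.exp (-2 * β) * (1 - 2 * s) + √(1 + (Real.exp (-4 * β) - 1) * (1 - 2 * s) ^ 2)) /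
    (2 * (1 - s))

/-- The function `F` in the variational formula for the pressure. -/
def FFun (β t : ℝ) : ℝ := ∫ s in (0 : ℝ)..(min t (1 - t)), Real.log (fFun β s)

/-- The limiting annealed pressure `ψ(β, B)`. -/
def pressure (d : ℕ) (β B : ℝ) : ℝ :=
  β * d / 2 - B +
    sSup ((fun t : ℝ => (t - 1) * Real.log (1 - t) - t * Real.log t + 2 * B * t + d * FFun β t) ''
      Set.Icc 0 1)

/-- `χ` is the limiting susceptibility at `(β, B)`: it is the limit of the annealed
susceptibilities, and it is the second derivative of `ψ(β, ·)` at `B`, where `ψ(β, ·)` is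
differentiable near `B` and its derivative is differentiable at `B`. -/
def IsSusceptibility (d : ℕ) (β B χ : ℝ) : Prop :=
  Tendsto (fun n => annealedSusceptibility d n β B) atTop (𝓝 χ) ∧
    ∃ ψ' : ℝ → ℝ, (∀ᶠ b in 𝓝 B, HasDerivAt (pressure d β) (ψ' b) b) ∧ HasDerivAt ψ' χ B

/-! ### The annealed measure is a probability measure -/

lemma even_sum_evenDegrees {n : ℕ} (D : Fin n → ℕ) : Even (∑ i, evenDegrees D i) := by
  by_cases h : Odd (∑ j, D j)
  · obtain _ | n := n
    · simp
    · have : ∑ i, evenDegrees D i = ∑ i, D i + 1 := by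
        rw [Fin.sum_univ_succ, Fin.sum_univ_succ]
        simp [evenDegrees, h]
        ring
      rw [this]
      exact h.add_one
  · have : ∀ i, evenDegrees D i = D i := fun i => by simp [evenDegrees, h]
    simpa [this] using h

lemma nonempty_pairing {n : ℕ} (D : Fin n → ℕ) : Nonempty (Pairing (evenDegrees D)) := by
  obtain ⟨k, hk⟩ := even_sum_evenDegrees D
  have e : HalfEdge (evenDegrees D) ≃ Fin k ⊕ Fin k :=
    Fintype.equivOfCardEq (by simp [hk])
  refine ⟨⟨(e.trans (Equiv.sumComm _ _)).trans e.symm, fun h => by simp, fun h hh => ?_⟩⟩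
  have h1 : (e h).swap = e h := by
    have := congrArg e hh
    simpa using this
  cases h2 : e h <;> simp [h2] at h1

instance (d n : ℕ) : Nonempty (Pairing (regularDegrees d n)) := nonempty_pairing _

lemma graphExpect_pos {d n : ℕ} (f : Pairing (regularDegrees d n) → ℝ) (hf : ∀ m, 0 < f m) :
    0 < graphExpect (regularDegrees d n) f :=
  div_pos (Finset.sum_pos (fun m _ => hf m) Finset.univ_nonempty)
    (by exact_mod_cast Fintype.card_pos)

lemma annealedProb_pos (d n : ℕ) (β B : ℝ) (σ : Config n) : 0 < annealedProb d n β B σ :=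
  div_pos (graphExpect_pos _ fun _ => Real.exp_pos _)
    (graphExpect_pos _ fun _ => Finset.sum_pos (fun _ _ => Real.exp_pos _) Finset.univ_nonempty)

lemma sum_annealedProb (d n : ℕ) (β B : ℝ) : ∑ σ : Config n, annealedProb d n β B σ = 1 := by
  have h : ∑ σ : Config n, graphExpect (regularDegrees d n)
      (fun m => Real.exp (-hamiltonian β B m σ)) =
      graphExpect (regularDegrees d n) (fun m => partitionFunction β B m) := by
    simp only [graphExpect, partitionFunction]
    rw [← Finset.sum_div, Finset.sum_comm]
  simp only [annealedProb]
  rw [← Finset.sum_div, h]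
  exact div_self (graphExpect_pos _ fun _ =>
    Finset.sum_pos (fun _ _ => Real.exp_pos _) Finset.univ_nonempty).ne'

instance (d n : ℕ) (β B : ℝ) : IsProbabilityMeasure (annealedMeasure d n β B) := by
  constructor
  simp only [annealedMeasure, Measure.coe_finsetSum, Finset.sum_apply, Measure.smul_apply,
    measure_univ, smul_eq_mul, mul_one]
  rw [← ENNReal.ofReal_sum_of_nonneg fun σ _ => (annealedProb_pos d n β B σ).le,
    sum_annealedProb, ENNReal.ofReal_one]

end AnnealedIsing

end

/-!
The matching can be summed out exactly. Splitting the perfect matchings of the half-edges according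
to the partner of one of them gives a recursion for the sum of `∏ exp (β τ τ')` over matchings, and,
since `exp (β τ τ') = cosh β * (1 + τ τ' tanh β)` for spins, integration by parts gives the same
recursion for the integrals `∫ ∏ (cos θ + b τ sin θ) dθ` over a half circle, with `b ^ 2 = tanh β`
(`exists_matchingSum_eq`). This is the linearization of the pair interaction by a Gaussian variable,
in polar coordinates. So the annealed measure is a mixture over the angle `θ` of signed product
measures (`annealedProb_eq`), in which a vertex has the weight
`exp B * (cos θ + b sin θ) ^ d + exp (-B) * (cos θ - b sin θ) ^ d`.

The mixture concentrates at the maximizer of this weight. With `tan θ = b v`, a critical point is a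
solution of the cavity equation `B = artanh v - (d - 1) artanh (v tanh β)`. For `B > 0`, or `B = 0`
and `(d - 1) tanh β < 1`, the right-hand side increases from any nonnegative solution on, so that
the maximizer is unique and nondegenerate (`exists_isPeak`; negative fields follow by symmetry). The
Laplace method, applied to the weight in the complex field `B + z / √n`, shows that the moment
generating function of the centered and normalized spin converges at every complex `z` to
`exp (χ z ^ 2 / 2)` (`IsPeak.tendsto_finiteMGF`), where `χ` is the variance of a spin at the peak
plus the contribution of the fluctuations of the angle (`peakVariance`). On the imaginary axis this
is the central limit theorem (`IsPeak.tendstoInDistribution`), and Cauchy's formula gives the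
convergence of the mean and of the variance. If `d n` is odd, the additional half-edge changes the
weight of a single vertex, which cancels in the limit.

For the pressure, the quadratic equation satisfied by `f` integrates `log f` in closed form: the
integral is, up to a constant, the value at a suitable angle of
`t log (cos θ + b sin θ) + (1 - t) log (cos θ - b sin θ)`. Together with Gibbs' variational principle for the two spins of a vertex, `ψ` is
the logarithm of the maximal weight, up to a term without `B` (`IsPeak.pressure_eq`). The maximizer
is differentiable in the field, so the first derivative of `ψ` is the magnetization at the peak and
the second is `χ` (`IsPeak.hasDerivAt_vertexMean`).

It remains to identify `β_c`: if `(d - 1) tanh β > 1`, the magnetization at the peak stays bounded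
away from `0` as `B ↘ 0` (`exists_isSpontaneousMagnetization`), so `β < β_c` implies
`(d - 1) tanh β < 1`.
-/

noncomputable section

namespace AnnealedIsing

/-! ### Weighted perfect matchings -/

section Matchings

variable {H : Type*} [Fintype H] [DecidableEq H]

/-- The perfect matchings of a finset `s`, as involutions whose support is exactly `s`. -/
def matchings (s : Finset H) : Finset (Equiv.Perm H) :=
  Finset.univ.filter fun m => (∀ h, m (m h) = h) ∧ ∀ h, m h ≠ h ↔ h ∈ s

lemma mem_matchings {s : Finset H} {m : Equiv.Perm H} :
    m ∈ matchings s ↔ (∀ h, m (m h) = h) ∧ ∀ h, m h ≠ h ↔ h ∈ s := by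
  simp [matchings]

/-- The matchings of `s` weighted by `exp (β τ τ')` for each matched pair; the exponent is half
the sum over `s` because every pair is met twice. -/
def matchingSum (β : ℝ) (τ : H → ℝ) (s : Finset H) : ℝ :=
  ∑ m ∈ matchings s, Real.exp (β / 2 * ∑ h ∈ s, τ h * τ (m h))

lemma matchings_empty : matchings (∅ : Finset H) = {1} := by
  ext m
  simp only [mem_matchings, Finset.notMem_empty, iff_false, not_not, Finset.mem_singleton]
  constructor
  · rintro ⟨-, h⟩
    ext x
    simp [h x]
  · rintro rfl
    simp

lemma matchingSum_empty (β : ℝ) (τ : H → ℝ) : matchingSum β τ ∅ = 1 := by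
  simp [matchingSum, matchings_empty]

lemma swap_mul_mem_matchings_erase {s : Finset H} {a b : H} {m : Equiv.Perm H}
    (hm : m ∈ matchings s) (hab : m a = b) :
    Equiv.swap a b * m ∈ matchings ((s.erase a).erase b) := by
  rw [mem_matchings] at hm ⊢
  obtain ⟨h1, h2⟩ := hm
  have hba : m b = a := by rw [← hab, h1]
  have key : ∀ x, x ≠ a → x ≠ b → (Equiv.swap a b * m) x = m x ∧ m x ≠ a ∧ m x ≠ b := by
    intro x hxa hxb
    have h3 : m x ≠ a := fun h => hxb (by rw [← hab, ← h, h1])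
    have h4 : m x ≠ b := fun h => hxa (by rw [← hba, ← h, h1])
    exact ⟨by simp [Equiv.swap_apply_of_ne_of_ne h3 h4], h3, h4⟩
  have ka : (Equiv.swap a b * m) a = a := by simp [hab]
  have kb : (Equiv.swap a b * m) b = b := by simp [hba]
  constructor
  · intro x
    by_cases hxa : x = a
    · subst hxa; rw [ka, ka]
    by_cases hxb : x = b
    · subst hxb; rw [kb, kb]
    obtain ⟨h3, h4, h5⟩ := key x hxa hxb
    rw [h3, (key _ h4 h5).1, h1]
  · intro x
    by_cases hxa : x = a
    · subst hxa; simp [ka]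
    by_cases hxb : x = b
    · subst hxb; simp [kb]
    rw [(key x hxa hxb).1, h2]
    simp [hxa, hxb]

lemma swap_mul_mem_matchings {s : Finset H} {a b : H} {m : Equiv.Perm H}
    (ha : a ∈ s) (hb : b ∈ s) (hab : a ≠ b) (hm : m ∈ matchings ((s.erase a).erase b)) :
    Equiv.swap a b * m ∈ matchings s := by
  rw [mem_matchings] at hm ⊢
  obtain ⟨h1, h2⟩ := hm
  have ha' : m a = a := by
    by_contra h
    simpa using (h2 a).1 h
  have hb' : m b = b := by
    by_contra h
    simpa using (h2 b).1 h
  have key : ∀ x, x ≠ a → x ≠ b → (Equiv.swap a b * m) x = m x ∧ m x ≠ a ∧ m x ≠ b := by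
    intro x hxa hxb
    have h3 : m x ≠ a := fun h => hxa (m.injective (by rw [h, ha']))
    have h4 : m x ≠ b := fun h => hxb (m.injective (by rw [h, hb']))
    exact ⟨by simp [Equiv.swap_apply_of_ne_of_ne h3 h4], h3, h4⟩
  have ka : (Equiv.swap a b * m) a = b := by simp [ha']
  have kb : (Equiv.swap a b * m) b = a := by simp [hb']
  constructor
  · intro x
    by_cases hxa : x = a
    · subst hxa; rw [ka, kb]
    by_cases hxb : x = b
    · subst hxb; rw [kb, ka]
    obtain ⟨h3, h4, h5⟩ := key x hxa hxb
    rw [h3, (key _ h4 h5).1, h1]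
  · intro x
    by_cases hxa : x = a
    · subst hxa; simp [ka, ha, hab.symm]
    by_cases hxb : x = b
    · subst hxb; simp [kb, hb, hab]
    rw [(key x hxa hxb).1, h2]
    simp [hxa, hxb]

/-- Splitting the matchings according to the partner of a fixed element. -/
lemma matchingSum_eq_sum_erase (β : ℝ) (τ : H → ℝ) {s : Finset H} {a : H} (ha : a ∈ s) :
    matchingSum β τ s = ∑ b ∈ s.erase a,
      Real.exp (β * (τ a * τ b)) * matchingSum β τ ((s.erase a).erase b) := by
  have hmap : ∀ m ∈ matchings s, m a ∈ s.erase a := by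
    intro m hm
    rw [mem_matchings] at hm
    have h1 := (hm.2 a).2 ha
    refine Finset.mem_erase.2 ⟨h1, (hm.2 _).1 ?_⟩
    rw [hm.1]
    exact h1.symm
  rw [matchingSum, ← Finset.sum_fiberwise_of_maps_to hmap]
  refine Finset.sum_congr rfl fun b hb => ?_
  obtain ⟨hba, hbs⟩ := Finset.mem_erase.1 hb
  rw [matchingSum, Finset.mul_sum]
  refine Finset.sum_bij' (fun m _ => Equiv.swap a b * m) (fun m _ => Equiv.swap a b * m)
    ?_ ?_ ?_ ?_ ?_
  · intro m hm
    rw [Finset.mem_filter] at hm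
    exact swap_mul_mem_matchings_erase hm.1 hm.2
  · intro m hm
    refine Finset.mem_filter.2 ⟨swap_mul_mem_matchings ha hbs hba.symm hm, ?_⟩
    have ha' : m a = a := by
      by_contra h
      simpa using ((mem_matchings.1 hm).2 a).1 h
    simp [ha']
  · intro m _
    simp [← mul_assoc]
  · intro m _
    simp [← mul_assoc]
  · intro m hm
    rw [Finset.mem_filter] at hm
    obtain ⟨hm, hab⟩ := hm
    rw [mem_matchings] at hm
    have hba' : m b = a := by rw [← hab, hm.1]
    rw [← Real.exp_add]
    congr 1
    rw [← Finset.add_sum_erase s _ ha, ← Finset.add_sum_erase (s.erase a) _ hb, hab, hba']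
    have : ∀ x ∈ (s.erase a).erase b, τ x * τ ((Equiv.swap a b * m) x) = τ x * τ (m x) := by
      intro x hx
      simp only [Finset.mem_erase] at hx
      have h3 : m x ≠ a := fun h => hx.1 (by rw [← hab, ← h, hm.1])
      have h4 : m x ≠ b := fun h => hx.2.1 (by rw [← hba', ← h, hm.1])
      simp [Equiv.swap_apply_of_ne_of_ne h3 h4]
    rw [Finset.sum_congr rfl this]
    ring

end Matchings

/-! ### Moments on the circle -/

section Integral

variable {H : Type*}

/-- The integral over a half circle of `∏ (cos θ + b τ sin θ)`: up to constants, the moment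
`E ∏ (A + b τ Y)` of two independent standard Gaussian variables `A` and `Y`. -/
def circleMoment (b : ℝ) (τ : H → ℝ) (s : Finset H) : ℝ :=
  ∫ θ in (-(Real.pi / 2))..(Real.pi / 2), ∏ h ∈ s, (Real.cos θ + b * τ h * Real.sin θ)

lemma circleMoment_empty (b : ℝ) (τ : H → ℝ) : circleMoment b τ ∅ = Real.pi := by
  simp [circleMoment]

/-- Integration by parts: the circle moments satisfy the recursion of the matching sums. -/
lemma card_mul_circleMoment [DecidableEq H] (b : ℝ) (τ : H → ℝ) {s : Finset H}
    (hs : Even s.card) {a : H} (ha : a ∈ s) : s.card * circleMoment b τ s =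
      ∑ c ∈ s.erase a, (1 + b ^ 2 * (τ a * τ c)) * circleMoment b τ ((s.erase a).erase c) := by
  set F : H → ℝ → ℝ := fun h θ => Real.cos θ + b * τ h * Real.sin θ with hF
  set F' : H → ℝ → ℝ := fun h θ => -Real.sin θ + b * τ h * Real.cos θ with hF'
  have hder : ∀ h θ, HasDerivAt (F h) (F' h θ) θ := fun h θ =>
    (Real.hasDerivAt_cos θ).add ((Real.hasDerivAt_sin θ).const_mul _)
  have hder' : ∀ θ, HasDerivAt (fun θ => -F' a θ) (F a θ) θ := fun θ => by
    have := ((Real.hasDerivAt_sin θ).neg.add ((Real.hasDerivAt_cos θ).const_mul (b * τ a))).neg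
    exact this.congr_deriv (by simp only [F]; ring)
  have hcF : ∀ h, Continuous (F h) := fun h => by fun_prop
  have hcF' : ∀ h, Continuous (F' h) := fun h => by fun_prop
  have hprod : ∀ θ, HasDerivAt (fun θ => ∏ h ∈ s.erase a, F h θ)
      (∑ c ∈ s.erase a, (∏ h ∈ (s.erase a).erase c, F h θ) * F' c θ) θ := fun θ => by
    simpa using HasDerivAt.fun_finsetProd (u := s.erase a) (f := F) (f' := fun h => F' h θ)
      fun i _ => hder i θ
  have hparts := intervalIntegral.integral_mul_deriv_eq_deriv_mul
    (a := -(Real.pi / 2)) (b := Real.pi / 2)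
    (u := fun θ => ∏ h ∈ s.erase a, F h θ) (v := fun θ => -F' a θ)
    (fun θ _ => hprod θ) (fun θ _ => hder' θ)
    (Continuous.intervalIntegrable (by fun_prop) _ _)
    (Continuous.intervalIntegrable (by fun_prop) _ _)
  have hodd : Odd (s.erase a).card := by
    rw [Finset.card_erase_of_mem ha]
    exact Nat.Even.sub_odd (Finset.card_pos.2 ⟨a, ha⟩) hs odd_one
  -- the boundary terms cancel because the integrand changes its sign under a half turn
  have hbdry : (∏ h ∈ s.erase a, F h (-(Real.pi / 2))) * -F' a (-(Real.pi / 2)) =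
      (∏ h ∈ s.erase a, F h (Real.pi / 2)) * -F' a (Real.pi / 2) := by
    have h1 : ∀ h, F h (-(Real.pi / 2)) = (-1) * F h (Real.pi / 2) := fun h => by simp [F]
    simp only [h1, Finset.prod_mul_distrib, Finset.prod_const, hodd.neg_one_pow]
    simp [F']
  have hleft : ∀ θ, (∏ h ∈ s.erase a, F h θ) * F a θ = ∏ h ∈ s, F h θ := fun θ =>
    Finset.prod_erase_mul s _ ha
  have hmul : ∀ c θ, -F' a θ * F' c θ = F a θ * F c θ - (1 + b ^ 2 * (τ a * τ c)) := by
    intro c θ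
    have := Real.sin_sq_add_cos_sq θ
    simp only [F, F']
    linear_combination (-(1 + b ^ 2 * (τ a * τ c))) * this
  have hcm : ∀ t : Finset H, circleMoment b τ t =
      ∫ θ in (-(Real.pi / 2))..(Real.pi / 2), ∏ h ∈ t, F h θ := fun t => rfl
  have hint : ∀ c ∈ s.erase a, ∀ θ,
      (∏ h ∈ (s.erase a).erase c, F h θ) * F' c θ * -F' a θ =
        ∏ h ∈ s, F h θ - (1 + b ^ 2 * (τ a * τ c)) * ∏ h ∈ (s.erase a).erase c, F h θ := by
    intro c hc θ
    rw [← hleft θ, ← Finset.prod_erase_mul (s.erase a) _ hc]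
    linear_combination (∏ h ∈ (s.erase a).erase c, F h θ) * hmul c θ
  have hcard : (((s.erase a).card : ℕ) : ℝ) = s.card - 1 := by
    rw [Finset.card_erase_of_mem ha, Nat.cast_sub (Finset.card_pos.2 ⟨a, ha⟩), Nat.cast_one]
  simp only [hleft, hbdry, sub_self, zero_sub, Finset.sum_mul] at hparts
  rw [intervalIntegral.integral_finsetSum
    (fun c _ => Continuous.intervalIntegrable (by fun_prop) _ _)] at hparts
  have hterm : ∀ c ∈ s.erase a,
      (∫ θ in (-(Real.pi / 2))..(Real.pi / 2),
        (∏ h ∈ (s.erase a).erase c, F h θ) * F' c θ * -F' a θ) =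
      circleMoment b τ s - (1 + b ^ 2 * (τ a * τ c)) * circleMoment b τ ((s.erase a).erase c) := by
    intro c hc
    simp only [hint c hc, hcm]
    rw [intervalIntegral.integral_sub (Continuous.intervalIntegrable (by fun_prop) _ _)
      (Continuous.intervalIntegrable (by fun_prop) _ _), intervalIntegral.integral_const_mul]
  rw [Finset.sum_congr rfl hterm, Finset.sum_sub_distrib, Finset.sum_const, nsmul_eq_mul, hcard,
    ← hcm] at hparts
  linear_combination hparts

end Integral

lemma tanh_nonneg {β : ℝ} (hβ : 0 ≤ β) : 0 ≤ Real.tanh β := by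
  rw [Real.tanh_eq_sinh_div_cosh]
  exact div_nonneg (Real.sinh_nonneg_iff.2 hβ) (Real.cosh_pos β).le

/-- A factor `exp (β τ τ')` is proportional to `1 + τ τ' tanh β`. -/
lemma exp_mul_spin (β : ℝ) {x : ℝ} (hx : x = 1 ∨ x = -1) :
    Real.exp (β * x) = Real.cosh β * (1 + Real.tanh β * x) := by
  have h := (Real.cosh_pos β).ne'
  rw [Real.tanh_eq_sinh_div_cosh]
  rcases hx with rfl | rfl
  · field_simp
    rw [← Real.cosh_add_sinh]
  · field_simp
    rw [← Real.cosh_sub_sinh]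
    ring

/-- Matching sums over sets of a given even size are proportional to circle moments, with a
constant that depends neither on the spins nor on the set: both satisfy the same recursion, since
`b ^ 2 = tanh β`. -/
lemma exists_matchingSum_eq (β : ℝ) (hβ : 0 ≤ β) (N : ℕ) : ∃ C : ℝ, 0 < C ∧
    ∀ {H : Type} [Fintype H] [DecidableEq H] (τ : H → ℝ), (∀ h, τ h = 1 ∨ τ h = -1) →
      ∀ s : Finset H, s.card = 2 * N →
        matchingSum β τ s = C * circleMoment √(Real.tanh β) τ s := by
  have hsq : √(Real.tanh β) ^ 2 = Real.tanh β := Real.sq_sqrt (tanh_nonneg hβ)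
  induction N with
  | zero =>
    refine ⟨Real.pi⁻¹, inv_pos.2 Real.pi_pos, fun τ _ s hs => ?_⟩
    rw [Nat.mul_zero, Finset.card_eq_zero] at hs
    rw [hs, matchingSum_empty, circleMoment_empty, inv_mul_cancel₀ Real.pi_ne_zero]
  | succ N ih =>
    obtain ⟨C, hC, h⟩ := ih
    refine ⟨C * Real.cosh β * (2 * (N + 1)), by have := Real.cosh_pos β; positivity,
      fun {H} _ _ τ hτ s hs => ?_⟩
    obtain ⟨a, ha⟩ : s.Nonempty := Finset.card_pos.1 (by omega)
    have hrec := card_mul_circleMoment √(Real.tanh β) τ (s := s) ⟨N + 1, by omega⟩ ha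
    rw [hs, hsq] at hrec
    push_cast at hrec
    rw [matchingSum_eq_sum_erase β τ ha, mul_assoc, hrec, Finset.mul_sum]
    refine Finset.sum_congr rfl fun c hc => ?_
    rw [h τ hτ _ (by rw [Finset.card_erase_of_mem hc, Finset.card_erase_of_mem ha]; omega),
      exp_mul_spin β (x := τ a * τ c)
        (by rcases hτ a with h | h <;> rcases hτ c with h' | h' <;> simp [h, h'])]
    ring

/-! ### The Hamiltonian in terms of half-edges -/

lemma spin_eq_one_or {n : ℕ} (σ : Config n) (i : Fin n) : spin σ i = 1 ∨ spin σ i = -1 := by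
  rcases Int.units_eq_one_or (σ i) with h | h <;> simp [spin, h]

/-- Every edge is met from both of its half-edges. -/
lemma sum_edges {n : ℕ} {D : Fin n → ℕ} (m : Pairing D) (φ : Sym2 (HalfEdge D) → ℝ) :
    ∑ e ∈ edges m, φ e = 1 / 2 * ∑ h, φ s(h, m.1 h) := by
  classical
  rw [← Finset.sum_fiberwise_of_maps_to (s := Finset.univ) (t := edges m)
    (g := fun h => s(h, m.1 h)) (fun h _ => Finset.mem_image_of_mem _ (Finset.mem_univ h)),
    Finset.mul_sum]
  refine Finset.sum_congr rfl fun e he => ?_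
  obtain ⟨h, -, rfl⟩ := Finset.mem_image.1 he
  have hfib : (Finset.univ.filter fun x => s(x, m.1 x) = s(h, m.1 h)) = {h, m.1 h} := by
    ext x
    simp only [Finset.mem_filter, Finset.mem_univ, true_and, Finset.mem_insert,
      Finset.mem_singleton, Sym2.eq_iff]
    constructor
    · rintro (⟨h1, -⟩ | ⟨h1, -⟩) <;> simp [h1]
    · rintro (rfl | rfl)
      · simp
      · simp [m.2.1]
  rw [hfib, Finset.sum_pair (m.2.2 h).symm, m.2.1, Sym2.eq_swap (a := m.1 h)]
  ring

/-- The sum over `i ≤ j` counts every edge once, self-loops included. -/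
lemma hamiltonian_eq {n : ℕ} {D : Fin n → ℕ} (β B : ℝ) (m : Pairing D) (σ : Config n) :
    -hamiltonian β B m σ =
      B * totalSpin σ + β / 2 * ∑ h, spin σ h.1 * spin σ (m.1 h).1 := by
  have key : ∑ i, ∑ j ∈ Finset.univ.filter (fun j => i ≤ j),
      (edgeCount m i j : ℝ) * spin σ i * spin σ j =
      ∑ e ∈ edges m, ∑ i, ∑ j ∈ Finset.univ.filter (fun j => i ≤ j),
        if e.map Sigma.fst = s(i, j) then spin σ i * spin σ j else 0 := by
    rw [Finset.sum_comm]
    refine Finset.sum_congr rfl fun i _ => ?_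
    rw [Finset.sum_comm]
    refine Finset.sum_congr rfl fun j _ => ?_
    rw [edgeCount, Finset.card_filter, mul_assoc]
    push_cast
    rw [Finset.sum_mul]
    refine Finset.sum_congr rfl fun e _ => ?_
    split_ifs <;> simp
  have hpair : ∀ a b : Fin n, (∑ i, ∑ j ∈ Finset.univ.filter (fun j => i ≤ j),
      if s(a, b) = s(i, j) then spin σ i * spin σ j else 0) = spin σ a * spin σ b := by
    have hle : ∀ a b : Fin n, a ≤ b → (∑ i, ∑ j ∈ Finset.univ.filter (fun j => i ≤ j),
        if s(a, b) = s(i, j) then spin σ i * spin σ j else 0) = spin σ a * spin σ b := by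
      intro a b hab
      rw [Finset.sum_eq_single a, Finset.sum_eq_single b]
      · simp
      · intro j _ hj
        refine if_neg fun h => ?_
        rcases Sym2.eq_iff.1 h with ⟨-, h2⟩ | ⟨h1, h2⟩
        · exact hj h2.symm
        · exact hj (h1.symm.trans h2.symm)
      · simp [hab]
      · intro i _ hi
        refine Finset.sum_eq_zero fun j hj => if_neg fun h => ?_
        rw [Finset.mem_filter] at hj
        rcases Sym2.eq_iff.1 h with ⟨h1, -⟩ | ⟨h1, h2⟩
        · exact hi h1.symm
        · subst h1 h2
          exact hi (le_antisymm hj.2 hab)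
      · simp
    intro a b
    rcases le_total a b with h | h
    · exact hle a b h
    · rw [Sym2.eq_swap, hle b a h, mul_comm]
  rw [hamiltonian, key, sum_edges, totalSpin]
  have hmap : ∀ h, (∑ i, ∑ j ∈ Finset.univ.filter (fun j => i ≤ j),
      if (s(h, m.1 h)).map Sigma.fst = s(i, j) then spin σ i * spin σ j else 0) =
      spin σ h.1 * spin σ (m.1 h).1 := fun h => hpair _ _
  rw [Finset.sum_congr rfl fun h _ => hmap h]
  ring

lemma sum_pairing_eq_matchingSum {n : ℕ} (D : Fin n → ℕ) (β B : ℝ) (σ : Config n) :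
    ∑ m : Pairing D, Real.exp (-hamiltonian β B m σ) =
      Real.exp (B * totalSpin σ) *
        matchingSum β (fun h : HalfEdge D => spin σ h.1) Finset.univ := by
  rw [matchingSum, Finset.mul_sum]
  refine Finset.sum_bij (fun m _ => m.1) ?_ ?_ ?_ ?_
  · intro m _
    simpa [mem_matchings] using m.2
  · intro m _ m' _ h
    exact Subtype.ext h
  · intro m hm
    exact ⟨⟨m, by simpa [mem_matchings] using hm⟩, Finset.mem_univ _, rfl⟩
  · intro m _
    rw [hamiltonian_eq, Real.exp_add]

/-- The weight of a configuration, as an integral over a half circle; with `b ^ 2 = tanh β` it is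
proportional to the annealed weight. -/
def configWeight (d n : ℕ) (b B : ℝ) (σ : Config n) : ℝ :=
  ∫ θ in (-(Real.pi / 2))..(Real.pi / 2), ∏ i, (Real.exp (B * spin σ i) *
    (Real.cos θ + b * spin σ i * Real.sin θ) ^ (regularDegrees d n i))

/-- The annealed measure is a mixture over the angle of (signed) product measures. -/
lemma annealedProb_eq (d n : ℕ) (β B : ℝ) (hβ : 0 ≤ β) (σ : Config n) :
    annealedProb d n β B σ = configWeight d n √(Real.tanh β) B σ /
      ∑ τ, configWeight d n √(Real.tanh β) B τ := by
  set D := regularDegrees d n with hD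
  obtain ⟨N, hN⟩ : ∃ N, (Finset.univ : Finset (HalfEdge D)).card = 2 * N := by
    obtain ⟨k, hk⟩ := even_sum_evenDegrees (n := n) fun _ => d
    refine ⟨k, ?_⟩
    rw [Finset.card_univ, Fintype.card_sigma]
    simp only [Fintype.card_fin]
    rw [two_mul]
    exact hk
  obtain ⟨C, hC, h⟩ := exists_matchingSum_eq β hβ N
  have hw : ∀ σ : Config n, ∑ m : Pairing D, Real.exp (-hamiltonian β B m σ) =
      C * configWeight d n √(Real.tanh β) B σ := by
    intro σ
    rw [sum_pairing_eq_matchingSum, h _ (fun h => spin_eq_one_or σ h.1) _ hN, circleMoment,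
      configWeight]
    rw [mul_left_comm, ← intervalIntegral.integral_const_mul]
    congr 2
    ext θ
    rw [Finset.prod_mul_distrib, ← Real.exp_sum, ← Finset.mul_sum, Fintype.prod_sigma]
    simp [totalSpin, hD]
  have hcard : (Fintype.card (Pairing D) : ℝ) ≠ 0 := by
    have : Nonempty (Pairing D) := nonempty_pairing _
    exact_mod_cast Fintype.card_ne_zero
  rw [annealedProb, graphExpect, graphExpect, div_div_div_cancel_right₀ hcard]
  have hZ : ∑ m : Pairing (regularDegrees d n), partitionFunction β B m =
      ∑ σ : Config n, ∑ m : Pairing D, Real.exp (-hamiltonian β B m σ) := Finset.sum_comm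
  rw [hZ, hw]
  simp only [hw, ← Finset.mul_sum]
  rw [mul_div_mul_left _ _ hC.ne']

/-! ### The weight of a vertex as a function of the angle -/

/-- The factor `cos θ ± b sin θ` of a half-edge; the spin `-1` corresponds to `-b`. -/
def halfEdgeFactor (b θ : ℝ) : ℝ := Real.cos θ + b * Real.sin θ

/-- The derivative of `halfEdgeFactor b`. -/
def halfEdgeFactor' (b θ : ℝ) : ℝ := -Real.sin θ + b * Real.cos θ

/-- The factor of a vertex of degree `d` with spin `1` (spin `-1` corresponds to `-b`). -/
def vertexFactor (d : ℕ) (b θ : ℝ) : ℝ := halfEdgeFactor b θ ^ d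

/-- The derivative of `vertexFactor d b`. -/
def vertexFactor' (d : ℕ) (b θ : ℝ) : ℝ :=
  d * (halfEdgeFactor b θ ^ (d - 1) * halfEdgeFactor' b θ)

/-- The second derivative of `vertexFactor d b`. -/
def vertexFactor'' (d : ℕ) (b θ : ℝ) : ℝ :=
  d * (((d - 1 : ℕ) : ℝ) * halfEdgeFactor b θ ^ (d - 1 - 1) * halfEdgeFactor' b θ ^ 2 -
    halfEdgeFactor b θ ^ (d - 1) * halfEdgeFactor b θ)

lemma hasDerivAt_halfEdgeFactor (b θ : ℝ) :
    HasDerivAt (halfEdgeFactor b) (halfEdgeFactor' b θ) θ :=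
  (Real.hasDerivAt_cos θ).add ((Real.hasDerivAt_sin θ).const_mul b)

lemma hasDerivAt_halfEdgeFactor' (b θ : ℝ) :
    HasDerivAt (halfEdgeFactor' b) (-halfEdgeFactor b θ) θ :=
  ((Real.hasDerivAt_sin θ).neg.add ((Real.hasDerivAt_cos θ).const_mul b)).congr_deriv
    (by simp only [halfEdgeFactor]; ring)

lemma hasDerivAt_vertexFactor (d : ℕ) (b θ : ℝ) :
    HasDerivAt (vertexFactor d b) (vertexFactor' d b θ) θ :=
  ((hasDerivAt_halfEdgeFactor b θ).fun_pow d).congr_deriv (by rw [vertexFactor']; ring)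

lemma hasDerivAt_vertexFactor' (d : ℕ) (b θ : ℝ) :
    HasDerivAt (vertexFactor' d b) (vertexFactor'' d b θ) θ :=
  ((((hasDerivAt_halfEdgeFactor b θ).fun_pow (d - 1)).mul
    (hasDerivAt_halfEdgeFactor' b θ)).const_mul (d : ℝ)).congr_deriv
      (by rw [vertexFactor'']; ring)

lemma continuous_vertexFactor (d : ℕ) (b : ℝ) : Continuous (vertexFactor d b) := by
  unfold vertexFactor halfEdgeFactor
  fun_prop

lemma halfEdgeFactor_neg (b θ : ℝ) : halfEdgeFactor b (-θ) = halfEdgeFactor (-b) θ := by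
  simp [halfEdgeFactor]

lemma halfEdgeFactor'_neg (b θ : ℝ) : halfEdgeFactor' b (-θ) = -halfEdgeFactor' (-b) θ := by
  simp only [halfEdgeFactor', Real.sin_neg, Real.cos_neg]
  ring

lemma vertexFactor_neg (d : ℕ) (b θ : ℝ) : vertexFactor d b (-θ) = vertexFactor d (-b) θ := by
  simp [vertexFactor, halfEdgeFactor_neg]

lemma vertexFactor'_neg (d : ℕ) (b θ : ℝ) :
    vertexFactor' d b (-θ) = -vertexFactor' d (-b) θ := by
  simp [vertexFactor', halfEdgeFactor_neg, halfEdgeFactor'_neg]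

lemma vertexFactor''_neg (d : ℕ) (b θ : ℝ) :
    vertexFactor'' d b (-θ) = vertexFactor'' d (-b) θ := by
  simp [vertexFactor'', halfEdgeFactor_neg, halfEdgeFactor'_neg]

/-- The sum over the spin of `F`, a function of `±b`, weighted with the field `B`. -/
def fieldSum (B : ℝ) (F : ℝ → ℝ) (b : ℝ) : ℝ := Real.exp B * F b + Real.exp (-B) * F (-b)

/-- The total weight of a vertex of degree `d` at the angle `θ`. -/
def vertexWeight (d : ℕ) (b B θ : ℝ) : ℝ := fieldSum B (fun c => vertexFactor d c θ) b

/-- The sum of the absolute values of the weights of the two spins of a vertex. -/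
def absWeight (d : ℕ) (b B θ : ℝ) : ℝ := fieldSum B (fun c => |vertexFactor d c θ|) b

/-- `θ₀` is the unique maximizer of the weight of a vertex, even in absolute value, on a half
circle; it is nondegenerate, and both spins have positive weights there. -/
structure IsPeak (d : ℕ) (b B θ₀ : ℝ) : Prop where
  mem : θ₀ ∈ Set.Ioo (-(Real.pi / 2)) (Real.pi / 2)
  plus_pos : 0 < halfEdgeFactor b θ₀
  minus_pos : 0 < halfEdgeFactor (-b) θ₀
  crit : fieldSum B (fun c => vertexFactor' d c θ₀) b = 0
  concave : fieldSum B (fun c => vertexFactor'' d c θ₀) b < 0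
  lt : ∀ θ ∈ Set.Icc (-(Real.pi / 2)) (Real.pi / 2), θ ≠ θ₀ →
    absWeight d b B θ < vertexWeight d b B θ₀

/-! ### Existence of the peak -/

lemma absWeight_neg (d : ℕ) (b B θ : ℝ) : absWeight d b (-B) (-θ) = absWeight d b B θ := by
  simp only [absWeight, fieldSum, vertexFactor_neg, neg_neg]
  ring

lemma continuous_absWeight (d : ℕ) (b B : ℝ) : Continuous (absWeight d b B) := by
  have h1 := continuous_vertexFactor d b
  have h2 := continuous_vertexFactor d (-b)
  unfold absWeight fieldSum
  fun_prop

lemma vertexWeight_neg (d : ℕ) (b B θ : ℝ) :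
    vertexWeight d b (-B) (-θ) = vertexWeight d b B θ := by
  simp only [vertexWeight, fieldSum, vertexFactor_neg, neg_neg]
  ring

lemma IsPeak.neg {d : ℕ} {b B θ₀ : ℝ} (h : IsPeak d b B θ₀) : IsPeak d b (-B) (-θ₀) where
  mem := ⟨by linarith [h.mem.2], by linarith [h.mem.1]⟩
  plus_pos := by rw [halfEdgeFactor_neg]; exact h.minus_pos
  minus_pos := by rw [halfEdgeFactor_neg, neg_neg]; exact h.plus_pos
  crit := by
    have := h.crit
    simp only [fieldSum, vertexFactor'_neg, neg_neg] at this ⊢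
    linarith
  concave := by
    have := h.concave
    simp only [fieldSum, vertexFactor''_neg, neg_neg] at this ⊢
    linarith
  lt θ hθ hne := by
    rw [vertexWeight_neg, show absWeight d b (-B) θ = absWeight d b B (-θ) by
      rw [← absWeight_neg d b B (-θ), neg_neg]]
    exact h.lt (-θ) ⟨by linarith [hθ.2], by linarith [hθ.1]⟩ fun h => hne (by rw [← h, neg_neg])

lemma abs_sin_le_cos {θ : ℝ} (hθ : |θ| ≤ Real.pi / 4) : |Real.sin θ| ≤ Real.cos θ := by
  have hpi := Real.pi_pos
  obtain ⟨h1, h2⟩ := abs_le.1 hθ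
  have hc : 0 ≤ Real.cos θ := Real.cos_nonneg_of_mem_Icc ⟨by linarith, by linarith⟩
  have h3 : 0 ≤ Real.cos (2 * θ) := Real.cos_nonneg_of_mem_Icc ⟨by linarith, by linarith⟩
  rw [Real.cos_two_mul] at h3
  rw [← abs_of_nonneg hc]
  refine sq_le_sq.1 ?_
  linarith [Real.sin_sq_add_cos_sq θ]

lemma halfEdgeFactor_pos {b θ : ℝ} (hb : |b| < 1) (hθ : |θ| ≤ Real.pi / 4) :
    0 < halfEdgeFactor b θ := by
  have hpi := Real.pi_pos
  have h := abs_sin_le_cos hθ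
  obtain ⟨h1, h2⟩ := abs_le.1 hθ
  have hc : 0 < Real.cos θ := Real.cos_pos_of_mem_Ioo ⟨by linarith, by linarith⟩
  have h3 : |b * Real.sin θ| ≤ |b| * Real.cos θ := by
    rw [abs_mul]
    exact mul_le_mul_of_nonneg_left h (abs_nonneg _)
  have h4 : |b| * Real.cos θ < Real.cos θ := by nlinarith
  have h5 := neg_abs_le (b * Real.sin θ)
  unfold halfEdgeFactor
  linarith

/-- Reflecting at the angle `π / 4` increases the absolute values of the weights of both spins. -/
lemma abs_halfEdgeFactor_lt_of_pi_div_four_lt {b θ : ℝ} (hb : |b| < 1) (h1 : Real.pi / 4 < θ)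
    (h2 : θ ≤ Real.pi / 2) : |halfEdgeFactor b θ| < halfEdgeFactor b (Real.pi / 2 - θ) := by
  have hpi := Real.pi_pos
  have hc : 0 ≤ Real.cos θ := Real.cos_nonneg_of_mem_Icc ⟨by linarith, by linarith⟩
  have hs : 0 < Real.sin θ := Real.sin_pos_of_pos_of_lt_pi (by linarith) (by linarith)
  have hsc : Real.cos θ < Real.sin θ := by
    have h3 : Real.cos (2 * θ) < 0 :=
      Real.cos_neg_of_pi_div_two_lt_of_lt (by linarith) (by linarith)
    rw [Real.cos_two_mul] at h3
    refine lt_of_pow_lt_pow_left₀ 2 hs.le ?_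
    linarith [Real.sin_sq_add_cos_sq θ]
  obtain ⟨hb1, hb2⟩ := abs_lt.1 hb
  unfold halfEdgeFactor
  rw [Real.cos_pi_div_two_sub, Real.sin_pi_div_two_sub, abs_lt]
  constructor <;> nlinarith

/-- The maximum over a half circle is only attained for angles at most `π / 4`, where all factors
are positive. -/
lemma absWeight_lt_of_pi_div_four_lt {d : ℕ} (hd : d ≠ 0) {b B θ : ℝ} (hb : |b| < 1)
    (h1 : Real.pi / 4 < |θ|) (h2 : |θ| ≤ Real.pi / 2) :
    ∃ θ', |θ'| ≤ Real.pi / 4 ∧ absWeight d b B θ < absWeight d b B θ' := by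
  have key : ∀ B θ : ℝ, Real.pi / 4 < θ → θ ≤ Real.pi / 2 →
      absWeight d b B θ < absWeight d b B (Real.pi / 2 - θ) := by
    intro B θ h1 h2
    have hlt : ∀ c : ℝ, |c| < 1 →
        |vertexFactor d c θ| < |vertexFactor d c (Real.pi / 2 - θ)| := by
      intro c hc
      have h3 := abs_halfEdgeFactor_lt_of_pi_div_four_lt hc h1 h2
      rw [vertexFactor, vertexFactor, abs_pow, abs_pow]
      exact pow_lt_pow_left₀ (h3.trans_le (le_abs_self _)) (abs_nonneg _) hd
    exact add_lt_add (mul_lt_mul_of_pos_left (hlt b hb) (Real.exp_pos _))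
      (mul_lt_mul_of_pos_left (hlt (-b) (by rwa [abs_neg])) (Real.exp_pos _))
  rcases le_total 0 θ with h | h
  · rw [abs_of_nonneg h] at h1 h2
    exact ⟨Real.pi / 2 - θ, abs_le.2 ⟨by linarith [Real.pi_pos], by linarith⟩, key B θ h1 h2⟩
  · rw [abs_of_nonpos h] at h1 h2
    refine ⟨-(Real.pi / 2 - -θ), ?_, ?_⟩
    · rw [abs_neg]
      exact abs_le.2 ⟨by linarith [Real.pi_pos], by linarith⟩
    · have h3 := key (-B) (-θ) h1 h2
      rwa [absWeight_neg, ← absWeight_neg d b (-B), neg_neg] at h3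

lemma absWeight_eq_vertexWeight {d : ℕ} {b B θ : ℝ} (h1 : 0 ≤ halfEdgeFactor b θ)
    (h2 : 0 ≤ halfEdgeFactor (-b) θ) : absWeight d b B θ = vertexWeight d b B θ := by
  simp only [absWeight, vertexWeight, fieldSum, vertexFactor]
  rw [abs_of_nonneg (pow_nonneg h1 d), abs_of_nonneg (pow_nonneg h2 d)]

lemma vertexWeight_le_absWeight (d : ℕ) (b B θ : ℝ) :
    vertexWeight d b B θ ≤ absWeight d b B θ :=
  add_le_add (mul_le_mul_of_nonneg_left (le_abs_self _) (Real.exp_pos _).le)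
    (mul_le_mul_of_nonneg_left (le_abs_self _) (Real.exp_pos _).le)

lemma hasDerivAt_vertexWeight (d : ℕ) (b B θ : ℝ) :
    HasDerivAt (vertexWeight d b B) (fieldSum B (fun c => vertexFactor' d c θ) b) θ :=
  ((hasDerivAt_vertexFactor d b θ).const_mul _).add
    ((hasDerivAt_vertexFactor d (-b) θ).const_mul _)

/-- A maximizer of the absolute weight on a half circle; the bound by `π / 4` is automatic, by
`IsAbsMax.of_isMaxOn`. -/
def IsAbsMax (d : ℕ) (b B θ : ℝ) : Prop :=
  IsMaxOn (absWeight d b B) (Set.Icc (-(Real.pi / 2)) (Real.pi / 2)) θ ∧ |θ| ≤ Real.pi / 4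

lemma IsAbsMax.of_isMaxOn {d : ℕ} (hd : d ≠ 0) {b : ℝ} (hb : |b| < 1) {B θ : ℝ}
    (hθ : θ ∈ Set.Icc (-(Real.pi / 2)) (Real.pi / 2))
    (hmax : IsMaxOn (absWeight d b B) (Set.Icc (-(Real.pi / 2)) (Real.pi / 2)) θ) :
    IsAbsMax d b B θ := by
  have hpi := Real.pi_pos
  refine ⟨hmax, ?_⟩
  by_contra! h
  obtain ⟨θ', h1, h2⟩ := absWeight_lt_of_pi_div_four_lt (B := B) hd hb h (abs_le.2 hθ)
  obtain ⟨h3, h4⟩ := abs_le.1 h1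
  exact absurd (hmax (show θ' ∈ Set.Icc _ _ from ⟨by linarith, by linarith⟩)) (not_le.2 h2)

lemma exists_isAbsMax {d : ℕ} (hd : d ≠ 0) {b : ℝ} (hb : |b| < 1) (B : ℝ) :
    ∃ θ, IsAbsMax d b B θ := by
  obtain ⟨θ, hθ, hmax⟩ := isCompact_Icc.exists_isMaxOn
    (Set.nonempty_Icc.2 (by linarith [Real.pi_pos] : -(Real.pi / 2) ≤ Real.pi / 2))
    (continuous_absWeight d b B).continuousOn
  exact ⟨θ, .of_isMaxOn hd hb hθ hmax⟩

lemma IsAbsMax.neg {d : ℕ} {b θ : ℝ} (h : IsAbsMax d b 0 θ) : IsAbsMax d b 0 (-θ) := by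
  have h0 : ∀ x, absWeight d b 0 (-x) = absWeight d b 0 x := fun x => by
    simpa using absWeight_neg d b 0 x
  refine ⟨fun x hx => ?_, by rw [abs_neg]; exact h.2⟩
  change absWeight d b 0 x ≤ absWeight d b 0 (-θ)
  rw [h0]
  exact h.1 hx

lemma IsAbsMax.crit {d : ℕ} {b B θ : ℝ} (hb : |b| < 1) (h : IsAbsMax d b B θ) :
    fieldSum B (fun c => vertexFactor' d c θ) b = 0 := by
  have hpi := Real.pi_pos
  have hb' : |-b| < 1 := by rwa [abs_neg]
  have hmax : IsLocalMax (vertexWeight d b B) θ := by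
    obtain ⟨h1, h2⟩ := abs_le.1 h.2
    filter_upwards [Icc_mem_nhds (show -(Real.pi / 2) < θ by linarith)
      (show θ < Real.pi / 2 by linarith)] with x hx
    rw [← absWeight_eq_vertexWeight (halfEdgeFactor_pos hb h.2).le (halfEdgeFactor_pos hb' h.2).le]
    exact (vertexWeight_le_absWeight d b B x).trans (h.1 hx)
  exact hmax.hasDerivAt_eq_zero (hasDerivAt_vertexWeight d b B θ)

/-- The critical point equation, in a form without truncated exponents. -/
lemma crit_iff {d : ℕ} (hd : 2 ≤ d) {b B θ : ℝ} :
    fieldSum B (fun c => vertexFactor' d c θ) b = 0 ↔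
      Real.exp B * halfEdgeFactor b θ ^ (d - 1) * (b * Real.cos θ - Real.sin θ) =
        Real.exp (-B) * halfEdgeFactor (-b) θ ^ (d - 1) * (b * Real.cos θ + Real.sin θ) := by
  have hd' : (d : ℝ) ≠ 0 := by positivity
  simp only [fieldSum, vertexFactor', halfEdgeFactor']
  constructor
  · intro h
    refine mul_left_cancel₀ hd' ?_
    linear_combination h
  · intro h
    linear_combination (d : ℝ) * h

/-- The determinant of the cavity equation: it has the sign of the derivative of
`v ↦ artanh v - (d - 1) artanh (w v)` on `[0, 1)`. -/
def cavityDet (d : ℕ) (w v : ℝ) : ℝ := 1 - w ^ 2 * v ^ 2 - (d - 1) * w * (1 - v ^ 2)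

/-- Twice the function `v ↦ artanh v - (d - 1) artanh (w v)`. -/
def cavityField (d : ℕ) (w v : ℝ) : ℝ :=
  Real.log (1 + v) - Real.log (1 - v) - (d - 1) * (Real.log (1 + w * v) - Real.log (1 - w * v))

lemma hasDerivAt_cavityField (d : ℕ) {w v : ℝ} (hw0 : 0 ≤ w) (hw : w < 1) (hv0 : 0 ≤ v)
    (hv : v < 1) : HasDerivAt (cavityField d w)
      (2 * cavityDet d w v / ((1 - v ^ 2) * (1 - w ^ 2 * v ^ 2))) v := by
  have hwv : w * v < 1 := by nlinarith
  have hwv0 : 0 ≤ w * v := mul_nonneg hw0 hv0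
  have e1 : 1 + v ≠ 0 := by positivity
  have e2 : 1 - v ≠ 0 := by linarith
  have e3 : 1 + w * v ≠ 0 := by positivity
  have e4 : 1 - w * v ≠ 0 := by linarith
  have h1 : HasDerivAt (fun v : ℝ => 1 + v) 1 v := (hasDerivAt_id v).const_add 1
  have h2 : HasDerivAt (fun v : ℝ => 1 - v) (-1) v := (hasDerivAt_id v).const_sub 1
  have h3 : HasDerivAt (fun v : ℝ => 1 + w * v) w v := by
    simpa using ((hasDerivAt_id v).const_mul w).const_add 1
  have h4 : HasDerivAt (fun v : ℝ => 1 - w * v) (-w) v := by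
    simpa using ((hasDerivAt_id v).const_mul w).const_sub 1
  refine (((h1.log e1).sub (h2.log e2)).sub
    (((h3.log e3).sub (h4.log e4)).const_mul ((d : ℝ) - 1))).congr_deriv ?_
  have e5 : 1 - v ^ 2 = (1 + v) * (1 - v) := by ring
  have e6 : 1 - w ^ 2 * v ^ 2 = (1 + w * v) * (1 - w * v) := by ring
  rw [cavityDet, e5, e6, div_sub_div _ _ e1 e2, div_sub_div _ _ e3 e4, mul_div_assoc',
    div_sub_div _ _ (mul_ne_zero e1 e2) (mul_ne_zero e3 e4),
    div_eq_div_iff (by positivity) (by positivity)]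
  ring

lemma cavityDet_mono {d : ℕ} (hd : 2 ≤ d) {w v v' : ℝ} (hw0 : 0 ≤ w) (hw : w < 1) (hv : 0 ≤ v)
    (h : v ≤ v') : cavityDet d w v ≤ cavityDet d w v' := by
  have hd' : (2 : ℝ) ≤ d := by exact_mod_cast hd
  have h1 : v ^ 2 ≤ v' ^ 2 := pow_le_pow_left₀ hv h 2
  have h2 : 0 ≤ (d - 1) * w - w ^ 2 := by nlinarith
  unfold cavityDet
  nlinarith [mul_nonneg h2 (sub_nonneg.2 h1)]

/-- Solutions of the cavity equation are nondegenerate: either there is no phase transition, or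
the cavity field has increased between `0` and `v`, and so it increases from there on. -/
lemma cavityDet_pos {d : ℕ} (hd : 2 ≤ d) {w v B : ℝ} (hw0 : 0 < w) (hw : w < 1) (hv0 : 0 ≤ v)
    (hv : v < 1) (hB : 0 < B ∨ (d - 1) * w < 1) (h : cavityField d w v = 2 * B) :
    0 < cavityDet d w v := by
  rcases hB with hB | hB
  · have hv0' : 0 < v := by
      rcases hv0.lt_or_eq with h1 | h1
      · exact h1
      · rw [← h1] at h
        simp [cavityField] at h
        linarith
    obtain ⟨ξ, hξ, hslope⟩ := exists_hasDerivAt_eq_slope (cavityField d w)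
      (fun v => 2 * cavityDet d w v / ((1 - v ^ 2) * (1 - w ^ 2 * v ^ 2))) hv0'
      (fun x hx => (hasDerivAt_cavityField d hw0.le hw hx.1
        (hx.2.trans_lt hv)).continuousAt.continuousWithinAt)
      (fun x hx => hasDerivAt_cavityField d hw0.le hw hx.1.le (hx.2.trans hv))
    have h0 : cavityField d w 0 = 0 := by simp [cavityField]
    rw [h, h0] at hslope
    have hpos : 0 < 2 * cavityDet d w ξ / ((1 - ξ ^ 2) * (1 - w ^ 2 * ξ ^ 2)) := by
      rw [hslope]
      simp only [sub_zero]
      positivity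
    have hξ1 : ξ < 1 := hξ.2.trans hv
    have h1 : 0 < 1 - ξ ^ 2 := by nlinarith [hξ.1]
    have h2 : 0 < 1 - w ^ 2 * ξ ^ 2 := by
      have : w * ξ < 1 := by nlinarith [hξ.1]
      nlinarith [mul_pos hw0 hξ.1]
    rw [div_pos_iff_of_pos_right (mul_pos h1 h2)] at hpos
    have := cavityDet_mono hd hw0.le hw hξ.1.le hξ.2.le
    linarith
  · have := cavityDet_mono hd hw0.le hw le_rfl hv0
    refine lt_of_lt_of_le ?_ this
    simp only [cavityDet]
    linarith

/-- The cavity equation has at most one nonnegative solution: the cavity field increases from any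
solution on. -/
lemma cavityField_injective {d : ℕ} (hd : 2 ≤ d) {w v v' B : ℝ} (hw0 : 0 < w) (hw : w < 1)
    (hv0 : 0 ≤ v) (hvv' : v < v') (hv' : v' < 1) (hB : 0 < B ∨ (d - 1) * w < 1)
    (h : cavityField d w v = 2 * B) (h' : cavityField d w v' = 2 * B) : False := by
  have hpos := cavityDet_pos hd hw0 hw hv0 (hvv'.trans hv') hB h
  obtain ⟨ξ, hξ, hslope⟩ := exists_hasDerivAt_eq_slope (cavityField d w)
    (fun v => 2 * cavityDet d w v / ((1 - v ^ 2) * (1 - w ^ 2 * v ^ 2))) hvv'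
    (fun x hx => (hasDerivAt_cavityField d hw0.le hw (hv0.trans hx.1)
      (hx.2.trans_lt hv')).continuousAt.continuousWithinAt)
    (fun x hx => hasDerivAt_cavityField d hw0.le hw (hv0.trans hx.1.le) (hx.2.trans hv'))
  rw [h, h', sub_self, zero_div] at hslope
  have hξ0 : 0 ≤ ξ := hv0.trans hξ.1.le
  have hξ1 : ξ < 1 := hξ.2.trans hv'
  have h1 : 0 < 1 - ξ ^ 2 := by nlinarith
  have h2 : 0 < 1 - w ^ 2 * ξ ^ 2 := by
    have : w * ξ < 1 := by nlinarith
    nlinarith [mul_nonneg hw0.le hξ0]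
  have h3 := cavityDet_mono hd hw0.le hw hv0 hξ.1.le
  have : 0 < 2 * cavityDet d w ξ / ((1 - ξ ^ 2) * (1 - w ^ 2 * ξ ^ 2)) :=
    div_pos (by linarith) (mul_pos h1 h2)
  linarith

/-- At a critical point with nonnegative angle, `v = b⁻¹ tan θ` solves the cavity equation. -/
lemma exists_cavityField_eq {d : ℕ} (hd : 2 ≤ d) {b B θ : ℝ} (hb0 : 0 < b) (hb : b < 1)
    (hθ0 : 0 ≤ θ) (hθ : θ ≤ Real.pi / 4)
    (h : fieldSum B (fun c => vertexFactor' d c θ) b = 0) :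
    ∃ v, 0 ≤ v ∧ v < 1 ∧ Real.sin θ = b * v * Real.cos θ ∧ cavityField d (b ^ 2) v = 2 * B := by
  have hpi := Real.pi_pos
  have hθ' : |θ| ≤ Real.pi / 4 := by rwa [abs_of_nonneg hθ0]
  have hbb : |b| < 1 := by rwa [abs_of_pos hb0]
  have hp := halfEdgeFactor_pos hbb hθ'
  have hm := halfEdgeFactor_pos (b := -b) (by rwa [abs_neg]) hθ'
  have hc : 0 < Real.cos θ := Real.cos_pos_of_mem_Ioo ⟨by linarith, by linarith⟩
  have hs : 0 ≤ Real.sin θ := Real.sin_nonneg_of_nonneg_of_le_pi hθ0 (by linarith)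
  rw [crit_iff hd] at h
  have hδ : 0 < b * Real.cos θ + Real.sin θ := by positivity
  have hα : 0 < b * Real.cos θ - Real.sin θ := by
    have h1 : 0 < Real.exp (-B) * halfEdgeFactor (-b) θ ^ (d - 1) *
      (b * Real.cos θ + Real.sin θ) := by positivity
    rw [← h] at h1
    exact (pos_iff_pos_of_mul_pos h1).1 (by positivity)
  set v := Real.sin θ / (b * Real.cos θ) with hv
  have hsv : Real.sin θ = b * v * Real.cos θ := by
    rw [hv]
    field_simp
  have hv0 : 0 ≤ v := by positivity
  have hv1 : v < 1 := by
    rw [hv, div_lt_one (by positivity)]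
    linarith
  refine ⟨v, hv0, hv1, hsv, ?_⟩
  have hwv : b ^ 2 * v < 1 := by nlinarith
  have hwv0 : 0 ≤ b ^ 2 * v := by positivity
  have e1 : halfEdgeFactor b θ = Real.cos θ * (1 + b ^ 2 * v) := by
    rw [halfEdgeFactor, hsv]; ring
  have e2 : halfEdgeFactor (-b) θ = Real.cos θ * (1 - b ^ 2 * v) := by
    rw [halfEdgeFactor, hsv]; ring
  have e3 : b * Real.cos θ - Real.sin θ = b * Real.cos θ * (1 - v) := by rw [hsv]; ring
  have e4 : b * Real.cos θ + Real.sin θ = b * Real.cos θ * (1 + v) := by rw [hsv]; ring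
  have h2 := congrArg Real.log h
  have hd1 : ((d - 1 : ℕ) : ℝ) = d - 1 := by
    rw [Nat.cast_sub (by omega), Nat.cast_one]
  have l1 : (1 : ℝ) - v ≠ 0 := by linarith
  have l2 : (1 : ℝ) + v ≠ 0 := by linarith
  have l3 : (1 : ℝ) - b ^ 2 * v ≠ 0 := by linarith
  have l4 : (1 : ℝ) + b ^ 2 * v ≠ 0 := by linarith
  have l5 : b * Real.cos θ ≠ 0 := by positivity
  rw [Real.log_mul (by positivity) hα.ne', Real.log_mul (by positivity) (by positivity),
    Real.log_mul (by positivity) hδ.ne', Real.log_mul (by positivity) (by positivity),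
    Real.log_exp, Real.log_exp, Real.log_pow, Real.log_pow, e1, e2, e3, e4,
    Real.log_mul hc.ne' l4, Real.log_mul hc.ne' l3, Real.log_mul l5 l1,
    Real.log_mul l5 l2, hd1] at h2
  rw [cavityField]
  linear_combination -h2

/-- The second derivative at a critical point has the sign of minus the cavity determinant. -/
lemma concave_iff {d : ℕ} (hd : 2 ≤ d) {b B θ : ℝ} (hb0 : 0 < b)
    (hp : 0 < halfEdgeFactor b θ) (hm : 0 < halfEdgeFactor (-b) θ)
    (hα : 0 < b * Real.cos θ - Real.sin θ) (hδ : 0 < b * Real.cos θ + Real.sin θ)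
    (h : fieldSum B (fun c => vertexFactor' d c θ) b = 0) :
    fieldSum B (fun c => vertexFactor'' d c θ) b < 0 ↔
      (d - 1) * (b ^ 2 * Real.cos θ ^ 2 - Real.sin θ ^ 2) <
        Real.cos θ ^ 2 - b ^ 2 * Real.sin θ ^ 2 := by
  rw [crit_iff hd] at h
  have hd1 : ((d - 1 : ℕ) : ℝ) = d - 1 := by
    rw [Nat.cast_sub (by omega), Nat.cast_one]
  have hd0 : (0 : ℝ) < d := by positivity
  have hpow : ∀ x : ℝ, x ^ (d - 1) = x ^ (d - 1 - 1) * x := fun x => by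
    rw [← pow_succ]
    congr 1
    omega
  obtain ⟨E, hE⟩ : ∃ E, E = Real.exp B * halfEdgeFactor b θ ^ (d - 1 - 1) := ⟨_, rfl⟩
  obtain ⟨F, hF⟩ : ∃ F, F = Real.exp (-B) * halfEdgeFactor (-b) θ ^ (d - 1 - 1) := ⟨_, rfl⟩
  have hE0 : 0 < E := by rw [hE]; positivity
  have hF0 : 0 < F := by rw [hF]; positivity
  obtain ⟨k, hk⟩ : ∃ k, k = E * halfEdgeFactor b θ * (b * Real.cos θ - Real.sin θ) := ⟨_, rfl⟩
  have hk0 : 0 < k := by rw [hk]; positivity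
  have hk' : k = F * halfEdgeFactor (-b) θ * (b * Real.cos θ + Real.sin θ) := by
    rw [hk, hE, hF]
    rw [hpow, hpow] at h
    linear_combination h
  set P := halfEdgeFactor b θ with hP
  set M := halfEdgeFactor (-b) θ with hM
  set α := b * Real.cos θ - Real.sin θ with hα'
  set δ := b * Real.cos θ + Real.sin θ with hδ'
  have hs : Real.sin θ ^ 2 + Real.cos θ ^ 2 = 1 := Real.sin_sq_add_cos_sq θ
  have h1 : α * M + δ * P = 2 * b := by
    simp only [hP, hM, hα', hδ', halfEdgeFactor]
    linear_combination 2 * b * hs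
  have h2 : P * δ + M * α = 2 * b := by linear_combination h1
  have hX : (E * α ^ 2 + F * δ ^ 2) * (P * M) = 2 * b * k := by
    linear_combination (-α * M) * hk - (δ * P) * hk' + k * h1
  have hY : (E * P ^ 2 + F * M ^ 2) * (α * δ) = 2 * b * k := by
    linear_combination (-P * δ) * hk - (M * α) * hk' + k * h2
  have hval : fieldSum B (fun c => vertexFactor'' d c θ) b =
      d * ((d - 1) * (E * α ^ 2 + F * δ ^ 2) - (E * P ^ 2 + F * M ^ 2)) := by
    simp only [fieldSum, vertexFactor'', halfEdgeFactor', hd1, hE, hF, hpow,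
      ← hP, ← hM, hα', hδ']
    ring
  have hαδ : b ^ 2 * Real.cos θ ^ 2 - Real.sin θ ^ 2 = α * δ := by rw [hα', hδ']; ring
  have hPM : Real.cos θ ^ 2 - b ^ 2 * Real.sin θ ^ 2 = P * M := by
    rw [hP, hM, halfEdgeFactor, halfEdgeFactor]; ring
  have hPM0 : 0 < P * M := mul_pos hp hm
  have hαδ0 : 0 < α * δ := mul_pos hα hδ
  rw [hval, hαδ, hPM]
  have hX' : E * α ^ 2 + F * δ ^ 2 = 2 * b * k / (P * M) := by rw [eq_div_iff hPM0.ne', hX]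
  have hY' : E * P ^ 2 + F * M ^ 2 = 2 * b * k / (α * δ) := by rw [eq_div_iff hαδ0.ne', hY]
  have hprod : (d : ℝ) * ((d - 1) * (2 * b * k / (P * M)) - 2 * b * k / (α * δ)) =
      (d * (2 * b * k) / ((P * M) * (α * δ))) * ((d - 1) * (α * δ) - P * M) := by
    field_simp
  have hcoef : 0 < d * (2 * b * k) / ((P * M) * (α * δ)) := by positivity
  rw [hX', hY', hprod, mul_neg_iff]
  constructor
  · rintro (⟨-, h⟩ | ⟨h, -⟩)
    · linarith
    · linarith
  · intro h
    exact Or.inl ⟨hcoef, by linarith⟩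

/-- For a nonnegative field the maximizer has a nonnegative angle. -/
lemma IsAbsMax.nonneg {d : ℕ} (hd : 2 ≤ d) {b B θ : ℝ} (hb0 : 0 ≤ b) (hb : b < 1) (hB : 0 ≤ B)
    (hB' : 0 < B ∨ (d - 1) * b ^ 2 < 1) (h : IsAbsMax d b B θ) : 0 ≤ θ := by
  have hpi := Real.pi_pos
  have hbb : |b| < 1 := by rwa [abs_of_nonneg hb0]
  obtain ⟨h1, h2⟩ := abs_le.1 h.2
  have hp := halfEdgeFactor_pos hbb h.2
  have hm := halfEdgeFactor_pos (b := -b) (by rwa [abs_neg]) h.2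
  rcases hb0.lt_or_eq with hb0 | rfl
  · by_contra! hθ
    rcases hB.lt_or_eq with hB | rfl
    -- in a positive field, a negative angle has a smaller weight than its reflection
    · have hs : Real.sin θ < 0 := Real.sin_neg_of_neg_of_neg_pi_lt hθ (by linarith)
      have hlt : vertexFactor d b θ < vertexFactor d (-b) θ := by
        refine pow_lt_pow_left₀ ?_ hp.le (by omega)
        simp only [halfEdgeFactor]
        nlinarith
      have hle := h.1 (show -θ ∈ Set.Icc _ _ from ⟨by linarith, by linarith⟩)
      change absWeight d b B (-θ) ≤ absWeight d b B θ at hle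
      have he : Real.exp (-B) < Real.exp B := Real.exp_lt_exp.2 (by linarith)
      rw [absWeight_eq_vertexWeight hp.le hm.le, absWeight_eq_vertexWeight
        (by rw [halfEdgeFactor_neg]; exact hm.le)
        (by rw [halfEdgeFactor_neg, neg_neg]; exact hp.le)] at hle
      simp only [vertexWeight, fieldSum, vertexFactor_neg, neg_neg] at hle
      nlinarith
    -- in the zero field, its reflection would be a second solution of the cavity equation
    · have hn := h.neg
      obtain ⟨v, hv0, hv1, hsv, hv⟩ := exists_cavityField_eq hd hb0 hb (by linarith)
        (by linarith) (hn.crit hbb)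
      have hs : 0 < Real.sin (-θ) := Real.sin_pos_of_pos_of_lt_pi (by linarith) (by linarith)
      have hv0' : 0 < v := by
        rcases hv0.lt_or_eq with h | h
        · exact h
        · rw [← h] at hsv
          simp at hsv
          rw [Real.sin_neg, hsv] at hs
          simp at hs
      exact cavityField_injective hd (by positivity) (by nlinarith) le_rfl hv0' hv1 hB'
        (by simp [cavityField]) hv
  · have hc := (crit_iff hd).1 (h.crit hbb)
    rw [neg_zero] at hc hm
    have h3 : (Real.exp B * halfEdgeFactor 0 θ ^ (d - 1) +
        Real.exp (-B) * halfEdgeFactor 0 θ ^ (d - 1)) * Real.sin θ = 0 := by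
      linear_combination -hc
    have h4 : Real.sin θ = 0 := (mul_eq_zero.1 h3).resolve_left (by positivity)
    exact ((Real.sin_eq_zero_iff_of_lt_of_lt (by linarith) (by linarith)).1 h4).ge

lemma IsAbsMax.eq_of_zero {d : ℕ} (hd : 2 ≤ d) {B θ : ℝ} (h : IsAbsMax d 0 B θ) : θ = 0 := by
  have hpi := Real.pi_pos
  have hbb : |(0 : ℝ)| < 1 := by simp
  obtain ⟨h1, h2⟩ := abs_le.1 h.2
  have hp := halfEdgeFactor_pos hbb h.2
  have hc := (crit_iff hd).1 (h.crit hbb)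
  rw [neg_zero] at hc
  have h3 : (Real.exp B * halfEdgeFactor 0 θ ^ (d - 1) +
      Real.exp (-B) * halfEdgeFactor 0 θ ^ (d - 1)) * Real.sin θ = 0 := by
    linear_combination -hc
  have h4 : Real.sin θ = 0 := (mul_eq_zero.1 h3).resolve_left (by positivity)
  exact (Real.sin_eq_zero_iff_of_lt_of_lt (by linarith) (by linarith)).1 h4

lemma IsAbsMax.unique {d : ℕ} (hd : 2 ≤ d) {b B θ θ' : ℝ} (hb0 : 0 ≤ b) (hb : b < 1)
    (hB : 0 ≤ B) (hB' : 0 < B ∨ (d - 1) * b ^ 2 < 1) (h : IsAbsMax d b B θ)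
    (h' : IsAbsMax d b B θ') : θ = θ' := by
  have hpi := Real.pi_pos
  have hbb : |b| < 1 := by rwa [abs_of_nonneg hb0]
  have hθ := h.nonneg hd hb0 hb hB hB'
  have hθ' := h'.nonneg hd hb0 hb hB hB'
  rcases hb0.lt_or_eq with hb0 | rfl
  · have h1 := (abs_le.1 h.2).2
    have h2 := (abs_le.1 h'.2).2
    obtain ⟨v, hv0, hv1, hsv, hv⟩ := exists_cavityField_eq hd hb0 hb hθ h1 (h.crit hbb)
    obtain ⟨v', hv0', hv1', hsv', hv'⟩ := exists_cavityField_eq hd hb0 hb hθ' h2 (h'.crit hbb)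
    have hw0 : 0 < b ^ 2 := by positivity
    have hw : b ^ 2 < 1 := by nlinarith
    have hvv : v = v' := by
      rcases lt_trichotomy v v' with hlt | heq | hlt
      · exact (cavityField_injective hd hw0 hw hv0 hlt hv1' hB' hv hv').elim
      · exact heq
      · exact (cavityField_injective hd hw0 hw hv0' hlt hv1 hB' hv' hv).elim
    have hc : 0 < Real.cos θ := Real.cos_pos_of_mem_Ioo ⟨by linarith, by linarith⟩
    have hc' : 0 < Real.cos θ' := Real.cos_pos_of_mem_Ioo ⟨by linarith, by linarith⟩
    have h0 : Real.sin (θ - θ') = 0 := by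
      rw [Real.sin_sub, hsv, hsv', hvv]
      ring
    linarith [(Real.sin_eq_zero_iff_of_lt_of_lt (by linarith) (by linarith)).1 h0]
  · rw [h.eq_of_zero hd, h'.eq_of_zero hd]

/-- Existence of the peak for a nonnegative field, with the bound on its angle that follows from
nondegeneracy. -/
lemma exists_isPeak_of_nonneg {d : ℕ} (hd : 2 ≤ d) {b B : ℝ} (hb0 : 0 ≤ b) (hb : b < 1)
    (hB : 0 ≤ B) (hB' : 0 < B ∨ (d - 1) * b ^ 2 < 1) : ∃ θ, IsPeak d b B θ ∧
      (0 < b → ∃ v, 0 ≤ v ∧ Real.sin θ = b * v * Real.cos θ ∧ 0 < cavityDet d (b ^ 2) v) := by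
  have hpi := Real.pi_pos
  have hbb : |b| < 1 := by rwa [abs_of_nonneg hb0]
  obtain ⟨θ, h⟩ := exists_isAbsMax (d := d) (by omega) hbb B
  have hθ0 := h.nonneg hd hb0 hb hB hB'
  have hθ1 := (abs_le.1 h.2).2
  have hp := halfEdgeFactor_pos hbb h.2
  have hm := halfEdgeFactor_pos (b := -b) (by rwa [abs_neg]) h.2
  have hc : 0 < Real.cos θ := Real.cos_pos_of_mem_Ioo ⟨by linarith, by linarith⟩
  refine ⟨θ, ⟨⟨by linarith, by linarith⟩, hp, hm, h.crit hbb, ?_, ?_⟩, fun hb0 => ?_⟩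
  · rcases hb0.lt_or_eq with hb0 | rfl
    · obtain ⟨v, hv0, hv1, hsv, hv⟩ := exists_cavityField_eq hd hb0 hb hθ0 hθ1 (h.crit hbb)
      have hdet := cavityDet_pos hd (by positivity) (by nlinarith : b ^ 2 < 1) hv0 hv1 hB' hv
      rw [concave_iff hd hb0 hp hm _ _ (h.crit hbb), hsv]
      · rw [cavityDet] at hdet
        have := mul_pos (pow_pos hc 2) hdet
        linear_combination this
      · rw [hsv]
        have : 0 < b * Real.cos θ * (1 - v) := mul_pos (by positivity) (by linarith)
        linarith
      · have := Real.sin_nonneg_of_nonneg_of_le_pi hθ0 (by linarith)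
        positivity
    · rw [h.eq_of_zero hd]
      simp only [fieldSum, vertexFactor'', halfEdgeFactor', halfEdgeFactor]
      simp
      have h1 : 0 < Real.exp B * d := by positivity
      have h2 : 0 < Real.exp (-B) * d := by positivity
      linarith
  · intro x hx hne
    rw [← absWeight_eq_vertexWeight hp.le hm.le]
    refine lt_of_le_of_ne (h.1 hx) fun heq => hne ?_
    refine IsAbsMax.unique hd hb0 hb hB hB' (IsAbsMax.of_isMaxOn (by omega) hbb hx ?_) h
    intro y hy
    change absWeight d b B y ≤ absWeight d b B x
    rw [heq]
    exact h.1 hy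
  · obtain ⟨v, hv0, hv1, hsv, hv⟩ := exists_cavityField_eq hd hb0 hb hθ0 hθ1 (h.crit hbb)
    exact ⟨v, hv0, hsv, cavityDet_pos hd (by positivity) (by nlinarith) hv0 hv1 hB' hv⟩

/-- Away from the phase transition the weight of a vertex has a peak. -/
lemma exists_isPeak {d : ℕ} (hd : 2 ≤ d) {b B : ℝ} (hb0 : 0 ≤ b) (hb : b < 1)
    (hB : B ≠ 0 ∨ (d - 1) * b ^ 2 < 1) : ∃ θ, IsPeak d b B θ := by
  rcases lt_trichotomy B 0 with h | h | h
  · obtain ⟨θ, hθ, -⟩ := exists_isPeak_of_nonneg hd hb0 hb (B := -B) (by linarith)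
      (Or.inl (by linarith))
    exact ⟨-θ, by simpa using hθ.neg⟩
  · obtain ⟨θ, hθ, -⟩ := exists_isPeak_of_nonneg hd hb0 hb (B := B) h.ge
      (hB.imp_left fun hB => absurd h hB)
    exact ⟨θ, hθ⟩
  · obtain ⟨θ, hθ, -⟩ := exists_isPeak_of_nonneg hd hb0 hb (B := B) h.le (Or.inl h)
    exact ⟨θ, hθ⟩

/-! ### Second-order expansions and the quadratic bound at the peak -/

/-- Taylor's formula of order two with the remainder of Peano. -/
lemma isLittleO_taylor_two {E : Type*} [NormedAddCommGroup E] [NormedSpace ℝ E] {f f' : ℝ → E}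
    {x₀ : ℝ} {c : E} (hf : ∀ x, HasDerivAt f (f' x) x) (hf' : HasDerivAt f' c x₀) :
    (fun x => f x - f x₀ - (x - x₀) • f' x₀ - ((x - x₀) ^ 2 / 2) • c) =o[𝓝 x₀]
      fun x => (x - x₀) ^ 2 := by
  rw [Asymptotics.isLittleO_iff]
  intro ε hε
  have h1 := (hasDerivAt_iff_isLittleO.1 hf')
  rw [Asymptotics.isLittleO_iff] at h1
  obtain ⟨δ, hδ, hball⟩ := Metric.eventually_nhds_iff_ball.1 (h1 hε)
  refine Metric.eventually_nhds_iff_ball.2 ⟨δ, hδ, fun x hx => ?_⟩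
  set φ : ℝ → E := fun y => f y - f x₀ - (y - x₀) • f' x₀ - ((y - x₀) ^ 2 / 2) • c with hφ
  have hder : ∀ y, HasDerivAt φ (f' y - f' x₀ - (y - x₀) • c) y := by
    intro y
    have h2 : HasDerivAt (fun y : ℝ => y - x₀) 1 y := (hasDerivAt_id y).sub_const x₀
    have h3 : HasDerivAt (fun y : ℝ => (y - x₀) ^ 2 / 2) (y - x₀) y :=
      ((h2.fun_pow 2).div_const 2).congr_deriv (by norm_num)
    exact ((((hf y).sub_const (f x₀)).sub (h2.smul_const (f' x₀))).sub
      (h3.smul_const c)).congr_deriv (by rw [one_smul])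
  have hseg : segment ℝ x₀ x ⊆ Metric.closedBall x₀ |x - x₀| := by
    refine (convex_closedBall x₀ _).segment_subset (Metric.mem_closedBall_self (abs_nonneg _)) ?_
    rw [Metric.mem_closedBall, Real.dist_eq]
  have hb : ∀ y ∈ segment ℝ x₀ x, ‖f' y - f' x₀ - (y - x₀) • c‖ ≤ ε * |x - x₀| := by
    intro y hy
    have h3 := hseg hy
    rw [Metric.mem_closedBall, Real.dist_eq] at h3
    rw [Metric.mem_ball, Real.dist_eq] at hx
    have h4 := hball y (by rw [Metric.mem_ball, Real.dist_eq]; exact h3.trans_lt hx)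
    exact h4.trans (mul_le_mul_of_nonneg_left h3 hε.le)
  have h5 := Convex.norm_image_sub_le_of_norm_hasDerivWithin_le
    (fun y _ => (hder y).hasDerivWithinAt) hb (convex_segment x₀ x)
    (left_mem_segment ℝ x₀ x) (right_mem_segment ℝ x₀ x)
  have h6 : φ x₀ = 0 := by simp [hφ]
  rw [h6, sub_zero] at h5
  refine h5.trans (le_of_eq ?_)
  rw [Real.norm_eq_abs, Real.norm_eq_abs, abs_pow]
  ring

lemma hasDerivAt_vertexWeight' (d : ℕ) (b B θ : ℝ) :
    HasDerivAt (fun θ => fieldSum B (fun c => vertexFactor' d c θ) b)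
      (fieldSum B (fun c => vertexFactor'' d c θ) b) θ :=
  ((hasDerivAt_vertexFactor' d b θ).const_mul _).add
    ((hasDerivAt_vertexFactor' d (-b) θ).const_mul _)

lemma vertexWeight_pos {D : ℕ} {b B θ : ℝ} (h1 : 0 < halfEdgeFactor b θ)
    (h2 : 0 < halfEdgeFactor (-b) θ) : 0 < vertexWeight D b B θ :=
  add_pos (mul_pos (Real.exp_pos _) (pow_pos h1 _)) (mul_pos (Real.exp_pos _) (pow_pos h2 _))

lemma IsPeak.weight_pos {d : ℕ} {b B θ₀ : ℝ} (h : IsPeak d b B θ₀) (D : ℕ) :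
    0 < vertexWeight D b B θ₀ := vertexWeight_pos h.plus_pos h.minus_pos

lemma continuous_halfEdgeFactor (b : ℝ) : Continuous (halfEdgeFactor b) := by
  unfold halfEdgeFactor
  fun_prop

/-- A quadratic bound for the weight around its peak, valid on the whole half circle. -/
lemma IsPeak.exists_quadratic_bound {d : ℕ} {b B θ₀ : ℝ} (h : IsPeak d b B θ₀) :
    ∃ c > 0, ∀ θ ∈ Set.Icc (-(Real.pi / 2)) (Real.pi / 2),
      absWeight d b B θ ≤ vertexWeight d b B θ₀ * (1 - c * (θ - θ₀) ^ 2) := by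
  have hpi := Real.pi_pos
  have hg := h.weight_pos d
  set g := vertexWeight d b B θ₀ with hgdef
  set a := -(fieldSum B (fun c => vertexFactor'' d c θ₀) b) with ha
  have ha0 : 0 < a := by have := h.concave; linarith
  -- near the peak, by Taylor's formula
  have hT := isLittleO_taylor_two (hasDerivAt_vertexWeight d b B)
    (hasDerivAt_vertexWeight' d b B θ₀)
  rw [Asymptotics.isLittleO_iff] at hT
  have hnear : ∀ᶠ θ in 𝓝 θ₀, absWeight d b B θ ≤ g - a / 4 * (θ - θ₀) ^ 2 := by
    filter_upwards [hT (show 0 < a / 4 by positivity),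
      (continuous_halfEdgeFactor b).continuousAt.eventually (lt_mem_nhds h.plus_pos),
      (continuous_halfEdgeFactor (-b)).continuousAt.eventually (lt_mem_nhds h.minus_pos)]
      with θ h1 h2 h3
    rw [absWeight_eq_vertexWeight h2.le h3.le]
    rw [h.crit, Real.norm_eq_abs, Real.norm_eq_abs, smul_zero, sub_zero, smul_eq_mul,
      abs_of_nonneg (sq_nonneg (θ - θ₀))] at h1
    have h4 := (abs_le.1 h1).2
    have h5 : fieldSum B (fun c => vertexFactor'' d c θ₀) b = -a := by rw [ha, neg_neg]
    rw [h5] at h4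
    linarith
  obtain ⟨δ, hδ, hball⟩ := Metric.eventually_nhds_iff_ball.1 hnear
  -- away from the peak, by compactness
  have hfar : ∃ η > 0, ∀ θ ∈ Set.Icc (-(Real.pi / 2)) (Real.pi / 2), θ ∉ Metric.ball θ₀ δ →
      absWeight d b B θ ≤ g - η := by
    set K := Set.Icc (-(Real.pi / 2)) (Real.pi / 2) \ Metric.ball θ₀ δ with hK
    have hKc : IsCompact K := isCompact_Icc.diff Metric.isOpen_ball
    rcases K.eq_empty_or_nonempty with hE | hne
    · exact ⟨1, one_pos, fun θ h1 h2 => absurd (show θ ∈ K from ⟨h1, h2⟩) (by simp [hE])⟩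
    · obtain ⟨x, hx, hmax⟩ := hKc.exists_isMaxOn hne (continuous_absWeight d b B).continuousOn
      have hxne : x ≠ θ₀ := fun he => hx.2 (he ▸ Metric.mem_ball_self hδ)
      refine ⟨g - absWeight d b B x, sub_pos.2 (h.lt x hx.1 hxne), fun θ h1 h2 => ?_⟩
      have : absWeight d b B θ ≤ absWeight d b B x := hmax (show θ ∈ K from ⟨h1, h2⟩)
      linarith
  obtain ⟨η, hη, hfar⟩ := hfar
  refine ⟨min (a / 4) (η / Real.pi ^ 2) / g, by positivity, fun θ hθ => ?_⟩
  have hform : g * (1 - min (a / 4) (η / Real.pi ^ 2) / g * (θ - θ₀) ^ 2) =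
      g - min (a / 4) (η / Real.pi ^ 2) * (θ - θ₀) ^ 2 := by
    field_simp
  rw [hform]
  by_cases hb : θ ∈ Metric.ball θ₀ δ
  · refine (hball θ hb).trans ?_
    have := mul_le_mul_of_nonneg_right (min_le_left (a / 4) (η / Real.pi ^ 2))
      (sq_nonneg (θ - θ₀))
    linarith
  · refine (hfar θ hθ hb).trans ?_
    have h1 := mul_le_mul_of_nonneg_right (min_le_right (a / 4) (η / Real.pi ^ 2))
      (sq_nonneg (θ - θ₀))
    have h2 : (θ - θ₀) ^ 2 ≤ Real.pi ^ 2 := by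
      refine sq_le_sq.2 ?_
      rw [abs_of_pos hpi, abs_le]
      have := h.mem
      constructor <;> linarith [hθ.1, hθ.2, this.1, this.2]
    have h3 : η / Real.pi ^ 2 * (θ - θ₀) ^ 2 ≤ η := by
      calc η / Real.pi ^ 2 * (θ - θ₀) ^ 2 ≤ η / Real.pi ^ 2 * Real.pi ^ 2 := by gcongr
        _ = η := by field_simp
    linarith

lemma abs_halfEdgeFactor_le (b θ : ℝ) : |halfEdgeFactor b θ| ≤ 1 + |b| := by
  have h1 := Real.abs_cos_le_one θ
  have h2 := Real.abs_sin_le_one θ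
  calc |halfEdgeFactor b θ| ≤ |Real.cos θ| + |b * Real.sin θ| := abs_add_le _ _
    _ ≤ 1 + |b| := by
      rw [abs_mul]
      nlinarith [abs_nonneg b]

lemma abs_halfEdgeFactor'_le (b θ : ℝ) : |halfEdgeFactor' b θ| ≤ 1 + |b| := by
  have h1 := Real.abs_cos_le_one θ
  have h2 := Real.abs_sin_le_one θ
  calc |halfEdgeFactor' b θ| ≤ |-Real.sin θ| + |b * Real.cos θ| := abs_add_le _ _
    _ ≤ 1 + |b| := by
      rw [abs_mul, abs_neg]
      nlinarith [abs_nonneg b]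

lemma abs_vertexFactor_le (d : ℕ) (b θ : ℝ) : |vertexFactor d b θ| ≤ (1 + |b|) ^ d := by
  rw [vertexFactor, abs_pow]
  exact pow_le_pow_left₀ (abs_nonneg _) (abs_halfEdgeFactor_le b θ) d

lemma exists_lipschitz_vertexFactor (d : ℕ) (b : ℝ) :
    ∃ L, 0 ≤ L ∧ ∀ θ θ', |vertexFactor d b θ - vertexFactor d b θ'| ≤ L * |θ - θ'| := by
  refine ⟨d * ((1 + |b|) ^ (d - 1) * (1 + |b|)), by positivity, fun θ θ' => ?_⟩
  refine Convex.norm_image_sub_le_of_norm_hasDerivWithin_le (s := Set.univ)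
    (fun x _ => (hasDerivAt_vertexFactor d b x).hasDerivWithinAt) (fun x _ => ?_) convex_univ
    (Set.mem_univ _) (Set.mem_univ _)
  rw [Real.norm_eq_abs, vertexFactor', abs_mul, abs_mul, abs_pow, Nat.abs_cast]
  gcongr
  · exact abs_halfEdgeFactor_le b x
  · exact abs_halfEdgeFactor'_le b x

/-! ### The Laplace method -/

/-- The magnetization of a vertex at the angle `θ`. -/
def vertexMean (d : ℕ) (b B θ : ℝ) : ℝ :=
  (Real.exp B * vertexFactor d b θ - Real.exp (-B) * vertexFactor d (-b) θ) /
    vertexWeight d b B θ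

/-- The derivative of the magnetization of a vertex with respect to the angle, at a critical
point of the weight. -/
def vertexMean' (d : ℕ) (b B θ : ℝ) : ℝ :=
  (Real.exp B * vertexFactor' d b θ - Real.exp (-B) * vertexFactor' d (-b) θ) /
    vertexWeight d b B θ

/-- Minus the second derivative of the logarithm of the weight, at a critical point. -/
def curvature (d : ℕ) (b B θ : ℝ) : ℝ :=
  -fieldSum B (fun c => vertexFactor'' d c θ) b / vertexWeight d b B θ

/-- The limit susceptibility: the variance of a spin at the peak, plus the contribution of the
Gaussian fluctuations of the angle. -/
def peakVariance (d : ℕ) (b B θ : ℝ) : ℝ :=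
  1 - vertexMean d b B θ ^ 2 + vertexMean' d b B θ ^ 2 / curvature d b B θ

/-- The weight of a vertex in a complex field. -/
def complexWeight (D : ℕ) (b : ℝ) (ζ : ℂ) (θ : ℝ) : ℂ :=
  Complex.exp ζ * vertexFactor D b θ + Complex.exp (-ζ) * vertexFactor D (-b) θ

/-- The weight of a vertex in the field `B + z ε` at the angle `θ`, centered and normalized by its
value at the peak for `ε = 0`. -/
def centeredWeight (d : ℕ) (b B θ₀ : ℝ) (z : ℂ) (ε θ : ℝ) : ℂ :=
  complexWeight d b (B + z * ε) θ * Complex.exp (-(z * vertexMean d b B θ₀ * ε)) /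
    vertexWeight d b B θ₀

lemma centeredWeight_eq (d : ℕ) (b B θ₀ : ℝ) (z : ℂ) (ε θ : ℝ) :
    centeredWeight d b B θ₀ z ε θ =
      (Complex.exp (B + z * (1 - vertexMean d b B θ₀) * ε) * (vertexFactor d b θ : ℂ) +
      Complex.exp (-B + -(z * (1 + vertexMean d b B θ₀)) * ε) * (vertexFactor d (-b) θ : ℂ)) /
        vertexWeight d b B θ₀ := by
  rw [centeredWeight, complexWeight]
  congr 1
  rw [add_mul, mul_right_comm, mul_right_comm (Complex.exp (-(B + z * ε))), ← Complex.exp_add,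
    ← Complex.exp_add]
  congr 3 <;> ring_nf

lemma IsPeak.curvature_pos {d : ℕ} {b B θ₀ : ℝ} (h : IsPeak d b B θ₀) :
    0 < curvature d b B θ₀ :=
  div_pos (neg_pos.2 h.concave) (h.weight_pos d)

lemma continuous_complexWeight (D : ℕ) (b : ℝ) (ζ : ℂ) : Continuous (complexWeight D b ζ) := by
  have h1 := continuous_vertexFactor D b
  have h2 := continuous_vertexFactor D (-b)
  unfold complexWeight
  fun_prop

lemma complexWeight_ofReal (D : ℕ) (b B θ : ℝ) :
    complexWeight D b B θ = (vertexWeight D b B θ : ℂ) := by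
  simp [complexWeight, vertexWeight, fieldSum]

/-- The derivative of one of the two terms of `centeredWeight` along the scaling
`θ = θ₀ + x ε`. -/
lemma hasDerivAt_exp_mul_comp {p p' : ℝ → ℝ} (hp : ∀ θ, HasDerivAt p (p' θ) θ) (a₀ a : ℂ)
    (x θ₀ ε : ℝ) : HasDerivAt (fun ε : ℝ => Complex.exp (a₀ + a * ε) * (p (θ₀ + x * ε) : ℂ))
      (Complex.exp (a₀ + a * ε) * (a * p (θ₀ + x * ε) + x * p' (θ₀ + x * ε))) ε := by
  have h1 : HasDerivAt (fun ε : ℝ => Complex.exp (a₀ + a * ε))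
      (Complex.exp (a₀ + a * ε) * a) ε := by
    have : HasDerivAt (fun ε : ℝ => a₀ + a * (ε : ℂ)) a ε := by
      simpa using ((hasDerivAt_id ε).ofReal_comp.const_mul a).const_add a₀
    exact this.cexp
  have h2 : HasDerivAt (fun ε : ℝ => (p (θ₀ + x * ε) : ℂ)) ((p' (θ₀ + x * ε) * x : ℝ) : ℂ) ε := by
    have h3 : HasDerivAt (fun ε : ℝ => θ₀ + x * ε) x ε := by
      simpa using ((hasDerivAt_id ε).const_mul x).const_add θ₀
    exact ((hp _).comp ε h3).ofReal_comp
  refine (h1.mul h2).congr_deriv ?_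
  push_cast
  ring

/-- Second-order expansion of the centered weight along the scaling `θ = θ₀ + x ε`. The linear
term vanishes by the centering and because `θ₀` is critical. -/
lemma IsPeak.isLittleO_centeredWeight {d : ℕ} {b B θ₀ : ℝ} (h : IsPeak d b B θ₀) (z : ℂ) (x : ℝ) :
    (fun ε : ℝ => centeredWeight d b B θ₀ z ε (θ₀ + x * ε) - 1 -
      ((ε - 0) ^ 2 / 2 : ℝ) • (z ^ 2 * (1 - vertexMean d b B θ₀ ^ 2) +
        2 * z * x * vertexMean' d b B θ₀ - curvature d b B θ₀ * x ^ 2)) =o[𝓝 0]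
      fun ε : ℝ => (ε - 0) ^ 2 := by
  have hg : (vertexWeight d b B θ₀ : ℂ) ≠ 0 := by exact_mod_cast (h.weight_pos d).ne'
  set m := vertexMean d b B θ₀ with hm
  set g := vertexWeight d b B θ₀ with hgdef
  set a : ℂ := z * (1 - m) with ha
  set a' : ℂ := -(z * (1 + m)) with ha'
  set f : ℝ → ℂ := fun ε =>
    (Complex.exp (B + a * ε) * (vertexFactor d b (θ₀ + x * ε) : ℂ) +
      Complex.exp (-B + a' * ε) * (vertexFactor d (-b) (θ₀ + x * ε) : ℂ)) / g with hf
  have hfeq : ∀ ε : ℝ, centeredWeight d b B θ₀ z ε (θ₀ + x * ε) = f ε := by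
    exact fun ε => centeredWeight_eq d b B θ₀ z ε _
  have hd1 : ∀ ε : ℝ, HasDerivAt f ((Complex.exp (B + a * ε) *
      (a * vertexFactor d b (θ₀ + x * ε) + x * vertexFactor' d b (θ₀ + x * ε)) +
      Complex.exp (-B + a' * ε) *
      (a' * vertexFactor d (-b) (θ₀ + x * ε) + x * vertexFactor' d (-b) (θ₀ + x * ε))) / g) ε :=
    fun ε => ((hasDerivAt_exp_mul_comp (hasDerivAt_vertexFactor d b) B a x θ₀ ε).add
      (hasDerivAt_exp_mul_comp (hasDerivAt_vertexFactor d (-b)) (-B) a' x θ₀ ε)).div_const _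
  have hsnd : ∀ (b : ℝ) (a₀ a : ℂ), HasDerivAt (fun ε : ℝ => Complex.exp (a₀ + a * ε) *
      (a * vertexFactor d b (θ₀ + x * ε) + x * vertexFactor' d b (θ₀ + x * ε)))
      (Complex.exp a₀ * (a ^ 2 * vertexFactor d b θ₀ + 2 * a * x * vertexFactor' d b θ₀ +
        x ^ 2 * vertexFactor'' d b θ₀)) 0 := by
    intro b a₀ a
    have h1 := (hasDerivAt_exp_mul_comp (hasDerivAt_vertexFactor d b) a₀ a x θ₀ 0).const_mul a
    have h2 := (hasDerivAt_exp_mul_comp (hasDerivAt_vertexFactor' d b) a₀ a x θ₀ 0).const_mul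
      (x : ℂ)
    refine ((h1.fun_add h2).congr_deriv ?_).congr_of_eventuallyEq
      (Eventually.of_forall fun ε => ?_)
    · simp only [Complex.ofReal_zero, mul_zero, add_zero]
      ring
    · simp only
      ring
  have hd2 := ((hsnd b B a).add (hsnd (-b) (-B) a')).div_const (g : ℂ)
  have hT := isLittleO_taylor_two hd1 hd2
  have hPQ : (Complex.exp B * vertexFactor d b θ₀ + Complex.exp (-B) * vertexFactor d (-b) θ₀ : ℂ)
      = g := by
    rw [hgdef, ← complexWeight_ofReal, complexWeight]
  have hmC : (Complex.exp B * vertexFactor d b θ₀ - Complex.exp (-B) * vertexFactor d (-b) θ₀ : ℂ)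
      = m * g := by
    have : m * g = Real.exp B * vertexFactor d b θ₀ - Real.exp (-B) * vertexFactor d (-b) θ₀ := by
      rw [hm, vertexMean, ← hgdef, div_mul_cancel₀ _ (h.weight_pos d).ne']
    exact_mod_cast this.symm
  have hm1 : (Complex.exp B * vertexFactor' d b θ₀ - Complex.exp (-B) * vertexFactor' d (-b) θ₀ : ℂ)
      = vertexMean' d b B θ₀ * g := by
    have : vertexMean' d b B θ₀ * g =
        Real.exp B * vertexFactor' d b θ₀ - Real.exp (-B) * vertexFactor' d (-b) θ₀ := by
      rw [vertexMean', ← hgdef, div_mul_cancel₀ _ (h.weight_pos d).ne']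
    exact_mod_cast this.symm
  have hcr : (Complex.exp B * vertexFactor' d b θ₀ + Complex.exp (-B) * vertexFactor' d (-b) θ₀ : ℂ)
      = 0 := by
    have := h.crit
    rw [fieldSum] at this
    exact_mod_cast this
  have hcu : (Complex.exp B * vertexFactor'' d b θ₀ +
      Complex.exp (-B) * vertexFactor'' d (-b) θ₀ : ℂ) = -(curvature d b B θ₀ * g) := by
    have : -(curvature d b B θ₀ * g) =
        Real.exp B * vertexFactor'' d b θ₀ + Real.exp (-B) * vertexFactor'' d (-b) θ₀ := by
      rw [curvature, ← hgdef, div_mul_cancel₀ _ (h.weight_pos d).ne', neg_neg, fieldSum]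
    exact_mod_cast this.symm
  refine hT.congr_left fun ε => ?_
  rw [hfeq]
  have e0 : f 0 = 1 := by
    rw [hf]
    simp only [Complex.ofReal_zero, mul_zero, add_zero]
    rw [hPQ, div_self hg]
  rw [e0]
  simp only [Complex.ofReal_zero, mul_zero, add_zero]
  have e1 : (Complex.exp B * (a * vertexFactor d b θ₀ + x * vertexFactor' d b θ₀) +
      Complex.exp (-B) * (a' * vertexFactor d (-b) θ₀ + x * vertexFactor' d (-b) θ₀) : ℂ) = 0 := by
    rw [ha, ha']
    linear_combination z * hmC - z * m * hPQ + x * hcr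
  rw [e1, zero_div, smul_zero, sub_zero]
  congr 2
  rw [div_eq_iff hg, ha, ha']
  linear_combination z ^ 2 * (1 + m ^ 2) * hPQ - 2 * z ^ 2 * m * hmC + 2 * z * x * hm1 -
    2 * z * x * m * hcr + x ^ 2 * hcu

lemma tendsto_inv_sqrt_succ : Tendsto (fun k : ℕ => (√((k : ℝ) + 1))⁻¹) atTop (𝓝 0) :=
  tendsto_inv_atTop_zero.comp (Real.tendsto_sqrt_atTop.comp
    (tendsto_atTop_add_const_right _ _ tendsto_natCast_atTop_atTop))

lemma IsPeak.tendsto_centeredWeight_pow {d : ℕ} {b B θ₀ : ℝ} (h : IsPeak d b B θ₀) (z : ℂ)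
    (x : ℝ) : Tendsto (fun k : ℕ => centeredWeight d b B θ₀ z (√((k : ℝ) + 1))⁻¹
        (θ₀ + x * (√((k : ℝ) + 1))⁻¹) ^ k) atTop
      (𝓝 (Complex.exp ((z ^ 2 * (1 - vertexMean d b B θ₀ ^ 2) +
        2 * z * x * vertexMean' d b B θ₀ - curvature d b B θ₀ * x ^ 2) / 2))) := by
  set c : ℂ := z ^ 2 * (1 - vertexMean d b B θ₀ ^ 2) +
        2 * z * x * vertexMean' d b B θ₀ - curvature d b B θ₀ * x ^ 2 with hc
  set ε : ℕ → ℝ := fun k => (√((k : ℝ) + 1))⁻¹ with hε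
  have hεpos : ∀ k, 0 < ε k := fun k => by simp only [hε]; positivity
  have hε2 : ∀ k, ε k ^ 2 = ((k : ℝ) + 1)⁻¹ := fun k => by
    simp only [hε]
    rw [inv_pow, Real.sq_sqrt (by positivity)]
  have h1 := (h.isLittleO_centeredWeight z x).comp_tendsto tendsto_inv_sqrt_succ
  have h2 := h1.tendsto_inv_smul_nhds_zero
  have h3 : Tendsto (fun k : ℕ => (k : ℝ) / (k + 1)) atTop (𝓝 1) :=
    tendsto_natCast_div_add_atTop (1 : ℝ)
  have hkey : Tendsto (fun k : ℕ => (k : ℂ) *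
      (centeredWeight d b B θ₀ z (ε k) (θ₀ + x * ε k) - 1)) atTop (𝓝 (c / 2)) := by
    have h4 : Tendsto (fun k : ℕ => (((k : ℝ) / (k + 1) : ℝ) : ℂ) *
        ((((ε k - 0) ^ 2)⁻¹ : ℝ) • (centeredWeight d b B θ₀ z (ε k) (θ₀ + x * ε k) - 1 -
          ((ε k - 0) ^ 2 / 2 : ℝ) • c) + c / 2)) atTop (𝓝 (((1 : ℝ) : ℂ) * (0 + c / 2))) := by
      refine Tendsto.mul ?_ (h2.add_const _)
      exact (Complex.continuous_ofReal.tendsto _).comp h3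
    rw [Complex.ofReal_one, one_mul, zero_add] at h4
    refine h4.congr fun k => ?_
    have hk : (k : ℂ) + 1 ≠ 0 := by exact_mod_cast (Nat.succ_ne_zero k)
    rw [sub_zero, hε2, Complex.real_smul, Complex.real_smul]
    push_cast
    field_simp
    ring
  have h5 := Complex.tendsto_one_add_pow_exp_of_tendsto hkey
  refine h5.congr fun k => ?_
  rw [add_sub_cancel]

lemma IsPeak.abs_vertexMean_le {d : ℕ} {b B θ₀ : ℝ} (h : IsPeak d b B θ₀) :
    |vertexMean d b B θ₀| ≤ 1 := by
  have hg := h.weight_pos d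
  have h1 : 0 < Real.exp B * vertexFactor d b θ₀ := mul_pos (Real.exp_pos _) (pow_pos h.plus_pos _)
  have h2 : 0 < Real.exp (-B) * vertexFactor d (-b) θ₀ :=
    mul_pos (Real.exp_pos _) (pow_pos h.minus_pos _)
  rw [vertexMean, abs_div, abs_of_pos hg, div_le_one hg, vertexWeight, fieldSum, abs_le]
  constructor <;> linarith

/-- A Gaussian bound for the centered weight. Only the real part of the field matters, and the
linear term in the field is small near the peak because of the centering. -/
lemma IsPeak.exists_norm_centeredWeight_le {d : ℕ} {b B θ₀ : ℝ} (h : IsPeak d b B θ₀) :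
    ∃ c > 0, ∃ L ≥ 0, ∀ (z : ℂ) (ε θ : ℝ), θ ∈ Set.Icc (-(Real.pi / 2)) (Real.pi / 2) → 0 ≤ ε →
      2 * ‖z‖ * ε ≤ 1 → ‖centeredWeight d b B θ₀ z ε θ‖ ≤
        Real.exp (-c * (θ - θ₀) ^ 2 + L * (‖z‖ * ε) * |θ - θ₀| + 4 * (‖z‖ * ε) ^ 2) := by
  have hg := h.weight_pos d
  have hm := abs_le.1 h.abs_vertexMean_le
  have hmg : vertexMean d b B θ₀ * vertexWeight d b B θ₀ =
      Real.exp B * vertexFactor d b θ₀ - Real.exp (-B) * vertexFactor d (-b) θ₀ := by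
    rw [vertexMean, div_mul_cancel₀ _ hg.ne']
  obtain ⟨c, hc, hbound⟩ := h.exists_quadratic_bound
  obtain ⟨L₁, hL₁, hlip₁⟩ := exists_lipschitz_vertexFactor d b
  obtain ⟨L₂, hL₂, hlip₂⟩ := exists_lipschitz_vertexFactor d (-b)
  have hp0 : 0 < vertexFactor d b θ₀ := pow_pos h.plus_pos _
  have hq0 : 0 < vertexFactor d (-b) θ₀ := pow_pos h.minus_pos _
  set m := vertexMean d b B θ₀ with hmdef
  set g := vertexWeight d b B θ₀ with hgdef
  have hg' : g = Real.exp B * vertexFactor d b θ₀ + Real.exp (-B) * vertexFactor d (-b) θ₀ := rfl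
  refine ⟨c, hc, (2 * Real.exp B * L₁ + 2 * Real.exp (-B) * L₂) / g, by positivity,
    fun z ε θ hθ hε hzε => ?_⟩
  set y := z.re * ε with hy
  have hyz : |y| ≤ ‖z‖ * ε := by
    rw [hy, abs_mul, abs_of_nonneg hε]
    exact mul_le_mul_of_nonneg_right (Complex.abs_re_le_norm z) hε
  have hy2 : |y| ≤ 1 / 2 := by linarith
  set A := Real.exp B * |vertexFactor d b θ| with hA
  set C := Real.exp (-B) * |vertexFactor d (-b) θ| with hC
  have hA0 : 0 ≤ A := by positivity
  have hC0 : 0 ≤ C := by positivity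
  have hAC : A + C = absWeight d b B θ := rfl
  have hexp : ∀ t : ℝ, |t| ≤ 2 → Real.exp (y * t) ≤ 1 + y * t + 4 * y ^ 2 := by
    intro t ht
    have h1 : |y * t| ≤ 1 := by
      rw [abs_mul]
      nlinarith [abs_nonneg y, abs_nonneg t]
    have h2 := (abs_le.1 (Real.abs_exp_sub_one_sub_id_le h1)).2
    have h3 : (y * t) ^ 2 ≤ 4 * y ^ 2 := by
      have : t ^ 2 ≤ 2 ^ 2 := sq_le_sq.2 (by rwa [abs_of_pos (by norm_num : (0 : ℝ) < 2)])
      nlinarith [sq_nonneg y]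
    linarith
  have e1 := hexp (1 - m) (abs_le.2 ⟨by linarith, by linarith⟩)
  have e2 := hexp (-(1 + m)) (abs_le.2 ⟨by linarith, by linarith⟩)
  have hnorm : ‖centeredWeight d b B θ₀ z ε θ‖ ≤
      (A * Real.exp (y * (1 - m)) + C * Real.exp (y * -(1 + m))) / g := by
    rw [centeredWeight_eq, norm_div, Complex.norm_real, Real.norm_eq_abs, abs_of_pos hg]
    refine div_le_div_of_nonneg_right ((norm_add_le _ _).trans (le_of_eq ?_)) hg.le
    rw [norm_mul, norm_mul, Complex.norm_exp, Complex.norm_exp, Complex.norm_real,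
      Complex.norm_real, Real.norm_eq_abs, Real.norm_eq_abs, hA, hC,
      mul_right_comm (Real.exp B), mul_right_comm (Real.exp (-B)), ← Real.exp_add,
      ← Real.exp_add]
    have r1 : (B + z * (1 - (m : ℂ)) * ε : ℂ).re = B + y * (1 - m) := by
      simp [hy]
      ring
    have r2 : (-B + -(z * (1 + (m : ℂ))) * ε : ℂ).re = -B + y * -(1 + m) := by
      simp [hy]
      ring
    rw [r1, r2]
  have hr : |(1 - m) * A - (1 + m) * C| ≤
      (2 * Real.exp B * L₁ + 2 * Real.exp (-B) * L₂) * |θ - θ₀| := by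
    have h1 : |A - Real.exp B * vertexFactor d b θ₀| ≤ Real.exp B * (L₁ * |θ - θ₀|) := by
      rw [hA, ← mul_sub, abs_mul, abs_of_pos (Real.exp_pos B)]
      refine mul_le_mul_of_nonneg_left ?_ (Real.exp_pos B).le
      have := abs_abs_sub_abs_le (vertexFactor d b θ) (vertexFactor d b θ₀)
      rw [abs_of_pos hp0] at this
      exact this.trans (hlip₁ θ θ₀)
    have h2 : |C - Real.exp (-B) * vertexFactor d (-b) θ₀| ≤
        Real.exp (-B) * (L₂ * |θ - θ₀|) := by
      rw [hC, ← mul_sub, abs_mul, abs_of_pos (Real.exp_pos (-B))]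
      refine mul_le_mul_of_nonneg_left ?_ (Real.exp_pos (-B)).le
      have := abs_abs_sub_abs_le (vertexFactor d (-b) θ) (vertexFactor d (-b) θ₀)
      rw [abs_of_pos hq0] at this
      exact this.trans (hlip₂ θ θ₀)
    have h3 : (1 - m) * A - (1 + m) * C =
        (1 - m) * (A - Real.exp B * vertexFactor d b θ₀) -
          (1 + m) * (C - Real.exp (-B) * vertexFactor d (-b) θ₀) := by
      rw [hg'] at hmg
      linear_combination -hmg
    rw [h3]
    refine (abs_sub _ _).trans ?_
    rw [abs_mul, abs_mul, abs_of_nonneg (by linarith : (0 : ℝ) ≤ 1 - m),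
      abs_of_nonneg (by linarith : (0 : ℝ) ≤ 1 + m)]
    have h4 := mul_le_mul (by linarith : 1 - m ≤ 2) h1 (abs_nonneg _) (by norm_num)
    have h5 := mul_le_mul (by linarith : 1 + m ≤ 2) h2 (abs_nonneg _) (by norm_num)
    linarith
  have hsum : A * Real.exp (y * (1 - m)) + C * Real.exp (y * -(1 + m)) ≤
      (A + C) * (1 + 4 * y ^ 2) + |y| * |(1 - m) * A - (1 + m) * C| := by
    have h1 := mul_le_mul_of_nonneg_left e1 hA0
    have h2 := mul_le_mul_of_nonneg_left e2 hC0
    have h3 := le_abs_self (y * ((1 - m) * A - (1 + m) * C))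
    rw [abs_mul] at h3
    linarith
  have hb := hbound θ hθ
  rw [← hAC] at hb
  have hyy : y ^ 2 ≤ (‖z‖ * ε) ^ 2 := by
    rw [← sq_abs]
    exact pow_le_pow_left₀ (abs_nonneg y) hyz 2
  have hfin : (A + C) * (1 + 4 * y ^ 2) + |y| * |(1 - m) * A - (1 + m) * C| ≤
      g * (1 - c * (θ - θ₀) ^ 2 + 4 * (‖z‖ * ε) ^ 2 +
        (2 * Real.exp B * L₁ + 2 * Real.exp (-B) * L₂) / g * (‖z‖ * ε) * |θ - θ₀|) := by
    have h1 := mul_le_mul hyz hr (abs_nonneg _) (by positivity)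
    have h2 := mul_le_mul_of_nonneg_right hb (by positivity : 0 ≤ 1 + 4 * y ^ 2)
    have h3 : g * ((2 * Real.exp B * L₁ + 2 * Real.exp (-B) * L₂) / g * (‖z‖ * ε) * |θ - θ₀|) =
      ‖z‖ * ε * ((2 * Real.exp B * L₁ + 2 * Real.exp (-B) * L₂) * |θ - θ₀|) := by
      field_simp
    have h4 : 0 ≤ g * (c * (θ - θ₀) ^ 2 * (4 * y ^ 2)) := by positivity
    have h5 := mul_le_mul_of_nonneg_left hyy hg.le
    linarith
  refine hnorm.trans ((div_le_div_of_nonneg_right (hsum.trans hfin) hg.le).trans ?_)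
  rw [mul_div_cancel_left₀ _ hg.ne']
  refine le_trans (le_of_eq ?_) (Real.add_one_le_exp _)
  ring

lemma norm_complexWeight_le (D : ℕ) (b : ℝ) (ζ : ℂ) (θ : ℝ) :
    ‖complexWeight D b ζ θ‖ ≤ 2 * Real.exp ‖ζ‖ * (1 + |b|) ^ D := by
  have key : ∀ (ζ : ℂ) (b : ℝ), ‖Complex.exp ζ * (vertexFactor D b θ : ℂ)‖ ≤
      Real.exp ‖ζ‖ * (1 + |b|) ^ D := by
    intro ζ b
    rw [norm_mul, Complex.norm_exp, Complex.norm_real, Real.norm_eq_abs]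
    exact mul_le_mul (Real.exp_le_exp.2 (Complex.re_le_norm ζ)) (abs_vertexFactor_le D b θ)
      (abs_nonneg _) (Real.exp_pos _).le
  have h1 := key ζ b
  have h2 := key (-ζ) (-b)
  rw [norm_neg, abs_neg] at h2
  refine (norm_add_le _ _).trans ?_
  linarith

/-- The integrand of the generating function: `k` vertices of degree `d` with normalized weights
and one vertex of degree `D`, in the field `B + z (k + 1) ^ (-1 / 2)`. -/
def generatingIntegrand (d D : ℕ) (b B θ₀ : ℝ) (k : ℕ) (z : ℂ) (θ : ℝ) : ℂ :=
  complexWeight D b (B + z * ((√((k : ℝ) + 1))⁻¹ : ℝ)) θ *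
    centeredWeight d b B θ₀ z (√((k : ℝ) + 1))⁻¹ θ ^ k

lemma continuous_generatingIntegrand (d D : ℕ) (b B θ₀ : ℝ) (k : ℕ) (z : ℂ) :
    Continuous (generatingIntegrand d D b B θ₀ k z) := by
  have h1 := fun D ζ => continuous_complexWeight D b ζ
  unfold generatingIntegrand centeredWeight
  fun_prop

/-- The Laplace method for the generating function. -/
lemma IsPeak.tendsto_integral {d : ℕ} {b B θ₀ : ℝ} (h : IsPeak d b B θ₀) (D : ℕ) (z : ℂ) :
    Tendsto (fun k : ℕ => (√((k : ℝ) + 1) : ℂ) *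
      ∫ θ in (-(Real.pi / 2))..(Real.pi / 2), generatingIntegrand d D b B θ₀ k z θ) atTop
      (𝓝 (vertexWeight D b B θ₀ * ∫ x : ℝ, Complex.exp ((z ^ 2 * (1 - vertexMean d b B θ₀ ^ 2) +
        2 * z * x * vertexMean' d b B θ₀ - curvature d b B θ₀ * x ^ 2) / 2))) := by
  have hpi := Real.pi_pos
  obtain ⟨c, hc, L, hL, hbound⟩ := h.exists_norm_centeredWeight_le
  set I := Set.Ioc (-(Real.pi / 2)) (Real.pi / 2) with hI
  set ε : ℕ → ℝ := fun k => (√((k : ℝ) + 1))⁻¹ with hε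
  have hεpos : ∀ k, 0 < ε k := fun k => by simp only [hε]; positivity
  have hε2 : ∀ k, ε k ^ 2 = ((k : ℝ) + 1)⁻¹ := fun k => by
    simp only [hε]
    rw [inv_pow, Real.sq_sqrt (by positivity)]
  have hε0 : Tendsto ε atTop (𝓝 0) := tendsto_inv_sqrt_succ
  -- rescale the angle
  have hscale : ∀ k : ℕ, (√((k : ℝ) + 1) : ℂ) *
      ∫ θ in (-(Real.pi / 2))..(Real.pi / 2), generatingIntegrand d D b B θ₀ k z θ =
      ∫ x : ℝ, I.indicator (generatingIntegrand d D b B θ₀ k z) (θ₀ + x * ε k) := by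
    intro k
    have hs : 0 < √((k : ℝ) + 1) := by positivity
    have h1 := Measure.integral_comp_div
      (fun x => I.indicator (generatingIntegrand d D b B θ₀ k z) (θ₀ + x)) (√((k : ℝ) + 1))
    simp only [div_eq_mul_inv] at h1
    rw [h1, integral_add_left_eq_self, integral_indicator measurableSet_Ioc,
      intervalIntegral.integral_of_le (by linarith), abs_of_pos hs, Complex.real_smul]
  simp only [hscale]
  rw [← integral_const_mul]
  set K₁ := 4 * ‖z‖ ^ 2 + (L * ‖z‖) ^ 2 / (2 * c) with hK₁
  have hK₁0 : 0 ≤ K₁ := by positivity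
  set K₂ := 2 * Real.exp (|B| + ‖z‖) * (1 + |b|) ^ D with hK₂
  refine tendsto_integral_filter_of_dominated_convergence
    (fun x => K₂ * Real.exp K₁ * Real.exp (-(c / 4) * x ^ 2)) ?_ ?_ ?_ ?_
  · refine Eventually.of_forall fun k => ?_
    have h1 : Measurable (I.indicator (generatingIntegrand d D b B θ₀ k z)) :=
      (continuous_generatingIntegrand d D b B θ₀ k z).measurable.indicator measurableSet_Ioc
    exact (h1.comp (by fun_prop)).aestronglyMeasurable
  · have hsmall : ∀ᶠ k in atTop, 2 * ‖z‖ * ε k ≤ 1 := by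
      have := (hε0.const_mul (2 * ‖z‖))
      rw [mul_zero] at this
      exact this.eventually (Iic_mem_nhds one_pos)
    filter_upwards [hsmall, eventually_ge_atTop 1] with k hk hk1
    refine Eventually.of_forall fun x => ?_
    by_cases hx : θ₀ + x * ε k ∈ I
    swap
    · rw [Set.indicator_of_notMem hx, norm_zero]
      positivity
    rw [Set.indicator_of_mem hx, generatingIntegrand, norm_mul, norm_pow]
    have hk1' : (1 : ℝ) ≤ k := by exact_mod_cast hk1
    have hε1 : ε k ≤ 1 := by
      simp only [hε]
      exact inv_le_one_of_one_le₀ (Real.one_le_sqrt.2 (by linarith))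
    have b1 : ‖complexWeight D b (B + z * (ε k : ℝ)) (θ₀ + x * ε k)‖ ≤ K₂ := by
      refine (norm_complexWeight_le _ _ _ _).trans ?_
      rw [hK₂]
      gcongr
      refine (norm_add_le _ _).trans ?_
      rw [norm_mul, Complex.norm_real, Complex.norm_real, Real.norm_eq_abs, Real.norm_eq_abs,
        abs_of_pos (hεpos k)]
      nlinarith [norm_nonneg z]
    have b2 := hbound z (ε k) (θ₀ + x * ε k) (Set.Ioc_subset_Icc_self hx) (hεpos k).le hk
    have b3 : -c * (θ₀ + x * ε k - θ₀) ^ 2 + L * (‖z‖ * ε k) * |θ₀ + x * ε k - θ₀| +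
        4 * (‖z‖ * ε k) ^ 2 ≤ ((k : ℝ) + 1)⁻¹ * (-(c / 2) * x ^ 2 + K₁) := by
      rw [add_sub_cancel_left, abs_mul, abs_of_pos (hεpos k), ← hε2]
      have hq : L * ‖z‖ * |x| ≤ c / 2 * x ^ 2 + (L * ‖z‖) ^ 2 / (2 * c) := by
        have h1 : c / 2 * x ^ 2 + (L * ‖z‖) ^ 2 / (2 * c) - L * ‖z‖ * |x| =
            (c * |x| - L * ‖z‖) ^ 2 / (2 * c) := by
          rw [← sq_abs x]
          field_simp
          ring
        have h2 : 0 ≤ (c * |x| - L * ‖z‖) ^ 2 / (2 * c) := by positivity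
        linarith
      have h3 : -c * (x * ε k) ^ 2 + L * (‖z‖ * ε k) * (|x| * ε k) + 4 * (‖z‖ * ε k) ^ 2 =
          ε k ^ 2 * (-c * x ^ 2 + L * ‖z‖ * |x| + 4 * ‖z‖ ^ 2) := by ring
      rw [h3]
      refine mul_le_mul_of_nonneg_left ?_ (sq_nonneg _)
      rw [hK₁]
      linarith
    have b4 : ‖centeredWeight d b B θ₀ z (ε k) (θ₀ + x * ε k)‖ ^ k ≤
        Real.exp K₁ * Real.exp (-(c / 4) * x ^ 2) := by
      refine (pow_le_pow_left₀ (norm_nonneg _) (b2.trans (Real.exp_le_exp.2 b3)) k).trans ?_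
      rw [← Real.exp_nat_mul, ← Real.exp_add]
      refine Real.exp_le_exp.2 ?_
      have hr1 : (k : ℝ) * ((k : ℝ) + 1)⁻¹ ≤ 1 := by
        rw [← div_eq_mul_inv, div_le_one (by positivity)]
        linarith
      have hr2 : 1 / 2 ≤ (k : ℝ) * ((k : ℝ) + 1)⁻¹ := by
        rw [← div_eq_mul_inv, div_le_div_iff₀ (by norm_num) (by positivity)]
        linarith
      have h4 : 0 ≤ c * x ^ 2 := by positivity
      nlinarith
    calc _ ≤ K₂ * (Real.exp K₁ * Real.exp (-(c / 4) * x ^ 2)) :=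
          mul_le_mul b1 b4 (by positivity) (by positivity)
      _ = _ := by ring
  · exact (integrable_exp_neg_mul_sq (by positivity)).const_mul _
  · refine Eventually.of_forall fun x => ?_
    have hlim : Tendsto (fun k => θ₀ + x * ε k) atTop (𝓝 θ₀) := by
      simpa using (hε0.const_mul x).const_add θ₀
    have hmem : ∀ᶠ k in atTop, θ₀ + x * ε k ∈ I :=
      hlim.eventually (Filter.mem_of_superset (Ioo_mem_nhds h.mem.1 h.mem.2)
        Set.Ioo_subset_Ioc_self)
    refine Tendsto.congr' (f₁ := fun k => generatingIntegrand d D b B θ₀ k z (θ₀ + x * ε k)) ?_ ?_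
    · filter_upwards [hmem] with k hk
      rw [Set.indicator_of_mem hk]
    · refine Tendsto.mul ?_ (h.tendsto_centeredWeight_pow z x)
      rw [← complexWeight_ofReal]
      have hζ : Tendsto (fun k => (B : ℂ) + z * (ε k : ℂ)) atTop (𝓝 B) := by
        have := (((Complex.continuous_ofReal.tendsto 0).comp hε0).const_mul z).const_add (B : ℂ)
        simpa using this
      have hv : ∀ b, Tendsto (fun k => (vertexFactor D b (θ₀ + x * ε k) : ℂ)) atTop
          (𝓝 (vertexFactor D b θ₀ : ℂ)) := fun b =>
        (Complex.continuous_ofReal.tendsto _).comp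
          (((continuous_vertexFactor D b).tendsto _).comp hlim)
      unfold complexWeight
      exact (((Complex.continuous_exp.tendsto _).comp hζ).mul (hv b)).add
        (((Complex.continuous_exp.tendsto _).comp hζ.neg).mul (hv (-b)))

/-- The Gaussian integral of the limit of the generating function. -/
lemma integral_exp_quadratic_form {κ : ℝ} (hκ : 0 < κ) (v m' : ℝ) (z : ℂ) :
    ∫ x : ℝ, Complex.exp ((z ^ 2 * v + 2 * z * x * m' - κ * x ^ 2) / 2) =
      (∫ x : ℝ, Complex.exp (((0 : ℂ) ^ 2 * v + 2 * 0 * x * m' - κ * x ^ 2) / 2)) *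
        Complex.exp ((v + m' ^ 2 / κ : ℝ) * z ^ 2 / 2) := by
  have hre : (-(κ / 2) : ℂ).re < 0 := by
    have : (-(κ / 2) : ℂ) = ((-(κ / 2) : ℝ) : ℂ) := by push_cast; ring
    rw [this, Complex.ofReal_re]
    linarith
  have hκ' : (κ : ℂ) ≠ 0 := by exact_mod_cast hκ.ne'
  have key : ∀ z : ℂ, ∫ x : ℝ, Complex.exp ((z ^ 2 * v + 2 * z * x * m' - κ * x ^ 2) / 2) =
      (Real.pi / -(-(κ / 2) : ℂ)) ^ (1 / 2 : ℂ) *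
        Complex.exp ((v + m' ^ 2 / κ : ℝ) * z ^ 2 / 2) := by
    intro z
    have h1 := integral_cexp_quadratic hre (z * m') (z ^ 2 * v / 2)
    have h2 : ∀ x : ℝ, (-(κ / 2) : ℂ) * (x : ℂ) ^ 2 + z * m' * x + z ^ 2 * v / 2 =
        (z ^ 2 * v + 2 * z * x * m' - κ * x ^ 2) / 2 := fun x => by ring
    simp only [h2] at h1
    rw [h1]
    congr 2
    push_cast
    field_simp
    ring
  rw [key, key 0]
  simp

/-- The ratio of generating functions converges to that of a Gaussian variable. -/
lemma IsPeak.tendsto_ratio {d : ℕ} {b B θ₀ : ℝ} (h : IsPeak d b B θ₀) (D : ℕ) (z : ℂ) :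
    Tendsto (fun k : ℕ =>
      (∫ θ in (-(Real.pi / 2))..(Real.pi / 2), generatingIntegrand d D b B θ₀ k z θ) /
        ∫ θ in (-(Real.pi / 2))..(Real.pi / 2), generatingIntegrand d D b B θ₀ k 0 θ) atTop
      (𝓝 (Complex.exp (peakVariance d b B θ₀ * z ^ 2 / 2))) := by
  have hκ := h.curvature_pos
  set J : ℂ := ∫ x : ℝ, Complex.exp (((0 : ℂ) ^ 2 * (1 - vertexMean d b B θ₀ ^ 2 : ℝ) +
        2 * 0 * x * vertexMean' d b B θ₀ - curvature d b B θ₀ * x ^ 2) / 2) with hJ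
  have hJ0 : J ≠ 0 := by
    have h1 : J = ((∫ x : ℝ, Real.exp (-(curvature d b B θ₀ / 2) * x ^ 2) : ℝ) : ℂ) := by
      rw [hJ, ← integral_complex_ofReal]
      congr 1
      ext x
      push_cast
      congr 1
      ring
    rw [h1, integral_gaussian]
    have : 0 < √(Real.pi / (curvature d b B θ₀ / 2)) := by
      have := Real.pi_pos
      positivity
    exact_mod_cast this.ne'
  have hw : (vertexWeight D b B θ₀ : ℂ) ≠ 0 := by exact_mod_cast (h.weight_pos D).ne'
  have hlim : ∀ z : ℂ, Tendsto (fun k : ℕ => (√((k : ℝ) + 1) : ℂ) *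
      ∫ θ in (-(Real.pi / 2))..(Real.pi / 2), generatingIntegrand d D b B θ₀ k z θ) atTop
      (𝓝 (vertexWeight D b B θ₀ * (J * Complex.exp (peakVariance d b B θ₀ * z ^ 2 / 2)))) := by
    intro z
    have h1 := h.tendsto_integral D z
    have h2 := integral_exp_quadratic_form hκ (1 - vertexMean d b B θ₀ ^ 2)
      (vertexMean' d b B θ₀) z
    rw [← hJ] at h2
    push_cast at h1 h2
    rw [h2] at h1
    convert h1 using 4
    rw [peakVariance]
    push_cast
    ring
  have h0 := hlim 0
  have hne : (vertexWeight D b B θ₀ * (J * Complex.exp (peakVariance d b B θ₀ * 0 ^ 2 / 2)) : ℂ)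
      ≠ 0 := mul_ne_zero hw (mul_ne_zero hJ0 (Complex.exp_ne_zero _))
  have h3 := (hlim z).div h0 hne
  have h4 : (vertexWeight D b B θ₀ * (J * Complex.exp (peakVariance d b B θ₀ * z ^ 2 / 2)) : ℂ) /
      (vertexWeight D b B θ₀ * (J * Complex.exp (peakVariance d b B θ₀ * 0 ^ 2 / 2))) =
      Complex.exp (peakVariance d b B θ₀ * z ^ 2 / 2) := by
    have e0 : Complex.exp (peakVariance d b B θ₀ * 0 ^ 2 / 2) = 1 := by simp
    rw [e0]
    field_simp
  rw [h4] at h3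
  refine h3.congr fun k => ?_
  have hs : (√((k : ℝ) + 1) : ℂ) ≠ 0 := by
    have : 0 < √((k : ℝ) + 1) := by positivity
    exact_mod_cast this.ne'
  rw [Pi.div_apply, mul_div_mul_left _ _ hs]

/-! ### Convergence of derivatives of entire functions -/

/-- Eventual uniform boundedness on discs. -/
def EventuallyLocallyBounded (F : ℕ → ℂ → ℂ) : Prop :=
  ∀ R : ℝ, ∃ C : ℝ, ∀ᶠ k in atTop, ∀ z : ℂ, ‖z‖ ≤ R → ‖F k z‖ ≤ C

lemma norm_le_of_mem_sphere_one {z w : ℂ} {R : ℝ} (hz : ‖z‖ ≤ R) (hw : w ∈ Metric.sphere z 1) :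
    ‖w‖ ≤ R + 1 := by
  have h1 : ‖w - z‖ = 1 := by simpa [dist_eq_norm] using hw
  calc ‖w‖ = ‖z + (w - z)‖ := by ring_nf
    _ ≤ ‖z‖ + ‖w - z‖ := norm_add_le _ _
    _ ≤ R + 1 := by linarith

lemma EventuallyLocallyBounded.deriv {F : ℕ → ℂ → ℂ} (hF : ∀ k, Differentiable ℂ (F k))
    (hb : EventuallyLocallyBounded F) : EventuallyLocallyBounded fun k => deriv (F k) := by
  intro R
  obtain ⟨C, hC⟩ := hb (R + 1)
  refine ⟨C, hC.mono fun k hk z hz => ?_⟩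
  have := Complex.norm_deriv_le_of_forall_mem_sphere_norm_le one_pos (hF k).diffContOnCl
    fun w hw => hk w (norm_le_of_mem_sphere_one hz hw)
  rwa [div_one] at this

/-- Pointwise convergence of locally bounded entire functions passes to the derivatives, by
Cauchy's formula and dominated convergence. -/
lemma tendsto_deriv_of_eventuallyLocallyBounded {F : ℕ → ℂ → ℂ} {G : ℂ → ℂ}
    (hF : ∀ k, Differentiable ℂ (F k)) (hG : Differentiable ℂ G)
    (hb : EventuallyLocallyBounded F) (hlim : ∀ z, Tendsto (fun k => F k z) atTop (𝓝 (G z)))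
    (z : ℂ) : Tendsto (fun k => deriv (F k) z) atTop (𝓝 (deriv G z)) := by
  have hcauchy : ∀ f : ℂ → ℂ, Differentiable ℂ f →
      (2 * Real.pi * Complex.I : ℂ)⁻¹ * (∮ w in C(z, 1), (1 / (w - z) ^ 2) • f w) = deriv f z := by
    intro f hf
    rw [hf.diffContOnCl.deriv_eq_smul_circleIntegral one_pos, smul_eq_mul,
      inv_mul_cancel_left₀ Complex.two_pi_I_ne_zero]
  rw [← hcauchy G hG]
  refine Tendsto.congr (fun k => hcauchy (F k) (hF k)) (Tendsto.const_mul _ ?_)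
  obtain ⟨C, hC⟩ := hb (‖z‖ + 1)
  simp only [circleIntegral]
  have hne : ∀ θ, (circleMap z 1 θ - z) ^ 2 ≠ 0 := fun θ => by simp
  refine intervalIntegral.tendsto_integral_filter_of_dominated_convergence (fun _ => C) ?_ ?_ ?_ ?_
  · refine Eventually.of_forall fun k => Continuous.aestronglyMeasurable ?_
    have h1 := (hF k).continuous
    have h2 : Continuous (circleMap z 1) := continuous_circleMap z 1
    have h3 : Continuous (deriv (circleMap z 1)) := by
      simp only [funext (deriv_circleMap z 1)]
      fun_prop
    exact h3.smul ((continuous_const.div ((h2.sub continuous_const).pow 2) hne).smul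
      (h1.comp h2))
  · filter_upwards [hC] with k hk
    refine Eventually.of_forall fun θ _ => ?_
    have hw : circleMap z 1 θ ∈ Metric.sphere z 1 := circleMap_mem_sphere z zero_le_one θ
    have h1 := hk _ (norm_le_of_mem_sphere_one le_rfl hw)
    simpa [norm_smul] using h1
  · exact intervalIntegrable_const
  · exact Eventually.of_forall fun θ _ => ((hlim _).const_smul _).const_smul _

/-! ### Moments from generating functions -/

section FiniteGenerating

variable {Ω : ℕ → Type*} [∀ k, Fintype (Ω k)] {p X : ∀ k, Ω k → ℝ}

/-- The moment generating function, at a complex argument, of the values `X` with weights `p`. -/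
def finiteMGF {Ω : Type*} [Fintype Ω] (p X : Ω → ℝ) (z : ℂ) : ℂ :=
  ∑ σ, (p σ : ℂ) * Complex.exp (z * X σ)

lemma hasDerivAt_finiteMGF {Ω : Type*} [Fintype Ω] (p X : Ω → ℝ) (z : ℂ) :
    HasDerivAt (finiteMGF p X) (finiteMGF (fun σ => p σ * X σ) X z) z := by
  unfold finiteMGF
  refine HasDerivAt.fun_sum fun σ _ => ?_
  have h1 : HasDerivAt (fun z : ℂ => z * (X σ : ℂ)) (X σ) z := by
    simpa using (hasDerivAt_id z).mul_const (X σ : ℂ)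
  refine (h1.cexp.const_mul (p σ : ℂ)).congr_deriv ?_
  push_cast
  ring

lemma deriv_finiteMGF {Ω : Type*} [Fintype Ω] (p X : Ω → ℝ) :
    deriv (finiteMGF p X) = finiteMGF (fun σ => p σ * X σ) X :=
  funext fun z => (hasDerivAt_finiteMGF p X z).deriv

/-- On the disc of radius `R` the generating function of a positive measure is dominated by the
sum of its values at `R` and `-R`. -/
lemma eventuallyLocallyBounded_finiteMGF (hp : ∀ k σ, 0 ≤ p k σ) {G : ℂ → ℂ}
    (hlim : ∀ z, Tendsto (fun k => finiteMGF (p k) (X k) z) atTop (𝓝 (G z))) :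
    EventuallyLocallyBounded fun k => finiteMGF (p k) (X k) := by
  intro R
  refine ⟨‖G R‖ + ‖G (-R)‖ + 1, ?_⟩
  have h1 := ((hlim R).norm.add (hlim (-R)).norm).eventually
    (Iic_mem_nhds (lt_add_one (‖G R‖ + ‖G (-R)‖)))
  filter_upwards [h1] with k hk z hz
  have hreal : ∀ r : ℝ, ‖finiteMGF (p k) (X k) r‖ = ∑ σ, p k σ * Real.exp (r * X k σ) := by
    intro r
    have : finiteMGF (p k) (X k) r = ((∑ σ, p k σ * Real.exp (r * X k σ) : ℝ) : ℂ) := by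
      simp [finiteMGF]
    rw [this, Complex.norm_real, Real.norm_of_nonneg]
    exact Finset.sum_nonneg fun σ _ => mul_nonneg (hp k σ) (Real.exp_pos _).le
  have h2 : ‖finiteMGF (p k) (X k) z‖ ≤
      ∑ σ, p k σ * Real.exp (R * X k σ) + ∑ σ, p k σ * Real.exp (-R * X k σ) := by
    rw [← Finset.sum_add_distrib]
    refine (norm_sum_le _ _).trans (Finset.sum_le_sum fun σ _ => ?_)
    rw [norm_mul, Complex.norm_real, Real.norm_of_nonneg (hp k σ), Complex.norm_exp, ← mul_add]
    refine mul_le_mul_of_nonneg_left ?_ (hp k σ)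
    rw [Complex.re_mul_ofReal]
    have hre := abs_le.1 ((Complex.abs_re_le_norm z).trans hz)
    rcases le_total 0 (X k σ) with h | h
    · have := Real.exp_le_exp.2 (mul_le_mul_of_nonneg_right hre.2 h)
      linarith [Real.exp_pos (-R * X k σ)]
    · have := Real.exp_le_exp.2 (mul_le_mul_of_nonpos_right hre.1 h)
      linarith [Real.exp_pos (R * X k σ)]
  rw [← hreal, ← hreal] at h2
  push_cast at h2
  exact h2.trans hk

/-- If the moment generating functions converge to that of a centered Gaussian law everywhere in
the complex plane, then the first two moments converge. -/
lemma tendsto_moments_of_tendsto_finiteMGF (hp : ∀ k σ, 0 ≤ p k σ) {v : ℝ}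
    (hlim : ∀ z : ℂ, Tendsto (fun k => finiteMGF (p k) (X k) z) atTop
      (𝓝 (Complex.exp (v * z ^ 2 / 2)))) :
    Tendsto (fun k => ∑ σ, p k σ * X k σ) atTop (𝓝 0) ∧
      Tendsto (fun k => ∑ σ, p k σ * X k σ ^ 2) atTop (𝓝 v) := by
  have hF : ∀ k, Differentiable ℂ (finiteMGF (p k) (X k)) := fun k z =>
    (hasDerivAt_finiteMGF _ _ z).differentiableAt
  have hF' : ∀ k, Differentiable ℂ (deriv (finiteMGF (p k) (X k))) := fun k => by
    rw [deriv_finiteMGF]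
    exact fun z => (hasDerivAt_finiteMGF _ _ z).differentiableAt
  have hb := eventuallyLocallyBounded_finiteMGF hp hlim
  have hder : ∀ z : ℂ, HasDerivAt (fun z : ℂ => Complex.exp (v * z ^ 2 / 2))
      (v * z * Complex.exp (v * z ^ 2 / 2)) z := by
    intro z
    have h1 : HasDerivAt (fun z : ℂ => v * z ^ 2 / 2) (v * z) z :=
      ((((hasDerivAt_id z).fun_pow 2).const_mul (v : ℂ)).div_const 2).congr_deriv (by
        simp only [id, Nat.cast_ofNat]
        ring)
    exact h1.cexp.congr_deriv (by ring)
  have hder' : ∀ z : ℂ, HasDerivAt (fun z : ℂ => v * z * Complex.exp (v * z ^ 2 / 2))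
      (v * Complex.exp (v * z ^ 2 / 2) + v * z * (v * z * Complex.exp (v * z ^ 2 / 2))) z := by
    intro z
    have h1 : HasDerivAt (fun z : ℂ => (v : ℂ) * z) v z := by
      simpa using (hasDerivAt_id z).const_mul (v : ℂ)
    exact h1.mul (hder z)
  have hG' : deriv (fun z : ℂ => Complex.exp (v * z ^ 2 / 2)) =
      fun z : ℂ => v * z * Complex.exp (v * z ^ 2 / 2) := funext fun z => (hder z).deriv
  have l1 := tendsto_deriv_of_eventuallyLocallyBounded hF (fun z => (hder z).differentiableAt) hb
    hlim
  have l2 := tendsto_deriv_of_eventuallyLocallyBounded hF'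
    (by rw [hG']; exact fun z => (hder' z).differentiableAt) (hb.deriv hF) l1 0
  have l1 := l1 0
  rw [hG'] at l1 l2
  rw [(hder' 0).deriv] at l2
  simp only [deriv_finiteMGF] at l1 l2
  constructor
  · have h1 := (Complex.continuous_re.tendsto _).comp l1
    simp only [mul_zero, zero_mul, Complex.zero_re] at h1
    refine h1.congr fun k => ?_
    simp [finiteMGF]
  · have h1 := (Complex.continuous_re.tendsto _).comp l2
    simp only [mul_zero, add_zero, ne_eq, OfNat.ofNat_ne_zero, not_false_eq_true,
      zero_pow, zero_div, Complex.exp_zero, mul_one, Complex.ofReal_re] at h1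
    refine h1.congr fun k => ?_
    simp [finiteMGF, sq, mul_assoc]

end FiniteGenerating

/-! ### The annealed measure -/

lemma sum_units {M : Type*} [AddCommMonoid M] (f : ℤˣ → M) : ∑ s, f s = f 1 + f (-1) := by
  rw [UnitsInt.univ, Finset.sum_pair (by decide)]

/-- The normalized total spin, centered at `n m`. -/
def centeredSpin (n : ℕ) (m : ℝ) (σ : Config n) : ℝ := (totalSpin σ - n * m) / √n

/-- The generating function of the configuration weights, as an integral over the angle. -/
lemma sum_configWeight_mul_exp {d : ℕ} {b B θ₀ : ℝ} (hg : 0 < vertexWeight d b B θ₀) (k : ℕ)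
    (z : ℂ) : ∑ σ : Config (k + 1), (configWeight d (k + 1) b B σ : ℂ) *
        Complex.exp (z * centeredSpin (k + 1) (vertexMean d b B θ₀) σ) =
      Complex.exp (-(z * vertexMean d b B θ₀ * ((√((k : ℝ) + 1))⁻¹ : ℝ))) *
        vertexWeight d b B θ₀ ^ k * ∫ θ in (-(Real.pi / 2))..(Real.pi / 2),
          generatingIntegrand d (regularDegrees d (k + 1) 0) b B θ₀ k z θ := by
  set m := vertexMean d b B θ₀ with hm
  set ε : ℝ := (√((k : ℝ) + 1))⁻¹ with hε
  set w : ℂ := Complex.exp (-(z * m * ε)) with hw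
  have hgC : (vertexWeight d b B θ₀ : ℂ) ≠ 0 := by exact_mod_cast hg.ne'
  -- the weight of a vertex with a given spin
  set F : Fin (k + 1) → ℤˣ → ℝ → ℂ := fun i s θ =>
    Complex.exp (B * ((s : ℤ) : ℝ)) *
      (vertexFactor (regularDegrees d (k + 1) i) (b * ((s : ℤ) : ℝ)) θ : ℂ) *
      Complex.exp (z * ε * (((s : ℤ) : ℝ) - m)) with hF
  have hFc : ∀ i s, Continuous (F i s) := fun i s => by
    have := continuous_vertexFactor (regularDegrees d (k + 1) i) (b * ((s : ℤ) : ℝ))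
    simp only [hF]
    fun_prop
  have hterm : ∀ σ : Config (k + 1), (configWeight d (k + 1) b B σ : ℂ) *
      Complex.exp (z * centeredSpin (k + 1) m σ) =
      ∫ θ in (-(Real.pi / 2))..(Real.pi / 2), ∏ i, F i (σ i) θ := by
    intro σ
    rw [configWeight, ← intervalIntegral.integral_ofReal, ← intervalIntegral.integral_mul_const]
    congr 1
    ext θ
    have h1 : z * (centeredSpin (k + 1) m σ : ℂ) = ∑ i, z * ε * ((((σ i : ℤ) : ℝ) : ℂ) - m) := by
      rw [← Finset.mul_sum, Finset.sum_sub_distrib, centeredSpin, totalSpin]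
      simp only [spin, hε, Finset.sum_const, Finset.card_univ, Fintype.card_fin, nsmul_eq_mul]
      push_cast
      ring
    rw [h1, Complex.exp_sum]
    push_cast
    rw [← Finset.prod_mul_distrib]
    refine Finset.prod_congr rfl fun i _ => ?_
    simp only [hF, vertexFactor, halfEdgeFactor, spin]
    push_cast
    ring
  have hsum : ∀ i θ, ∑ s, F i s θ =
      complexWeight (regularDegrees d (k + 1) i) b (B + z * ε) θ * w := by
    intro i θ
    have hexp : ∀ a₁ a₂ a₃ a₄ v : ℂ, a₁ + a₂ = a₃ + a₄ →
        Complex.exp a₁ * v * Complex.exp a₂ = Complex.exp a₃ * v * Complex.exp a₄ := by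
      intro a₁ a₂ a₃ a₄ v h
      rw [mul_right_comm, ← Complex.exp_add, h, Complex.exp_add, mul_right_comm]
    rw [sum_units]
    simp only [hF, complexWeight, hw, Units.val_one, Units.val_neg, Int.cast_one, Int.cast_neg,
      Complex.ofReal_one, Complex.ofReal_neg, mul_one, mul_neg]
    rw [add_mul]
    congr 1 <;> exact hexp _ _ _ _ _ (by ring)
  simp only [hterm]
  rw [← intervalIntegral.integral_finsetSum
    (fun σ _ => (Continuous.intervalIntegrable
      (continuous_finsetProd _ fun i _ => hFc i (σ i)) _ _)),
    ← intervalIntegral.integral_const_mul]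
  congr 1
  ext θ
  have hprod := Finset.prod_univ_sum (fun _ : Fin (k + 1) => (Finset.univ : Finset ℤˣ))
    (fun i s => F i s θ)
  rw [Fintype.piFinset_univ] at hprod
  rw [← hprod]
  simp only [hsum]
  rw [Fin.prod_univ_succ]
  have hsucc : ∀ i : Fin k, regularDegrees d (k + 1) i.succ = d := fun i => by
    simp [regularDegrees, evenDegrees]
  simp only [hsucc, Finset.prod_const, Finset.card_univ, Fintype.card_fin]
  rw [generatingIntegrand, centeredWeight, ← hm, ← hε, ← hw, div_pow]
  field_simp

/-- The generating function of the centered total spin under the annealed measure converges to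
that of a Gaussian variable. -/
lemma IsPeak.tendsto_finiteMGF {d : ℕ} {β B θ₀ : ℝ} (hβ : 0 ≤ β)
    (h : IsPeak d √(Real.tanh β) B θ₀) (z : ℂ) :
    Tendsto (fun k : ℕ => finiteMGF (annealedProb d (k + 1) β B)
        (centeredSpin (k + 1) (vertexMean d √(Real.tanh β) B θ₀)) z) atTop
      (𝓝 (Complex.exp (peakVariance d √(Real.tanh β) B θ₀ * z ^ 2 / 2))) := by
  set b := √(Real.tanh β) with hb
  have hg := h.weight_pos d
  have hgC : (vertexWeight d b B θ₀ : ℂ) ≠ 0 := by exact_mod_cast hg.ne'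
  -- the degree of the first vertex depends on the parity, but the limit does not
  have hD : ∀ k : ℕ, regularDegrees d (k + 1) 0 =
      if Odd (∑ _j : Fin (k + 1), d) then d + 1 else d :=
    fun k => by simp [regularDegrees, evenDegrees]
  have hratio : Tendsto (fun k : ℕ =>
      (∫ θ in (-(Real.pi / 2))..(Real.pi / 2),
        generatingIntegrand d (regularDegrees d (k + 1) 0) b B θ₀ k z θ) /
      ∫ θ in (-(Real.pi / 2))..(Real.pi / 2),
        generatingIntegrand d (regularDegrees d (k + 1) 0) b B θ₀ k 0 θ) atTop
      (𝓝 (Complex.exp (peakVariance d b B θ₀ * z ^ 2 / 2))) := by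
    refine (Tendsto.if' (p := fun k : ℕ => Odd (∑ _j : Fin (k + 1), d))
      (h.tendsto_ratio (d + 1) z) (h.tendsto_ratio d z)).congr fun k => ?_
    rw [hD]
    split_ifs <;> rfl
  have hexp : Tendsto (fun k : ℕ => Complex.exp (-(z * vertexMean d b B θ₀ *
      ((√((k : ℝ) + 1))⁻¹ : ℝ)))) atTop (𝓝 1) := by
    have h1 := (((Complex.continuous_ofReal.tendsto 0).comp tendsto_inv_sqrt_succ).const_mul
      (z * vertexMean d b B θ₀ : ℂ)).neg
    rw [Complex.ofReal_zero, mul_zero, neg_zero] at h1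
    have h2 := (Complex.continuous_exp.tendsto 0).comp h1
    rwa [Complex.exp_zero] at h2
  have h1 := hexp.mul hratio
  rw [one_mul] at h1
  refine h1.congr fun k => ?_
  have h0 := sum_configWeight_mul_exp hg (k := k) (0 : ℂ)
  simp only [zero_mul, Complex.exp_zero, mul_one, neg_zero, one_mul] at h0
  have hz := sum_configWeight_mul_exp hg (k := k) z
  have hsum : finiteMGF (annealedProb d (k + 1) β B) (centeredSpin (k + 1) (vertexMean d b B θ₀)) z
      = (∑ σ : Config (k + 1), (configWeight d (k + 1) b B σ : ℂ) *
        Complex.exp (z * centeredSpin (k + 1) (vertexMean d b B θ₀) σ)) /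
        ∑ σ : Config (k + 1), (configWeight d (k + 1) b B σ : ℂ) := by
    rw [finiteMGF, Finset.sum_div]
    refine Finset.sum_congr rfl fun σ _ => ?_
    rw [annealedProb_eq d (k + 1) β B hβ σ, ← hb]
    push_cast
    ring
  rw [hsum, h0, hz, mul_assoc (Complex.exp _),
    mul_left_comm (Complex.exp _) ((vertexWeight d b B θ₀ : ℂ) ^ k),
    mul_div_mul_left _ _ (pow_ne_zero k hgC), mul_div_assoc]

lemma integral_annealedMeasure {E : Type*} [NormedAddCommGroup E] [NormedSpace ℝ E]
    [CompleteSpace E] (d n : ℕ) (β B : ℝ) (f : Config n → E) :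
    ∫ σ, f σ ∂(annealedMeasure d n β B) = ∑ σ, annealedProb d n β B σ • f σ := by
  rw [annealedMeasure, integral_finsetSum_measure
    fun σ _ => (integrable_dirac (by simp)).smul_measure (by simp)]
  refine Finset.sum_congr rfl fun σ _ => ?_
  rw [integral_smul_measure, integral_dirac,
    ENNReal.toReal_ofReal (annealedProb_pos d n β B σ).le]

lemma totalSpin_eq {n : ℕ} (hn : n ≠ 0) (m : ℝ) (σ : Config n) :
    totalSpin σ = n * m + √n * centeredSpin n m σ := by
  have : √(n : ℝ) ≠ 0 := by positivity
  rw [centeredSpin]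
  field_simp
  ring

lemma integral_totalSpin (d : ℕ) {n : ℕ} (hn : n ≠ 0) (β B m : ℝ) :
    ∫ σ, totalSpin σ ∂(annealedMeasure d n β B) =
      n * m + √n * ∑ σ, annealedProb d n β B σ * centeredSpin n m σ := by
  rw [integral_annealedMeasure]
  simp only [totalSpin_eq hn m, smul_eq_mul, mul_add, Finset.sum_add_distrib, ← Finset.sum_mul,
    sum_annealedProb, one_mul, Finset.mul_sum, mul_left_comm]

section Limits

variable {d : ℕ} {β B θ₀ : ℝ}

lemma IsPeak.tendsto_moments (hβ : 0 ≤ β) (h : IsPeak d √(Real.tanh β) B θ₀) :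
    Tendsto (fun k : ℕ => ∑ σ, annealedProb d (k + 1) β B σ *
        centeredSpin (k + 1) (vertexMean d √(Real.tanh β) B θ₀) σ) atTop (𝓝 0) ∧
      Tendsto (fun k : ℕ => ∑ σ, annealedProb d (k + 1) β B σ *
        centeredSpin (k + 1) (vertexMean d √(Real.tanh β) B θ₀) σ ^ 2) atTop
        (𝓝 (peakVariance d √(Real.tanh β) B θ₀)) :=
  tendsto_moments_of_tendsto_finiteMGF (fun _ σ => (annealedProb_pos _ _ _ _ σ).le)
    fun z => h.tendsto_finiteMGF hβ z

lemma IsPeak.tendsto_annealedMagnetization (hβ : 0 ≤ β) (h : IsPeak d √(Real.tanh β) B θ₀) :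
    Tendsto (fun n => annealedMagnetization d n β B) atTop
      (𝓝 (vertexMean d √(Real.tanh β) B θ₀)) := by
  rw [← tendsto_add_atTop_iff_nat 1]
  have h1 := (tendsto_inv_sqrt_succ.mul (h.tendsto_moments hβ).1).const_add
    (vertexMean d √(Real.tanh β) B θ₀)
  rw [mul_zero, add_zero] at h1
  refine h1.congr fun k => ?_
  have hs : √((k : ℝ) + 1) ≠ 0 := by positivity
  have hk : (k : ℝ) + 1 ≠ 0 := by positivity
  have hsq : √((k : ℝ) + 1) * √((k : ℝ) + 1) = k + 1 := Real.mul_self_sqrt (by positivity)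
  rw [annealedMagnetization, integral_div, integral_totalSpin d k.succ_ne_zero β B
    (vertexMean d √(Real.tanh β) B θ₀)]
  push_cast
  rw [eq_div_iff hk]
  set M := ∑ σ, annealedProb d (k + 1) β B σ *
    centeredSpin (k + 1) (vertexMean d √(Real.tanh β) B θ₀) σ
  have : (√((k : ℝ) + 1))⁻¹ * (k + 1) = √((k : ℝ) + 1) := by
    rw [inv_mul_eq_iff_eq_mul₀ hs, hsq]
  linear_combination M * this

lemma IsPeak.tendsto_annealedSusceptibility (hβ : 0 ≤ β) (h : IsPeak d √(Real.tanh β) B θ₀) :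
    Tendsto (fun n => annealedSusceptibility d n β B) atTop
      (𝓝 (peakVariance d √(Real.tanh β) B θ₀)) := by
  rw [← tendsto_add_atTop_iff_nat 1]
  obtain ⟨h1, h2⟩ := h.tendsto_moments hβ
  have h3 := h2.sub (h1.mul h1)
  rw [mul_zero, sub_zero] at h3
  refine h3.congr fun k => ?_
  set m := vertexMean d √(Real.tanh β) B θ₀ with hm
  set M := ∑ σ, annealedProb d (k + 1) β B σ * centeredSpin (k + 1) m σ with hM
  have hs : √((k + 1 : ℕ) : ℝ) ≠ 0 := by positivity
  have hdiff : ∀ σ : Config (k + 1), totalSpin σ / √((k + 1 : ℕ) : ℝ) -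
      ∫ σ, totalSpin σ / √((k + 1 : ℕ) : ℝ) ∂(annealedMeasure d (k + 1) β B) =
      centeredSpin (k + 1) m σ - M := by
    intro σ
    rw [integral_div, integral_totalSpin d k.succ_ne_zero β B m, totalSpin_eq k.succ_ne_zero m,
      ← hM, ← sub_div, div_eq_iff hs]
    ring
  rw [annealedSusceptibility, variance_eq_integral .of_discrete]
  simp only [hdiff]
  rw [integral_annealedMeasure]
  have hexpand : ∀ σ : Config (k + 1), annealedProb d (k + 1) β B σ •
      (centeredSpin (k + 1) m σ - M) ^ 2 =
      annealedProb d (k + 1) β B σ * centeredSpin (k + 1) m σ ^ 2 -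
        annealedProb d (k + 1) β B σ * centeredSpin (k + 1) m σ * (2 * M) +
        annealedProb d (k + 1) β B σ * M ^ 2 := fun σ => by
    rw [smul_eq_mul]
    ring
  simp only [hexpand]
  rw [Finset.sum_add_distrib, Finset.sum_sub_distrib, ← Finset.sum_mul, ← Finset.sum_mul,
    sum_annealedProb, ← hM]
  ring

/-- The central limit theorem, from the convergence of the generating functions. -/
lemma IsPeak.tendstoInDistribution (hβ : 0 ≤ β) (h : IsPeak d √(Real.tanh β) B θ₀) {χ : ℝ≥0}
    (hχ : (χ : ℝ) = peakVariance d √(Real.tanh β) B θ₀) :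
    TendstoInDistribution
      (fun (n : ℕ) (σ : Config n) =>
        (totalSpin σ - ∫ τ, totalSpin τ ∂(annealedMeasure d n β B)) / √(n : ℝ))
      atTop (id : ℝ → ℝ) (fun n => annealedMeasure d n β B) (gaussianReal 0 χ) where
  forall_aemeasurable n := .of_discrete
  aemeasurable_limit := aemeasurable_id
  tendsto := by
    -- Lévy's continuity theorem; the characteristic function is the generating function on the
    -- imaginary axis, recentered at the mean
    refine ProbabilityMeasure.tendsto_iff_tendsto_charFun.2 fun t => ?_
    rw [← tendsto_add_atTop_iff_nat 1]
    simp only [ProbabilityMeasure.coe_mk, Measure.map_id]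
    have h1 := h.tendsto_finiteMGF hβ (t * Complex.I)
    have h2 := (h.tendsto_moments hβ).1
    set m := vertexMean d √(Real.tanh β) B θ₀ with hm
    have h3 : Tendsto (fun k : ℕ => Complex.exp (-(t * Complex.I *
        ((∑ σ, annealedProb d (k + 1) β B σ * centeredSpin (k + 1) m σ : ℝ) : ℂ)))) atTop
        (𝓝 1) := by
      have h4 := (((Complex.continuous_ofReal.tendsto 0).comp h2).const_mul
        (t * Complex.I : ℂ)).neg
      rw [Complex.ofReal_zero, mul_zero, neg_zero] at h4
      have h5 := (Complex.continuous_exp.tendsto 0).comp h4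
      rwa [Complex.exp_zero] at h5
    have h4 := h3.mul h1
    have hval : 1 * Complex.exp (peakVariance d √(Real.tanh β) B θ₀ * (t * Complex.I) ^ 2 / 2) =
        charFun (gaussianReal 0 χ) t := by
      rw [charFun_gaussianReal, ← hχ, one_mul, mul_pow, Complex.I_sq]
      congr 1
      push_cast
      ring
    rw [hval] at h4
    refine h4.congr fun k => ?_
    rw [charFun_apply_real, integral_map .of_discrete (by fun_prop), integral_annealedMeasure,
      finiteMGF, Finset.mul_sum]
    refine Finset.sum_congr rfl fun σ _ => ?_
    set M := ∑ σ, annealedProb d (k + 1) β B σ * centeredSpin (k + 1) m σ with hM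
    have hs : √((k + 1 : ℕ) : ℝ) ≠ 0 := by positivity
    have hdiff : (totalSpin σ - ∫ τ, totalSpin τ ∂(annealedMeasure d (k + 1) β B)) /
        √((k + 1 : ℕ) : ℝ) = centeredSpin (k + 1) m σ - M := by
      rw [integral_totalSpin d k.succ_ne_zero β B m, totalSpin_eq k.succ_ne_zero m, ← hM,
        div_eq_iff hs]
      ring
    rw [hdiff, Complex.real_smul, mul_left_comm, ← Complex.exp_add]
    congr 2
    push_cast
    ring

end Limits

/-! ### The variational formula for the pressure -/

lemma exp_neg_two_mul (β : ℝ) :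
    Real.exp (-2 * β) * (1 + Real.tanh β) = 1 - Real.tanh β := by
  have hc := (Real.cosh_pos β).ne'
  have h2 : Real.exp (-2 * β) * Real.exp β = Real.exp (-β) := by
    rw [← Real.exp_add]
    ring_nf
  rw [Real.tanh_eq_sinh_div_cosh]
  set q := Real.exp (-2 * β)
  field_simp
  rw [Real.cosh_add_sinh, Real.cosh_sub_sinh, h2]

lemma fFun_radicand_pos (β : ℝ) {s : ℝ} (h0 : 0 ≤ s) (h1 : s ≤ 1) :
    0 < 1 + (Real.exp (-4 * β) - 1) * (1 - 2 * s) ^ 2 := by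
  have hq := Real.exp_pos (-4 * β)
  rcases eq_or_ne s (1 / 2) with rfl | hs
  · norm_num
  · have h2 : 0 < (1 - 2 * s) ^ 2 := by
      have : 1 - 2 * s ≠ 0 := fun h => hs (by linarith)
      positivity
    nlinarith [mul_pos hq h2]

lemma fFun_pos (β : ℝ) {s : ℝ} (h0 : 0 ≤ s) (h1 : s ≤ 1 / 2) : 0 < fFun β s := by
  have hr := fFun_radicand_pos β h0 (by linarith)
  have h2 : 0 ≤ Real.exp (-2 * β) * (1 - 2 * s) :=
    mul_nonneg (Real.exp_pos _).le (by linarith)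
  exact div_pos (add_pos_of_nonneg_of_pos h2 (Real.sqrt_pos.2 hr)) (by linarith)

/-- The quadratic equation solved by `f`. -/
lemma fFun_quadratic (β : ℝ) {s : ℝ} (h0 : 0 ≤ s) (h1 : s ≤ 1 / 2) :
    (1 - s) * fFun β s ^ 2 - Real.exp (-2 * β) * (1 - 2 * s) * fFun β s - s = 0 := by
  have hr := fFun_radicand_pos β h0 (by linarith)
  have hs : (1 - s) ≠ 0 := by linarith
  have h4 : Real.exp (-4 * β) = Real.exp (-2 * β) ^ 2 := by
    rw [sq, ← Real.exp_add]
    ring_nf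
  have hsq := Real.sq_sqrt hr.le
  rw [h4] at hsq
  rw [fFun, h4]
  set q := Real.exp (-2 * β)
  set R := √(1 + (q ^ 2 - 1) * (1 - 2 * s) ^ 2)
  field_simp
  linear_combination hsq

lemma differentiableAt_fFun (β : ℝ) {s : ℝ} (h0 : 0 ≤ s) (h1 : s ≤ 1 / 2) :
    DifferentiableAt ℝ (fFun β) s := by
  have hr := (fFun_radicand_pos β h0 (by linarith)).ne'
  have hs : 2 * (1 - s) ≠ 0 := by
    have : 0 < 1 - s := by linarith
    positivity
  unfold fFun
  refine DifferentiableAt.div (DifferentiableAt.add (by fun_prop) ?_) (by fun_prop) hs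
  exact DifferentiableAt.sqrt (by fun_prop) hr

/-- The closed form of `F` on `[0, 1 / 2]`; by the quadratic equation, `f` is a critical point of
`r ↦ t log r - log (r² - 2 q r + 1) / 2`. -/
lemma FFun_eq {β : ℝ} (hβ : 0 < β) {t : ℝ} (h0 : 0 ≤ t) (h1 : t ≤ 1 / 2) :
    FFun β t = t * Real.log (fFun β t) -
      Real.log (fFun β t ^ 2 - 2 * Real.exp (-2 * β) * fFun β t + 1) / 2 +
      Real.log (1 - Real.exp (-2 * β) ^ 2) / 2 := by
  have hq1 : Real.exp (-2 * β) < 1 := by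
    rw [← Real.exp_zero]
    exact Real.exp_lt_exp.2 (by linarith)
  have hq0 := Real.exp_pos (-2 * β)
  set q := Real.exp (-2 * β) with hq
  have hden : ∀ x : ℝ, 0 < x ^ 2 - 2 * q * x + 1 := fun x => by nlinarith [sq_nonneg (x - q)]
  have hder : ∀ s ∈ Set.uIcc 0 t, HasDerivAt (fun s => s * Real.log (fFun β s) -
      Real.log (fFun β s ^ 2 - 2 * q * fFun β s + 1) / 2) (Real.log (fFun β s)) s := by
    intro s hs
    rw [Set.uIcc_of_le h0] at hs
    have hs1 : s ≤ 1 / 2 := hs.2.trans h1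
    have hf := (differentiableAt_fFun β hs.1 hs1).hasDerivAt
    have hfp := fFun_pos β hs.1 hs1
    have hquad := fFun_quadratic β hs.1 hs1
    rw [← hq] at hquad
    have hd := hden (fFun β s)
    set f' := deriv (fFun β) s
    refine (((hasDerivAt_id s).mul (hf.log hfp.ne')).sub
      (((((hf.fun_pow 2).fun_sub (hf.const_mul (2 * q))).add_const 1).log hd.ne').div_const
        2)).congr_deriv ?_
    have hd' := hd.ne'
    have hfp' := hfp.ne'
    simp only [id, Nat.cast_ofNat, one_mul]
    have key : s * (f' / fFun β s) = (2 * fFun β s ^ (2 - 1) * f' - 2 * q * f') /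
        (fFun β s ^ 2 - 2 * q * fFun β s + 1) / 2 := by
      rw [div_div, mul_div_assoc', div_eq_div_iff hfp' (by positivity)]
      simp only [Nat.add_one_sub_one, pow_one]
      linear_combination (-2 * f') * hquad
    have key' : s * (f' / fFun β s) - (2 * fFun β s ^ (2 - 1) * f' - 2 * q * f') /
        (fFun β s ^ 2 - 2 * q * fFun β s + 1) / 2 = 0 := sub_eq_zero.2 key
    linear_combination key'
  have hint : IntervalIntegrable (fun s => Real.log (fFun β s)) volume 0 t := by
    refine ContinuousOn.intervalIntegrable fun s hs => ?_
    rw [Set.uIcc_of_le h0] at hs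
    have hs1 : s ≤ 1 / 2 := hs.2.trans h1
    exact ((differentiableAt_fFun β hs.1 hs1).continuousAt.log
      (fFun_pos β hs.1 hs1).ne').continuousWithinAt
  have hf0 : fFun β 0 = q := by
    have h2 := fFun_quadratic β le_rfl (by norm_num : (0 : ℝ) ≤ 1 / 2)
    have h3 := fFun_pos β le_rfl (by norm_num : (0 : ℝ) ≤ 1 / 2)
    refine mul_left_cancel₀ h3.ne' ?_
    rw [← hq] at h2
    linear_combination h2
  rw [FFun, min_eq_left (by linarith), intervalIntegral.integral_eq_sub_of_hasDerivAt hder hint,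
    hf0, show q ^ 2 - 2 * q * q + 1 = 1 - q ^ 2 by ring]
  ring

lemma FFun_one_sub (β t : ℝ) : FFun β (1 - t) = FFun β t := by
  rw [FFun, FFun, sub_sub_cancel, min_comm]

/-- At infinite temperature there is no interaction. -/
lemma FFun_zero (t : ℝ) (h0 : 0 ≤ t) (h1 : t ≤ 1) : FFun 0 t = 0 := by
  rw [FFun]
  refine intervalIntegral.integral_zero_ae (Eventually.of_forall fun s hs => ?_)
  rw [Set.uIoc_of_le (le_min h0 (by linarith))] at hs
  have hs1 : 2 * s ≤ 1 := by
    have h2 := hs.2.trans (min_le_left _ _)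
    have h3 := hs.2.trans (min_le_right _ _)
    linarith
  have hs2 : 2 * (1 - s) ≠ 0 := by linarith
  have : fFun 0 s = 1 := by
    rw [fFun, div_eq_one_iff_eq hs2]
    simp
    ring
  rw [this, Real.log_one]

/-- The function `F` in terms of the factors of the half-edges, at the optimal angle. -/
lemma FFun_eq_of_eq_fFun_mul {β : ℝ} (hβ : 0 < β) {t θ : ℝ} (h0 : 0 ≤ t) (h1 : t ≤ 1 / 2)
    (hm : 0 < halfEdgeFactor (-√(Real.tanh β)) θ)
    (h : halfEdgeFactor √(Real.tanh β) θ = fFun β t * halfEdgeFactor (-√(Real.tanh β)) θ) :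
    FFun β t = t * Real.log (halfEdgeFactor √(Real.tanh β) θ) +
      (1 - t) * Real.log (halfEdgeFactor (-√(Real.tanh β)) θ) -
        Real.log (1 + Real.tanh β) / 2 := by
  have hq1 : Real.exp (-2 * β) < 1 := by
    rw [← Real.exp_zero]
    exact Real.exp_lt_exp.2 (by linarith)
  have hq0 := Real.exp_pos (-2 * β)
  have hq := exp_neg_two_mul β
  have hw := tanh_nonneg hβ.le
  have hb := Real.sq_sqrt hw
  have hf := fFun_pos β h0 h1
  rw [FFun_eq hβ h0 h1]
  set q := Real.exp (-2 * β)
  set b := √(Real.tanh β)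
  set P := halfEdgeFactor b θ with hP
  set M := halfEdgeFactor (-b) θ with hM
  have hden : 0 < fFun β t ^ 2 - 2 * q * fFun β t + 1 := by
    nlinarith [sq_nonneg (fFun β t - q)]
  have hid : P ^ 2 - 2 * q * P * M + M ^ 2 = (1 + Real.tanh β) * (1 - q ^ 2) := by
    have hs : Real.sin θ ^ 2 + Real.cos θ ^ 2 = 1 := Real.sin_sq_add_cos_sq θ
    simp only [hP, hM, halfEdgeFactor]
    have hq2 : (1 + Real.tanh β) * (1 - q ^ 2) = 2 * Real.tanh β * (1 + q) := by
      linear_combination -(1 + q) * hq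
    have hq3 : 1 - q = Real.tanh β * (1 + q) := by linear_combination -hq
    rw [hq2]
    linear_combination 2 * Real.sin θ ^ 2 * (1 + q) * hb +
      2 * Real.cos θ ^ 2 * hq3 + 2 * Real.tanh β * (1 + q) * hs
  have hid2 : M ^ 2 * (fFun β t ^ 2 - 2 * q * fFun β t + 1) =
      (1 + Real.tanh β) * (1 - q ^ 2) := by
    rw [← hid, h]
    ring
  have hlog := congrArg Real.log hid2
  have hq2 : 0 < 1 - q ^ 2 := by nlinarith
  rw [Real.log_mul (by positivity) hden.ne', Real.log_mul (by positivity) hq2.ne',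
    Real.log_pow] at hlog
  push_cast at hlog
  rw [h, Real.log_mul hf.ne' hm.ne']
  linear_combination -hlog / 2

/-- The positive root of the quadratic equation of `f` is unique. -/
lemma eq_of_quadratic {q t r r' : ℝ} (h0 : 0 ≤ t) (h1 : t < 1) (hr : 0 < r) (hr' : 0 < r')
    (h : (1 - t) * r ^ 2 - q * (1 - 2 * t) * r - t = 0)
    (h' : (1 - t) * r' ^ 2 - q * (1 - 2 * t) * r' - t = 0) : r = r' := by
  by_contra hne
  have h2 : (r - r') * ((1 - t) * (r + r') - q * (1 - 2 * t)) = 0 := by linear_combination h - h'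
  have h3 := (mul_eq_zero.1 h2).resolve_left (sub_ne_zero.2 hne)
  have h4 : (1 - t) * (r * r') + t = 0 := by linear_combination r * h3 - h
  have h5 : 0 < (1 - t) * (r * r') := mul_pos (by linarith) (mul_pos hr hr')
  linarith

/-- `F t` is the value, at some angle, of the average of the logarithms of the factors of the
half-edges. -/
lemma exists_FFun_eq {β : ℝ} (hβ : 0 ≤ β) {t : ℝ} (h0 : 0 ≤ t) (h1 : t ≤ 1) :
    ∃ θ ∈ Set.Icc (-(Real.pi / 2)) (Real.pi / 2), 0 < halfEdgeFactor √(Real.tanh β) θ ∧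
      0 < halfEdgeFactor (-√(Real.tanh β)) θ ∧
      FFun β t = t * Real.log (halfEdgeFactor √(Real.tanh β) θ) +
        (1 - t) * Real.log (halfEdgeFactor (-√(Real.tanh β)) θ) -
          Real.log (1 + Real.tanh β) / 2 := by
  have hpi := Real.pi_pos
  rcases hβ.lt_or_eq with hβ | rfl
  · have hw : 0 < Real.tanh β := by
      rw [Real.tanh_eq_sinh_div_cosh]
      exact div_pos (Real.sinh_pos_iff.2 hβ) (Real.cosh_pos β)
    have hb : 0 < √(Real.tanh β) := Real.sqrt_pos.2 hw
    have key : ∀ f : ℝ, 0 < f → ∃ θ ∈ Set.Icc (-(Real.pi / 2)) (Real.pi / 2),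
        0 < halfEdgeFactor √(Real.tanh β) θ ∧ 0 < halfEdgeFactor (-√(Real.tanh β)) θ ∧
        halfEdgeFactor √(Real.tanh β) θ = f * halfEdgeFactor (-√(Real.tanh β)) θ := by
      intro f hf
      set u := (f - 1) / (√(Real.tanh β) * (f + 1)) with hu
      have hbu : √(Real.tanh β) * u = (f - 1) / (f + 1) := by
        rw [hu]
        field_simp
      have hc := Real.cos_arctan_pos u
      have hsin : Real.sin (Real.arctan u) = u * Real.cos (Real.arctan u) := by
        rw [← Real.tan_mul_cos hc.ne', Real.tan_arctan]
      have e1 : halfEdgeFactor √(Real.tanh β) (Real.arctan u) =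
          Real.cos (Real.arctan u) * (2 * f / (f + 1)) := by
        rw [halfEdgeFactor, hsin, ← mul_assoc, hbu]
        field_simp
        ring
      have e2 : halfEdgeFactor (-√(Real.tanh β)) (Real.arctan u) =
          Real.cos (Real.arctan u) * (2 / (f + 1)) := by
        rw [halfEdgeFactor, hsin, ← mul_assoc, neg_mul, hbu]
        field_simp
        ring
      refine ⟨Real.arctan u, ⟨(Real.neg_pi_div_two_lt_arctan u).le,
        (Real.arctan_lt_pi_div_two u).le⟩, ?_, ?_, ?_⟩
      · rw [e1]; positivity
      · rw [e2]; positivity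
      · rw [e1, e2]; ring
    rcases le_total t (1 / 2) with ht | ht
    · obtain ⟨θ, hθ, hp, hm, h⟩ := key (fFun β t) (fFun_pos β h0 ht)
      exact ⟨θ, hθ, hp, hm, FFun_eq_of_eq_fFun_mul hβ h0 ht hm h⟩
    · obtain ⟨θ, hθ, hp, hm, h⟩ := key (fFun β (1 - t)) (fFun_pos β (by linarith) (by linarith))
      refine ⟨-θ, ⟨by linarith [hθ.2], by linarith [hθ.1]⟩, ?_, ?_, ?_⟩
      · rwa [halfEdgeFactor_neg]
      · rwa [halfEdgeFactor_neg, neg_neg]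
      · rw [← FFun_one_sub, FFun_eq_of_eq_fFun_mul hβ (by linarith) (by linarith) hm h,
          halfEdgeFactor_neg, halfEdgeFactor_neg, neg_neg]
        ring
  · refine ⟨0, ⟨by linarith, by linarith⟩, ?_, ?_, ?_⟩
    · simp [halfEdgeFactor]
    · simp [halfEdgeFactor]
    · rw [FFun_zero t h0 h1]
      simp [halfEdgeFactor]

/-- `F t` dominates the average of the logarithms of the factors at any angle that is stationary
for this average. -/
lemma le_FFun_of_crit {β : ℝ} (hβ : 0 ≤ β) {t θ : ℝ} (h0 : 0 ≤ t) (h1 : t ≤ 1)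
    (hp : 0 < halfEdgeFactor √(Real.tanh β) θ) (hm : 0 < halfEdgeFactor (-√(Real.tanh β)) θ)
    (h : t * halfEdgeFactor' √(Real.tanh β) θ * halfEdgeFactor (-√(Real.tanh β)) θ +
      (1 - t) * halfEdgeFactor' (-√(Real.tanh β)) θ * halfEdgeFactor √(Real.tanh β) θ = 0) :
    t * Real.log (halfEdgeFactor √(Real.tanh β) θ) +
        (1 - t) * Real.log (halfEdgeFactor (-√(Real.tanh β)) θ) -
          Real.log (1 + Real.tanh β) / 2 ≤ FFun β t := by
  rcases hβ.lt_or_eq with hβ | rfl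
  · have hs : ∀ θ, Real.sin θ ^ 2 + Real.cos θ ^ 2 = 1 := Real.sin_sq_add_cos_sq
    have hw := tanh_nonneg hβ.le
    have hb := Real.sq_sqrt hw
    have hq := exp_neg_two_mul β
    -- a stationary angle gives the optimal ratio of the two factors
    have key : ∀ t θ : ℝ, 0 ≤ t → t ≤ 1 / 2 → 0 < halfEdgeFactor √(Real.tanh β) θ →
        0 < halfEdgeFactor (-√(Real.tanh β)) θ →
        t * halfEdgeFactor' √(Real.tanh β) θ * halfEdgeFactor (-√(Real.tanh β)) θ +
          (1 - t) * halfEdgeFactor' (-√(Real.tanh β)) θ * halfEdgeFactor √(Real.tanh β) θ = 0 →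
        halfEdgeFactor √(Real.tanh β) θ = fFun β t * halfEdgeFactor (-√(Real.tanh β)) θ := by
      intro t θ h0 h1 hp hm h
      rw [← div_eq_iff hm.ne']
      refine eq_of_quadratic (q := Real.exp (-2 * β)) h0 (by linarith) (div_pos hp hm)
        (fFun_pos β h0 h1) ?_ (fFun_quadratic β h0 h1)
      have hquad : (1 - t) * halfEdgeFactor √(Real.tanh β) θ ^ 2 -
          Real.exp (-2 * β) * (1 - 2 * t) * halfEdgeFactor √(Real.tanh β) θ *
            halfEdgeFactor (-√(Real.tanh β)) θ -
              t * halfEdgeFactor (-√(Real.tanh β)) θ ^ 2 = 0 := by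
        have hs := hs θ
        simp only [halfEdgeFactor, halfEdgeFactor'] at h ⊢
        set b := √(Real.tanh β)
        set S := Real.sin θ
        set C := Real.cos θ
        set q := Real.exp (-2 * β)
        set w := Real.tanh β
        have hw1 : (1 + w) ≠ 0 := by positivity
        have h' : b * (1 - 2 * t) + (1 + w) * (S * C) = 0 := by
          linear_combination -h + b * (2 * t - 1) * hs - S * C * hb
        refine mul_left_cancel₀ hw1 ?_
        linear_combination 2 * b * h' + (1 - 2 * t) * (S ^ 2 * (1 + w) * (1 + q) - 2) * hb +
          (1 - 2 * t) * (w * S ^ 2 - C ^ 2) * hq + 2 * w * (1 - 2 * t) * hs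
      have hm' := hm.ne'
      set q := Real.exp (-2 * β)
      field_simp
      linear_combination hquad
    rcases le_total t (1 / 2) with ht | ht
    · exact (FFun_eq_of_eq_fFun_mul hβ h0 ht hm (key t θ h0 ht hp hm h)).ge
    · have h2 : halfEdgeFactor √(Real.tanh β) (-θ) =
          fFun β (1 - t) * halfEdgeFactor (-√(Real.tanh β)) (-θ) := by
        refine key (1 - t) (-θ) (by linarith) (by linarith) (by rwa [halfEdgeFactor_neg])
          (by rwa [halfEdgeFactor_neg, neg_neg]) ?_
        rw [halfEdgeFactor_neg, halfEdgeFactor_neg, halfEdgeFactor'_neg, halfEdgeFactor'_neg,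
          neg_neg]
        linear_combination -h
      have h3 := FFun_eq_of_eq_fFun_mul hβ (by linarith) (by linarith)
        (by rwa [halfEdgeFactor_neg, neg_neg]) h2
      rw [FFun_one_sub, halfEdgeFactor_neg, halfEdgeFactor_neg, neg_neg] at h3
      rw [h3]
      linarith
  · rw [FFun_zero t h0 h1]
    simp only [halfEdgeFactor, Real.tanh_zero, Real.sqrt_zero, neg_zero, zero_mul, add_zero,
      Real.log_one, zero_div, sub_zero] at hp ⊢
    have := Real.log_nonpos hp.le (Real.cos_le_one θ)
    linarith

/-- Gibbs' variational inequality for two states. -/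
lemma entropy_add_le_log {x y t : ℝ} (hx : 0 < x) (hy : 0 < y) (h0 : 0 ≤ t) (h1 : t ≤ 1) :
    (t - 1) * Real.log (1 - t) - t * Real.log t + t * Real.log x + (1 - t) * Real.log y ≤
      Real.log (x + y) := by
  have key : ∀ {x t : ℝ}, 0 < x → 0 ≤ t → ∀ z, 0 < z →
      t * Real.log x - t * Real.log t - t * Real.log z ≤ x / z - t := by
    intro x t hx ht z hz
    rcases ht.lt_or_eq with ht | rfl
    · have h2 := Real.log_le_sub_one_of_pos (show 0 < x / (t * z) by positivity)
      rw [Real.log_div hx.ne' (by positivity), Real.log_mul ht.ne' hz.ne'] at h2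
      have h3 := mul_le_mul_of_nonneg_left h2 ht.le
      have h4 : t * (x / (t * z) - 1) = x / z - t := by field_simp
      linarith
    · simp
      positivity
  have hz : 0 < x + y := by positivity
  have e1 := key hx h0 (x + y) hz
  have e2 := key hy (sub_nonneg.2 h1) (x + y) hz
  have e3 : x / (x + y) + y / (x + y) = 1 := by field_simp
  linarith

/-- The pressure in terms of the maximal weight of a vertex. -/
lemma IsPeak.pressure_eq {d : ℕ} (hd : 2 ≤ d) {β B θ₀ : ℝ} (hβ : 0 ≤ β)
    (h : IsPeak d √(Real.tanh β) B θ₀) :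
    pressure d β B = β * d / 2 - d * (Real.log (1 + Real.tanh β) / 2) +
      Real.log (vertexWeight d √(Real.tanh β) B θ₀) := by
  have hg := h.weight_pos d
  have hlogx : ∀ (B c : ℝ), 0 < c → Real.log (Real.exp B * c ^ d) = B + d * Real.log c := by
    intro B c hc
    rw [Real.log_mul (Real.exp_pos _).ne' (pow_pos hc d).ne', Real.log_exp, Real.log_pow]
  set b := √(Real.tanh β) with hb
  set φ : ℝ → ℝ := fun t =>
    (t - 1) * Real.log (1 - t) - t * Real.log t + 2 * B * t + d * FFun β t with hφ
  -- Gibbs' inequality at an angle where `F t` is attained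
  have hupper : ∀ t, 0 ≤ t → t ≤ 1 → φ t ≤
      B - d * (Real.log (1 + Real.tanh β) / 2) + Real.log (vertexWeight d b B θ₀) := by
    intro t h0 h1
    obtain ⟨θ, hθ, hp, hm, hF⟩ := exists_FFun_eq hβ h0 h1
    rw [← hb] at hp hm hF
    have e1 := entropy_add_le_log (mul_pos (Real.exp_pos B) (pow_pos hp d))
      (mul_pos (Real.exp_pos (-B)) (pow_pos hm d)) h0 h1
    rw [hlogx _ _ hp, hlogx _ _ hm] at e1
    have e2 : Real.log (vertexWeight d b B θ) ≤ Real.log (vertexWeight d b B θ₀) := by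
      refine Real.log_le_log (vertexWeight_pos hp hm) ?_
      rcases eq_or_ne θ θ₀ with rfl | hne
      · exact le_rfl
      · exact (vertexWeight_le_absWeight d b B θ).trans (h.lt θ hθ hne).le
    have e3 : Real.exp B * halfEdgeFactor b θ ^ d + Real.exp (-B) * halfEdgeFactor (-b) θ ^ d =
        vertexWeight d b B θ := rfl
    rw [e3] at e1
    simp only [hφ, hF]
    linarith
  have hgreat : IsGreatest (φ '' Set.Icc 0 1)
      (B - d * (Real.log (1 + Real.tanh β) / 2) + Real.log (vertexWeight d b B θ₀)) := by
    refine ⟨?_, by rintro _ ⟨t, ⟨h0, h1⟩, rfl⟩; exact hupper t h0 h1⟩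
    -- equality holds at the peak, for the fraction of positive spins there
    have hp := h.plus_pos
    have hm := h.minus_pos
    set x := Real.exp B * halfEdgeFactor b θ₀ ^ d with hx
    set y := Real.exp (-B) * halfEdgeFactor (-b) θ₀ ^ d with hy
    have hx0 : 0 < x := mul_pos (Real.exp_pos B) (pow_pos hp d)
    have hy0 : 0 < y := mul_pos (Real.exp_pos (-B)) (pow_pos hm d)
    have hxy : vertexWeight d b B θ₀ = x + y := rfl
    have hz : 0 < x + y := by positivity
    set t := x / (x + y) with ht
    have ht1 : 1 - t = y / (x + y) := by
      rw [ht]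
      field_simp
      ring
    have h0 : 0 ≤ t := by positivity
    have h1 : t ≤ 1 := by
      have : 0 ≤ 1 - t := by rw [ht1]; positivity
      linarith
    have hmem : φ t ∈ φ '' Set.Icc 0 1 := ⟨t, ⟨h0, h1⟩, rfl⟩
    have hpow : ∀ c : ℝ, c ^ d = c ^ (d - 1) * c := fun c => by
      rw [← pow_succ]
      congr 1
      omega
    have hcrit : t * halfEdgeFactor' b θ₀ * halfEdgeFactor (-b) θ₀ +
        (1 - t) * halfEdgeFactor' (-b) θ₀ * halfEdgeFactor b θ₀ = 0 := by
      have hc := h.crit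
      simp only [fieldSum, vertexFactor'] at hc
      have hd0 : (d : ℝ) ≠ 0 := by positivity
      have hc' : Real.exp B * (halfEdgeFactor b θ₀ ^ (d - 1) * halfEdgeFactor' b θ₀) +
          Real.exp (-B) * (halfEdgeFactor (-b) θ₀ ^ (d - 1) * halfEdgeFactor' (-b) θ₀) = 0 := by
        refine mul_left_cancel₀ hd0 ?_
        linear_combination hc
      rw [ht1, ht]
      refine mul_left_cancel₀ hz.ne' ?_
      field_simp
      rw [hx, hy, hpow, hpow]
      linear_combination halfEdgeFactor b θ₀ * halfEdgeFactor (-b) θ₀ * hc'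
    have hF := le_FFun_of_crit hβ h0 h1 hp hm hcrit
    rw [← hb] at hF
    have hval : B - d * (Real.log (1 + Real.tanh β) / 2) + Real.log (vertexWeight d b B θ₀) ≤
        φ t := by
      have l1 : Real.log t = B + d * Real.log (halfEdgeFactor b θ₀) - Real.log (x + y) := by
        rw [ht, Real.log_div hx0.ne' hz.ne', hx, hlogx _ _ hp]
      have l2 : Real.log (1 - t) =
          -B + d * Real.log (halfEdgeFactor (-b) θ₀) - Real.log (x + y) := by
        rw [ht1, Real.log_div hy0.ne' hz.ne', hy, hlogx _ _ hm]
      have hF' := mul_le_mul_of_nonneg_left hF (Nat.cast_nonneg d : (0 : ℝ) ≤ d)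
      simp only [hφ]
      rw [l1, l2, hxy]
      linarith
    rwa [← le_antisymm (hupper t h0 h1) hval]
  rw [pressure, hgreat.csSup_eq]
  ring

/-! ### Differentiability of the pressure -/

lemma IsPeak.vertexWeight_le {d : ℕ} {b B θ₀ : ℝ} (h : IsPeak d b B θ₀) {θ : ℝ}
    (hθ : θ ∈ Set.Icc (-(Real.pi / 2)) (Real.pi / 2)) :
    vertexWeight d b B θ ≤ vertexWeight d b B θ₀ := by
  rcases eq_or_ne θ θ₀ with rfl | hne
  · exact le_rfl
  · exact (vertexWeight_le_absWeight d b B θ).trans (h.lt θ hθ hne).le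

lemma IsPeak.unique {d : ℕ} {b B θ θ' : ℝ} (h : IsPeak d b B θ) (h' : IsPeak d b B θ') :
    θ = θ' := by
  by_contra hne
  have h1 := h'.lt θ (Set.Ioo_subset_Icc_self h.mem) hne
  have h2 := h.vertexWeight_le (Set.Ioo_subset_Icc_self h'.mem)
  have h3 := vertexWeight_le_absWeight d b B θ
  linarith

/-- The peak depends continuously on the field. -/
lemma IsPeak.tendsto_peak {d : ℕ} {b B θ₀ : ℝ} (h : IsPeak d b B θ₀) {T : ℝ → ℝ}
    (hT : ∀ᶠ x in 𝓝 B, IsPeak d b x (T x)) : Tendsto T (𝓝 B) (𝓝 θ₀) := by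
  have hg := h.weight_pos d
  obtain ⟨c, hc, hbound⟩ := h.exists_quadratic_bound
  set g := vertexWeight d b B θ₀ with hgdef
  set K := (1 + |b|) ^ d with hK
  have hK0 : 0 ≤ K := by positivity
  -- the variation of the weight with the field, uniformly in the angle
  set η : ℝ → ℝ := fun x => (|Real.exp x - Real.exp B| + |Real.exp (-x) - Real.exp (-B)|) * K
    with hη
  have hηlim : Tendsto η (𝓝 B) (𝓝 0) := by
    have : Continuous η := by fun_prop
    have h1 := this.tendsto B
    simpa [hη] using h1
  have hvar : ∀ x θ, |vertexWeight d b x θ - vertexWeight d b B θ| ≤ η x := by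
    intro x θ
    have h1 := abs_vertexFactor_le d b θ
    have h2 := abs_vertexFactor_le d (-b) θ
    rw [abs_neg] at h2
    have h3 : vertexWeight d b x θ - vertexWeight d b B θ =
        (Real.exp x - Real.exp B) * vertexFactor d b θ +
          (Real.exp (-x) - Real.exp (-B)) * vertexFactor d (-b) θ := by
      simp only [vertexWeight, fieldSum]
      ring
    rw [h3]
    refine (abs_add_le _ _).trans ?_
    rw [abs_mul, abs_mul, hη]
    have h4 := mul_le_mul_of_nonneg_left h1 (abs_nonneg (Real.exp x - Real.exp B))
    have h5 := mul_le_mul_of_nonneg_left h2 (abs_nonneg (Real.exp (-x) - Real.exp (-B)))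
    simp only
    linarith
  have hsq : ∀ᶠ x in 𝓝 B, (T x - θ₀) ^ 2 ≤ 2 * η x / (c * g) := by
    filter_upwards [hT] with x hx
    have h1 := hbound (T x) (Set.Ioo_subset_Icc_self hx.mem)
    have h2 := vertexWeight_le_absWeight d b B (T x)
    have h3 := hx.vertexWeight_le (Set.Ioo_subset_Icc_self h.mem)
    have h4 := (abs_le.1 (hvar x (T x))).2
    have h5 := (abs_le.1 (hvar x θ₀)).1
    rw [le_div_iff₀ (by positivity)]
    linarith
  have hlim : Tendsto (fun x => (T x - θ₀) ^ 2) (𝓝 B) (𝓝 0) := by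
    refine tendsto_of_tendsto_of_tendsto_of_le_of_le' tendsto_const_nhds ?_
      (Eventually.of_forall fun x => sq_nonneg _) hsq
    have := (hηlim.const_mul 2).div_const (c * g)
    simpa using this
  have habs : Tendsto (fun x => |T x - θ₀|) (𝓝 B) (𝓝 0) := by
    have h1 := hlim.sqrt
    simpa [Real.sqrt_sq_eq_abs] using h1
  rw [tendsto_iff_dist_tendsto_zero]
  simpa [Real.dist_eq] using habs

/-- The peak is a differentiable function of the field: the critical point equation is expanded in
divided differences, as in the implicit function theorem. -/
lemma IsPeak.hasDerivAt_peak {d : ℕ} {b B θ₀ : ℝ} (h : IsPeak d b B θ₀) {T : ℝ → ℝ}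
    (hT : ∀ᶠ x in 𝓝 B, IsPeak d b x (T x)) :
    HasDerivAt T (vertexMean' d b B θ₀ / curvature d b B θ₀) B := by
  have hTB : T B = θ₀ := hT.self_of_nhds.unique h
  have hg := (h.weight_pos d).ne'
  have hlim := h.tendsto_peak hT
  have hds : ∀ c, Tendsto (fun x => dslope (vertexFactor' d c) θ₀ (T x)) (𝓝 B)
      (𝓝 (vertexFactor'' d c θ₀)) := by
    intro c
    have h1 := hasDerivAt_vertexFactor' d c θ₀
    have h2 : ContinuousAt (dslope (vertexFactor' d c) θ₀) θ₀ :=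
      continuousAt_dslope_same.2 h1.differentiableAt
    have h3 := h2.tendsto
    rw [dslope_same, h1.deriv] at h3
    exact h3.comp hlim
  set D : ℝ → ℝ := fun x => Real.exp x * dslope (vertexFactor' d b) θ₀ (T x) +
    Real.exp (-x) * dslope (vertexFactor' d (-b)) θ₀ (T x) with hD
  have hDlim : Tendsto D (𝓝 B) (𝓝 (fieldSum B (fun c => vertexFactor'' d c θ₀) b)) := by
    have e1 : Tendsto (fun x : ℝ => Real.exp x) (𝓝 B) (𝓝 (Real.exp B)) :=
      Real.continuous_exp.tendsto B
    have e2 : Tendsto (fun x : ℝ => Real.exp (-x)) (𝓝 B) (𝓝 (Real.exp (-B))) :=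
      (Real.continuous_exp.comp continuous_neg).tendsto B
    exact (e1.mul (hds b)).add (e2.mul (hds (-b)))
  set A : ℝ → ℝ := fun x => fieldSum x (fun c => vertexFactor' d c θ₀) b with hA
  have hAder : HasDerivAt A (vertexMean' d b B θ₀ * vertexWeight d b B θ₀) B := by
    have e1 := (Real.hasDerivAt_exp B).mul_const (vertexFactor' d b θ₀)
    have e2 := ((hasDerivAt_neg B).exp).mul_const (vertexFactor' d (-b) θ₀)
    refine (e1.add e2).congr_deriv ?_
    rw [vertexMean', div_mul_cancel₀ _ hg]
    ring
  have hAB : A B = 0 := h.crit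
  have heq : ∀ᶠ x in 𝓝 B, (T x - θ₀) * D x = -A x := by
    filter_upwards [hT] with x hx
    have h1 := sub_smul_dslope (vertexFactor' d b) θ₀ (T x)
    have h2 := sub_smul_dslope (vertexFactor' d (-b)) θ₀ (T x)
    rw [smul_eq_mul] at h1 h2
    have h3 := hx.crit
    simp only [fieldSum] at h3
    simp only [hD, hA, fieldSum]
    linear_combination Real.exp x * h1 + Real.exp (-x) * h2 + h3
  have hDne : ∀ᶠ x in 𝓝 B, D x ≠ 0 := hDlim.eventually_ne h.concave.ne
  rw [hasDerivAt_iff_tendsto_slope] at hAder ⊢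
  have hfin := (hAder.div (hDlim.mono_left nhdsWithin_le_nhds) h.concave.ne).neg
  have hval : -(vertexMean' d b B θ₀ * vertexWeight d b B θ₀ /
      fieldSum B (fun c => vertexFactor'' d c θ₀) b) =
      vertexMean' d b B θ₀ / curvature d b B θ₀ := by
    have := h.concave.ne
    rw [curvature]
    field_simp
  rw [hval] at hfin
  refine hfin.congr' ?_
  filter_upwards [nhdsWithin_le_nhds heq, nhdsWithin_le_nhds hDne] with x h1 h2
  rw [Pi.div_apply, slope_def_field, slope_def_field, hAB, hTB, sub_zero]
  have h3 : T x - θ₀ = -A x / D x := by rw [eq_div_iff h2, h1]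
  rw [h3]
  ring

/-- The derivative of the logarithm of the maximal weight is the magnetization of a vertex. -/
lemma IsPeak.hasDerivAt_log_weight {d : ℕ} {b B θ₀ : ℝ} (h : IsPeak d b B θ₀) {T : ℝ → ℝ}
    (hT : ∀ᶠ x in 𝓝 B, IsPeak d b x (T x)) :
    HasDerivAt (fun x => Real.log (vertexWeight d b x (T x))) (vertexMean d b B θ₀) B := by
  have hTB : T B = θ₀ := hT.self_of_nhds.unique h
  have hg := h.weight_pos d
  have hder := h.hasDerivAt_peak hT
  have hv : ∀ c, HasDerivAt (fun x => vertexFactor d c (T x))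
      (vertexFactor' d c θ₀ * (vertexMean' d b B θ₀ / curvature d b B θ₀)) B := by
    intro c
    have h1 : HasDerivAt (vertexFactor d c) (vertexFactor' d c θ₀) (T B) :=
      hTB ▸ hasDerivAt_vertexFactor d c (T B)
    exact HasDerivAt.comp (h₂ := vertexFactor d c) B h1 hder
  have hw := ((Real.hasDerivAt_exp B).mul (hv b)).add (((hasDerivAt_neg B).exp).mul (hv (-b)))
  have hw' : HasDerivAt (fun x => vertexWeight d b x (T x))
      (vertexMean d b B θ₀ * vertexWeight d b B θ₀) B := by
    refine hw.congr_deriv ?_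
    have hc := h.crit
    simp only [fieldSum] at hc
    rw [vertexMean, div_mul_cancel₀ _ hg.ne', hTB]
    linear_combination (vertexMean' d b B θ₀ / curvature d b B θ₀) * hc
  refine (hw'.log (by rw [hTB]; exact hg.ne')).congr_deriv ?_
  rw [hTB, mul_div_cancel_right₀ _ hg.ne']

/-- The derivative of the magnetization at the peak is the limit susceptibility. -/
lemma IsPeak.hasDerivAt_vertexMean {d : ℕ} {b B θ₀ : ℝ} (h : IsPeak d b B θ₀) {T : ℝ → ℝ}
    (hT : ∀ᶠ x in 𝓝 B, IsPeak d b x (T x)) :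
    HasDerivAt (fun x => vertexMean d b x (T x)) (peakVariance d b B θ₀) B := by
  have hTB : T B = θ₀ := hT.self_of_nhds.unique h
  have hg := h.weight_pos d
  have hder := h.hasDerivAt_peak hT
  set τ := vertexMean' d b B θ₀ / curvature d b B θ₀ with hτ
  have hv : ∀ c, HasDerivAt (fun x => vertexFactor d c (T x)) (vertexFactor' d c θ₀ * τ) B := by
    intro c
    have h1 : HasDerivAt (vertexFactor d c) (vertexFactor' d c θ₀) (T B) :=
      hTB ▸ hasDerivAt_vertexFactor d c (T B)
    exact HasDerivAt.comp (h₂ := vertexFactor d c) B h1 hder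
  have hm : Real.exp B * vertexFactor d b θ₀ - Real.exp (-B) * vertexFactor d (-b) θ₀ =
      vertexMean d b B θ₀ * vertexWeight d b B θ₀ := by
    rw [vertexMean, div_mul_cancel₀ _ hg.ne']
  have hm' : Real.exp B * vertexFactor' d b θ₀ - Real.exp (-B) * vertexFactor' d (-b) θ₀ =
      vertexMean' d b B θ₀ * vertexWeight d b B θ₀ := by
    rw [vertexMean', div_mul_cancel₀ _ hg.ne']
  have hc := h.crit
  simp only [fieldSum] at hc
  have hgdef : vertexWeight d b B θ₀ =
      Real.exp B * vertexFactor d b θ₀ + Real.exp (-B) * vertexFactor d (-b) θ₀ := rfl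
  have hnum : HasDerivAt (fun x => Real.exp x * vertexFactor d b (T x) -
      Real.exp (-x) * vertexFactor d (-b) (T x))
      ((1 + vertexMean' d b B θ₀ * τ) * vertexWeight d b B θ₀) B := by
    refine (((Real.hasDerivAt_exp B).mul (hv b)).sub
      (((hasDerivAt_neg B).exp).mul (hv (-b)))).congr_deriv ?_
    rw [hTB]
    linear_combination τ * hm' - hgdef
  have hden : HasDerivAt (fun x => vertexWeight d b x (T x))
      (vertexMean d b B θ₀ * vertexWeight d b B θ₀) B := by
    refine (((Real.hasDerivAt_exp B).mul (hv b)).add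
      (((hasDerivAt_neg B).exp).mul (hv (-b)))).congr_deriv ?_
    rw [hTB]
    linear_combination τ * hc + hm
  refine (hnum.div hden (by rw [hTB]; exact hg.ne')).congr_deriv ?_
  rw [hTB, hm, peakVariance]
  have hκ := h.curvature_pos.ne'
  have hg' := hg.ne'
  rw [hτ]
  field_simp
  ring

/-! ### Spontaneous magnetization -/

/-- The magnetization at the peak increases with the field. -/
lemma IsPeak.vertexMean_mono {d : ℕ} {b B₁ B₂ θ₁ θ₂ : ℝ} (h₁ : IsPeak d b B₁ θ₁)
    (h₂ : IsPeak d b B₂ θ₂) (hB : B₁ < B₂) :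
    vertexMean d b B₁ θ₁ ≤ vertexMean d b B₂ θ₂ := by
  have hg₁ := h₁.weight_pos d
  have hg₂ := h₂.weight_pos d
  have e₁ := h₁.vertexWeight_le (Set.Ioo_subset_Icc_self h₂.mem)
  have e₂ := h₂.vertexWeight_le (Set.Ioo_subset_Icc_self h₁.mem)
  have hw₁ : 0 < vertexWeight d b B₁ θ₂ := vertexWeight_pos h₂.plus_pos h₂.minus_pos
  have hw₂ : 0 < vertexWeight d b B₂ θ₁ := vertexWeight_pos h₁.plus_pos h₁.minus_pos
  -- in the product of the two inequalities only the cross terms differ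
  have hprod := mul_le_mul e₁ e₂ hw₂.le hg₁.le
  have p₁ : 0 < vertexFactor d b θ₁ := pow_pos h₁.plus_pos _
  have q₁ : 0 < vertexFactor d (-b) θ₁ := pow_pos h₁.minus_pos _
  have p₂ : 0 < vertexFactor d b θ₂ := pow_pos h₂.plus_pos _
  have q₂ : 0 < vertexFactor d (-b) θ₂ := pow_pos h₂.minus_pos _
  rw [vertexMean, vertexMean, div_le_div_iff₀ hg₁ hg₂]
  simp only [vertexWeight, fieldSum] at hprod ⊢
  have f₁ := Real.exp_pos B₁
  have f₂ := Real.exp_pos B₂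
  have f₃ := Real.exp_pos (-B₁)
  have f₄ := Real.exp_pos (-B₂)
  have hlt : Real.exp B₁ * Real.exp (-B₂) < Real.exp (-B₁) * Real.exp B₂ :=
    mul_comm (Real.exp (-B₁)) _ ▸ mul_lt_mul (Real.exp_lt_exp.2 hB)
      (Real.exp_le_exp.2 (by linarith)) f₄ f₂.le
  set p1 := vertexFactor d b θ₁
  set q1 := vertexFactor d (-b) θ₁
  set p2 := vertexFactor d b θ₂
  set q2 := vertexFactor d (-b) θ₂
  have hcross : p1 * q2 ≤ p2 * q1 := by
    by_contra! hcon
    have := mul_pos (sub_pos.2 hlt) (sub_pos.2 hcon)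
    nlinarith
  have hfin : Real.exp B₁ * Real.exp (-B₂) * (p1 * q2) ≤
      Real.exp (-B₁) * Real.exp B₂ * (p2 * q1) :=
    mul_le_mul hlt.le hcross (by positivity) (by positivity)
  linarith

/-- The magnetization at the peak is at least `b ^ 2 * v`, its value for degree one in the zero
field: a nonnegative field and further half-edges can only increase it. -/
lemma IsPeak.le_vertexMean {d : ℕ} (hd : 2 ≤ d) {b B θ₀ v : ℝ} (h : IsPeak d b B θ₀)
    (hB : 0 ≤ B) (hv : 0 ≤ v) (hs : Real.sin θ₀ = b * v * Real.cos θ₀) :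
    b ^ 2 * v ≤ vertexMean d b B θ₀ := by
  have hg := h.weight_pos d
  have hc : 0 < Real.cos θ₀ := Real.cos_pos_of_mem_Ioo h.mem
  have hp := h.plus_pos
  have hm := h.minus_pos
  have e1 : halfEdgeFactor b θ₀ = Real.cos θ₀ * (1 + b ^ 2 * v) := by
    rw [halfEdgeFactor, hs]; ring
  have e2 : halfEdgeFactor (-b) θ₀ = Real.cos θ₀ * (1 - b ^ 2 * v) := by
    rw [halfEdgeFactor, hs]; ring
  have hle : halfEdgeFactor (-b) θ₀ ≤ halfEdgeFactor b θ₀ := by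
    rw [e1, e2]
    have : 0 ≤ b ^ 2 * v := by positivity
    nlinarith
  have hpow : ∀ c : ℝ, c ^ d = c ^ (d - 1) * c := fun c => by
    rw [← pow_succ]
    congr 1
    omega
  have hpm : (1 + b ^ 2 * v) * halfEdgeFactor (-b) θ₀ = (1 - b ^ 2 * v) * halfEdgeFactor b θ₀ := by
    rw [e1, e2]; ring
  have h1 : (1 + b ^ 2 * v) * (Real.exp (-B) * vertexFactor d (-b) θ₀) ≤
      (1 - b ^ 2 * v) * (Real.exp B * vertexFactor d b θ₀) := by
    have h2 : Real.exp (-B) * halfEdgeFactor (-b) θ₀ ^ (d - 1) ≤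
        Real.exp B * halfEdgeFactor b θ₀ ^ (d - 1) :=
      mul_le_mul (Real.exp_le_exp.2 (by linarith)) (pow_le_pow_left₀ hm.le hle _)
        (by positivity) (Real.exp_pos _).le
    have h3 : 0 ≤ (1 - b ^ 2 * v) * halfEdgeFactor b θ₀ := by
      rw [← hpm]; positivity
    have h4 := mul_le_mul_of_nonneg_right h2 h3
    rw [vertexFactor, vertexFactor, hpow, hpow (halfEdgeFactor b θ₀)]
    linear_combination h4 +
      Real.exp (-B) * halfEdgeFactor (-b) θ₀ ^ (d - 1) * hpm
  rw [vertexMean, le_div_iff₀ hg, vertexWeight, fieldSum]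
  linarith

/-- Above the phase transition there is a spontaneous magnetization: nondegeneracy of the peak
keeps the solution of the cavity equation above the zero of the cavity determinant. -/
lemma exists_isSpontaneousMagnetization {d : ℕ} (hd : 2 ≤ d) {β : ℝ} (hβ : 0 < β)
    (h : 1 < (d - 1) * Real.tanh β) : ∃ m, IsSpontaneousMagnetization d β m ∧ 0 < m := by
  have hw : 0 < Real.tanh β := by
    rw [Real.tanh_eq_sinh_div_cosh]
    exact div_pos (Real.sinh_pos_iff.2 hβ) (Real.cosh_pos β)
  have hw1 := Real.tanh_lt_one β
  have hb0 : 0 < √(Real.tanh β) := Real.sqrt_pos.2 hw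
  have hb1 : √(Real.tanh β) < 1 := by
    rw [Real.sqrt_lt' one_pos]
    simpa using hw1
  have hbsq : √(Real.tanh β) ^ 2 = Real.tanh β := Real.sq_sqrt hw.le
  have hex : ∀ B : ℝ, ∃ θ, 0 < B → IsPeak d √(Real.tanh β) B θ ∧
      (0 < √(Real.tanh β) → ∃ v, 0 ≤ v ∧ Real.sin θ = √(Real.tanh β) * v * Real.cos θ ∧
        0 < cavityDet d (√(Real.tanh β) ^ 2) v) := by
    intro B
    by_cases hB : 0 < B
    · obtain ⟨θ, hθ⟩ := exists_isPeak_of_nonneg hd hb0.le hb1 hB.le (Or.inl hB)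
      exact ⟨θ, fun _ => hθ⟩
    · exact ⟨0, fun h => absurd h hB⟩
  choose T hT using hex
  set w := Real.tanh β with hwdef
  set M : ℝ → ℝ := fun B => vertexMean d √w B (T B) with hM
  -- the zero of the cavity determinant
  set v₀ := √(((d - 1) * w - 1) / ((d - 1) * w - w ^ 2)) with hv₀
  have hden : 0 < (d - 1) * w - w ^ 2 := by nlinarith
  have hv₀pos : 0 < v₀ := Real.sqrt_pos.2 (div_pos (by linarith) hden)
  have hlow : ∀ B, 0 < B → w * v₀ ≤ M B := by
    intro B hB
    obtain ⟨hpk, hv⟩ := hT B hB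
    obtain ⟨v, hv0, hsv, hdet⟩ := hv hb0
    have h1 := hpk.le_vertexMean hd hB.le hv0 hsv
    rw [hbsq] at h1 hdet
    refine le_trans (mul_le_mul_of_nonneg_left ?_ hw.le) h1
    rw [hv₀, Real.sqrt_le_left hv0, div_le_iff₀ hden]
    rw [cavityDet] at hdet
    linarith
  have hmono : MonotoneOn M (Set.Ioi 0) := by
    intro x hx y hy hxy
    rcases hxy.lt_or_eq with hlt | rfl
    · exact (hT x hx).1.vertexMean_mono (hT y hy).1 hlt
    · exact le_rfl
  have hbdd : BddBelow (M '' Set.Ioi 0) := ⟨w * v₀, by rintro _ ⟨B, hB, rfl⟩; exact hlow B hB⟩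
  have hlim := hmono.tendsto_nhdsGT hbdd
  refine ⟨sInf (M '' Set.Ioi 0), ⟨M, fun B hB => ?_, hlim⟩, ?_⟩
  · exact (hT B hB).1.tendsto_annealedMagnetization hβ.le
  · refine lt_of_lt_of_le (mul_pos hw hv₀pos) (ge_of_tendsto hlim ?_)
    filter_upwards [self_mem_nhdsWithin] with B hB
    exact hlow B hB

/-- Below the critical inverse temperature there is no phase transition. At the threshold
`(d - 1) * tanh β = 1` itself, larger inverse temperatures still have a spontaneous
magnetization, so the inequality is strict. -/
lemma mul_tanh_lt_one_of_lt_criticalBeta {d : ℕ} (hd : 2 ≤ d) {β : ℝ} (hβ : 0 < β)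
    (h : (β : EReal) < criticalBeta d) : (d - 1) * Real.tanh β < 1 := by
  by_contra! hcon
  obtain ⟨x, hx1, hx2⟩ := EReal.lt_iff_exists_real_btwn.1 h
  have hx : β < x := by exact_mod_cast hx1
  have hd' : (0 : ℝ) < d - 1 := by
    have : (2 : ℝ) ≤ d := by exact_mod_cast hd
    linarith
  have htanh : Real.tanh β < Real.tanh x := by
    rw [← Real.artanh_lt_artanh_iff ⟨Real.neg_one_lt_tanh _, Real.tanh_lt_one _⟩
      ⟨Real.neg_one_lt_tanh _, Real.tanh_lt_one _⟩, Real.artanh_tanh, Real.artanh_tanh]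
    exact hx
  obtain ⟨m, hm⟩ := exists_isSpontaneousMagnetization hd (hβ.trans hx)
    (hcon.trans_lt (mul_lt_mul_of_pos_left htanh hd'))
  exact absurd hx2 (not_lt.2 (sInf_le ⟨x, rfl, hβ.trans hx, m, hm⟩))

lemma IsPeak.peakVariance_nonneg {d : ℕ} {b B θ₀ : ℝ} (h : IsPeak d b B θ₀) :
    0 ≤ peakVariance d b B θ₀ := by
  have h1 : vertexMean d b B θ₀ ^ 2 ≤ 1 := (sq_le_one_iff_abs_le_one _).2 h.abs_vertexMean_le
  have h2 := div_nonneg (sq_nonneg (vertexMean' d b B θ₀)) h.curvature_pos.le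
  rw [peakVariance]
  linarith

end AnnealedIsing

end

theorem theorem1p3 (d : ℕ) (hd : 2 ≤ d) (β B : ℝ)
    (hU : (β, B) ∈ AnnealedIsing.uniquenessRegion d) :
    ∃ χ : ℝ≥0, AnnealedIsing.IsSusceptibility d β B χ ∧
      TendstoInDistribution
        (fun (n : ℕ) (σ : AnnealedIsing.Config n) =>
          (AnnealedIsing.totalSpin σ -
            ∫ τ, AnnealedIsing.totalSpin τ ∂(AnnealedIsing.annealedMeasure d n β B)) / √(n : ℝ))
        atTop (id : ℝ → ℝ)
        (fun n => AnnealedIsing.annealedMeasure d n β B) (gaussianReal 0 χ) := by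
  obtain ⟨hβ, hB⟩ : 0 ≤ β ∧ (B ≠ 0 ∨ (d - 1) * √(Real.tanh β) ^ 2 < 1) := by
    rcases hU with ⟨h1, h2⟩ | ⟨h1, h2, -⟩
    · exact ⟨h1, Or.inl h2⟩
    · refine ⟨h1.le, Or.inr ?_⟩
      rw [Real.sq_sqrt (AnnealedIsing.tanh_nonneg h1.le)]
      exact AnnealedIsing.mul_tanh_lt_one_of_lt_criticalBeta hd h1 h2
  have hb1 : √(Real.tanh β) < 1 := by
    rw [Real.sqrt_lt' one_pos]
    simpa using Real.tanh_lt_one β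
  set b := √(Real.tanh β) with hb
  -- the fields for which the weight of a vertex has a peak form an open set
  set G : Set ℝ := {x | x ≠ 0 ∨ (d - 1) * b ^ 2 < 1} with hG
  have hGopen : IsOpen G := by
    have : G = {x | x ≠ 0} ∪ {_x | (d - 1) * b ^ 2 < 1} := rfl
    rw [this]
    exact isOpen_ne.union isOpen_const
  have hex : ∀ x : ℝ, ∃ θ, x ∈ G → AnnealedIsing.IsPeak d b x θ := by
    intro x
    by_cases hx : x ∈ G
    · obtain ⟨θ, hθ⟩ := AnnealedIsing.exists_isPeak hd (Real.sqrt_nonneg _) hb1 hx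
      exact ⟨θ, fun _ => hθ⟩
    · exact ⟨0, fun h => absurd h hx⟩
  choose T hT using hex
  have hTnear : ∀ x ∈ G, ∀ᶠ y in 𝓝 x, AnnealedIsing.IsPeak d b y (T y) := fun x hx =>
    Filter.Eventually.mono (hGopen.mem_nhds hx) fun y hy => hT y hy
  have hpk := hT B hB
  refine ⟨⟨AnnealedIsing.peakVariance d b B (T B), hpk.peakVariance_nonneg⟩,
    ⟨hpk.tendsto_annealedSusceptibility hβ, fun x => AnnealedIsing.vertexMean d b x (T x), ?_,
      hpk.hasDerivAt_vertexMean (hTnear B hB)⟩, hpk.tendstoInDistribution hβ rfl⟩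
  filter_upwards [hGopen.mem_nhds hB] with x hx
  have h1 := (((hT x hx).hasDerivAt_log_weight (hTnear x hx)).const_add
    (β * d / 2 - d * (Real.log (1 + Real.tanh β) / 2)))
  refine h1.congr_of_eventuallyEq ?_
  filter_upwards [hTnear x hx] with y hy
  exact hy.pressure_eq hd hβ
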